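/- **Setting.** Let $T>0$, $d\in\mathbb N$, $\mathbb T^d=\mathbb R^d/\mathbb Z^d$. An *algebra with mean value* is a closed subalgebra $\mathcal A$ of the complex-valued bounded uniformly continuous functions on $\mathbb R$ (sup norm) that is closed under complex conjugation (a $C^*$-algebra), contains the constants, is translation invariant, and each of whose elements $f$ has a mean value $M(f)\in\mathbb C$: $f(\cdot/\varepsilon)\rightharpoonup M(f)$ weakly-$*$ in $L^\infty(\mathbb R)$ as $\varepsilon\to0$. Let $\Delta(\mathcal A)$ be its spectrum (the characters of $\mathcal A$, with the weak-$*$ topology), $\widehat f(s)=s(f)$ the Gelfand transform, and $\beta$ the Radon probability measure on $\Delta(\mathcal A)$ with $M(f)=\int\widehat f\,d\beta$ for all $f\in\mathcal A$. Let $\Phi:\mathbb R\times\mathbb R^d\to\mathbb R^d$, $(\tau,x)\mapsto\Phi_\tau(x)$, satisfy: (i) $\Phi$ is $C^1$; (ii) $\Phi_t\circ\Phi_s=\Phi_{t+s}$ for all $t,s\in\mathbb R$; (iii) the Jacobian matrix of the backward flow, $J(\tau,x)=\big(\partial\Phi^i_{-\tau}/\partial x_j(x)\big)_{i,j}$, satisfies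 $\sup_{x\in K}\sup_{\tau\in\mathbb R}|J(\tau,x)|<\infty$ for every compact $K\subset\mathbb R^d$; (iv) $\det J(\tau,x)=1$ for all $\tau,x$. Let $\varepsilon$ run through a sequence of positive numbers tending to $0$. A sequence $w^\varepsilon\in L^2((0,T)\times\mathbb R^d)$ *weakly $\Sigma$-converges along $\Phi_\tau$* to $w_0\in L^2((0,T)\times\mathbb R^d\times\Delta(\mathcal A)\times\mathbb T^d)$ if $$\lim_{\varepsilon\to0}\iint_{(0,T)\times\mathbb R^d} w^\varepsilon(t,x)\,\psi\Big(t,\Phi_{-t/\varepsilon}(x),\frac t\varepsilon,\frac x\varepsilon\Big)\,dx\,dt=\iiiint w_0(t,X,s,y)\,\widehat\psi(t,X,s,y)\,dy\,d\beta(s)\,dX\,dt$$ for every smooth test function $\psi(t,X,\tau,y)$ with values in $\mathcal A$ in the variable $\tau$, i.e. every $\psi\in C^\infty((0,T)\times\mathbb R^d\times\mathbb T^d;\mathcal A)$ with compact support (here $\widehat\psi$ is the Gelfand transform in $\tau$). For vector-valued sequences this is understood componentwise. **Proposition.** Let $\mathcal A$ be an algebra with mean value and $\Phi_\tau$ a flow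 satisfying (i)–(iv), and suppose that the entries of $\widetilde J(\tau,X):=J(\tau,\Phi_\tau(X))$ belong to $C(\mathbb R^d;\mathcal A)$, i.e. $X\mapsto\widetilde J(\cdot,X)$ is continuous from $\mathbb R^d$ into $\mathcal A^{d\times d}$. Let $u^\varepsilon$ be a bounded sequence in $L^2((0,T)\times\mathbb R^d)$ with weak spatial gradients $\nabla u^\varepsilon\in L^2((0,T)\times\mathbb R^d)^d$, and suppose that $u^\varepsilon$ and $\nabla u^\varepsilon$ weakly $\Sigma$-converge along $\Phi_\tau$ to $u_0$ and $v_0$, respectively, as $\varepsilon\to0$. Then $u_0=u_0(t,X,s)$ does not depend on $y$, it has a weak gradient $\nabla_Xu_0$ (for almost every $(t,s)$, a locally integrable function of $X$), and there is $u_1(t,X,s,y)\in L^2\big((0,T)\times\mathbb R^d\times\Delta(\mathcal A);H^1(\mathbb T^d)\big)$ such that, almost everywhere, $$v_0(t,X,s,y)={}^{\top}\widehat{\widetilde J}(s,X)\,\nabla_Xu_0(t,X,s)+\nabla_yu_1(t,X,s,y).$$ -/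

import Mathlib

open MeasureTheory Filter Topology Set WeakDual
open scoped BoundedContinuousFunction ContDiff CompactlySupported

namespace SigmaFlow

/-! ### Algebras with mean value -/

/-- `f (· / ε)` converges to the constant `m` in the weak-* topology of `L^∞(ℝ)` as `ε → 0+`. -/
def HasMeanValue (f : ℝ → ℂ) (m : ℂ) : Prop :=
  ∀ g : ℝ → ℂ, Integrable g →
    Tendsto (fun ε : ℝ => ∫ τ, f (τ / ε) * g τ) (𝓝[>] 0) (𝓝 (m * ∫ τ, g τ))

/-- An algebra with mean value: a closed `*`-subalgebra of `BUC(ℝ)`, containing the constants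
(part of `StarSubalgebra`), translation invariant, all of whose elements have a mean value. -/
structure MeanValueAlgebra where
  carrier : StarSubalgebra ℂ (ℝ →ᵇ ℂ)
  isClosed : IsClosed (carrier : Set (ℝ →ᵇ ℂ))
  uniformContinuous : ∀ f ∈ carrier, UniformContinuous f
  translate : ∀ f ∈ carrier, ∀ a : ℝ, ∃ g ∈ carrier, ∀ τ, g τ = f (τ - a)
  mean_value : ∀ f ∈ carrier, ∃ m : ℂ, HasMeanValue f m

namespace MeanValueAlgebra

variable (A : MeanValueAlgebra)

/-- The elements of the algebra, with the supremum norm. -/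
abbrev Elem : Type := A.carrier

instance : IsClosed (A.carrier : Set (ℝ →ᵇ ℂ)) := A.isClosed

/-- The mean value `M(f)`. -/
noncomputable def mean (f : A.Elem) : ℂ := (A.mean_value f.1 f.2).choose

theorem hasMeanValue_mean (f : A.Elem) : HasMeanValue f.1 (A.mean f) :=
  (A.mean_value f.1 f.2).choose_spec

/-- The indicator of `(0, 1]`, used to read off a mean value. -/
noncomputable def window : ℝ → ℂ := (Ioc (0 : ℝ) 1).indicator fun _ => 1

theorem integrable_window : Integrable window :=
  (integrable_indicator_iff measurableSet_Ioc).2 (integrableOn_const (by simp))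

theorem integral_window : ∫ τ, window τ = 1 := by
  simp [window, integral_indicator measurableSet_Ioc]

theorem tendsto_mean (f : A.Elem) :
    Tendsto (fun ε : ℝ => ∫ τ, f.1 (τ / ε) * window τ) (𝓝[>] 0) (𝓝 (A.mean f)) := by
  simpa [integral_window] using A.hasMeanValue_mean f window integrable_window

theorem integrable_mul_window (f : ℝ →ᵇ ℂ) (ε : ℝ) :
    Integrable fun τ => f (τ / ε) * window τ :=
  integrable_window.bdd_mul (c := ‖f‖)
    (f.continuous.comp (continuous_id.div_const ε)).aestronglyMeasurable
    (ae_of_all _ fun _ => f.norm_coe_le_norm _)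

theorem mean_add (f g : A.Elem) : A.mean (f + g) = A.mean f + A.mean g := by
  refine tendsto_nhds_unique (A.tendsto_mean _) (((A.tendsto_mean f).add (A.tendsto_mean g)).congr
    fun ε => ?_)
  rw [← integral_add (integrable_mul_window f.1 ε) (integrable_mul_window g.1 ε)]
  simp [add_mul]

theorem mean_smul (c : ℂ) (f : A.Elem) : A.mean (c • f) = c * A.mean f := by
  refine tendsto_nhds_unique (A.tendsto_mean _) (((A.tendsto_mean f).const_mul c).congr
    fun ε => ?_)
  rw [← integral_const_mul]
  simp [mul_assoc]

theorem mean_star_mul_self_nonneg (f : A.Elem) : 0 ≤ (A.mean (star f * f)).re := by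
  refine ge_of_tendsto (Complex.continuous_re.continuousAt.tendsto.comp (A.tendsto_mean _))
    (Eventually.of_forall fun ε => ?_)
  have h : ∀ τ, (star f * f).1 (τ / ε) * window τ
      = (((Ioc (0 : ℝ) 1).indicator (fun τ => ‖f.1 (τ / ε)‖ ^ 2) τ : ℝ) : ℂ) := by
    intro τ
    by_cases hτ : τ ∈ Ioc (0 : ℝ) 1
    · simp [window, hτ, ← Complex.conj_mul']
    · simp [window, hτ]
  simp only [Function.comp_apply, h]
  rw [integral_complex_ofReal, Complex.ofReal_re]
  exact integral_nonneg fun τ => indicator_nonneg (fun _ _ => by positivity) _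

theorem mean_one : A.mean 1 = 1 :=
  tendsto_nhds_unique (A.tendsto_mean 1) (by simp [integral_window])

/-! ### Spectrum, Gelfand transform and the measure `β` -/

/-- The spectrum `Δ(A)`: the characters of `A` with the weak-* topology. The Gelfand transform of
`f` is `s ↦ s f`. -/
abbrev Spectrum : Type := characterSpace ℂ A.Elem

noncomputable instance : MeasurableSpace A.Spectrum := borel _

instance : BorelSpace A.Spectrum := ⟨rfl⟩

/-- A real continuous function on `Δ(A)`, seen as a complex one. -/
noncomputable def complexify (h : C_c(A.Spectrum, ℝ)) : C(A.Spectrum, ℂ) :=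
  ⟨fun s => (h s : ℂ), Complex.continuous_ofReal.comp h.continuous⟩

/-- The functional on `C(Δ(A))` which the mean value induces through the inverse of the Gelfand
transform (every real continuous function on the compact space `Δ(A)` has compact support). -/
noncomputable def meanFunctional : C_c(A.Spectrum, ℝ) →ₚ[ℝ] ℝ :=
  PositiveLinearMap.mk₀
    { toFun := fun h => (A.mean ((gelfandStarTransform A.Elem).symm (A.complexify h))).re
      map_add' := by
        intro h k
        have : A.complexify (h + k) = A.complexify h + A.complexify k := by
          ext s; simp [complexify]
        rw [this, map_add, mean_add, Complex.add_re]
      map_smul' := by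
        intro c h
        have : A.complexify (c • h) = (c : ℂ) • A.complexify h := by
          ext s; simp [complexify]
        rw [this, map_smul, mean_smul]
        simp }
    (by
      intro h hh
      have hh' : ∀ s, 0 ≤ h s := hh
      let k : C(A.Spectrum, ℂ) := ⟨fun s => (Real.sqrt (h s) : ℂ),
        Complex.continuous_ofReal.comp (Real.continuous_sqrt.comp h.continuous)⟩
      have : A.complexify h = star k * k := by
        ext s
        simp [complexify, k, ← Complex.ofReal_mul, Real.mul_self_sqrt (hh' s)]
      change 0 ≤ (A.mean ((gelfandStarTransform A.Elem).symm (A.complexify h))).re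
      rw [this, map_mul, map_star]
      exact A.mean_star_mul_self_nonneg _)

/-- The Radon measure `β` on `Δ(A)` which represents the mean value. -/
noncomputable def beta : Measure A.Spectrum := RealRMK.rieszMeasure A.meanFunctional

theorem integral_beta_ofReal (h : C_c(A.Spectrum, ℝ)) :
    ∫ s, h s ∂A.beta = (A.mean ((gelfandStarTransform A.Elem).symm (A.complexify h))).re :=
  RealRMK.integral_rieszMeasure A.meanFunctional h

theorem mean_star (f : A.Elem) : A.mean (star f) = starRingEnd ℂ (A.mean f) := by
  refine tendsto_nhds_unique (A.tendsto_mean _)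
    (((Complex.continuous_conj.tendsto _).comp (A.tendsto_mean f)).congr fun ε => ?_)
  simp only [Function.comp_apply]
  rw [← integral_conj]
  refine integral_congr_ae (ae_of_all _ fun τ => ?_)
  by_cases hτ : τ ∈ Ioc (0 : ℝ) 1
  · simp [window, hτ]
  · simp [window, hτ]

theorem mean_symm_complexify (h : C_c(A.Spectrum, ℝ)) :
    A.mean ((gelfandStarTransform A.Elem).symm (A.complexify h))
      = ((∫ s, h s ∂A.beta : ℝ) : ℂ) := by
  rw [integral_beta_ofReal]
  refine (Complex.conj_eq_iff_re.1 ?_).symm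
  rw [← mean_star, ← map_star]
  congr 2
  ext s
  simp [complexify]

/-- The measure `β` is a probability measure. -/
instance : IsProbabilityMeasure A.beta := by
  have h1 := A.mean_symm_complexify (CompactlySupportedContinuousMap.continuousMapEquiv 1)
  have h2 : A.complexify (CompactlySupportedContinuousMap.continuousMapEquiv 1) = 1 := by
    ext s; simp [complexify]
  rw [h2, map_one, mean_one] at h1
  have h3 : A.beta.real univ = 1 := by
    have : (∫ _s : A.Spectrum, (1 : ℝ) ∂A.beta) = 1 := by
      simpa using (Complex.ofReal_injective (by simpa using h1) :
        (1 : ℝ) = ∫ _s : A.Spectrum, (1 : ℝ) ∂A.beta).symm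
    simpa using this
  exact ⟨(ENNReal.toReal_eq_one_iff _).1 h3⟩

/-- The measure `β` represents the mean value. -/
theorem integral_beta (f : A.Elem) : ∫ s : A.Spectrum, s f ∂A.beta = A.mean f := by
  let F : C(A.Spectrum, ℂ) := gelfandStarTransform A.Elem f
  let hr : C_c(A.Spectrum, ℝ) := CompactlySupportedContinuousMap.continuousMapEquiv
    ⟨fun s => (F s).re, Complex.continuous_re.comp F.continuous⟩
  let hi : C_c(A.Spectrum, ℝ) := CompactlySupportedContinuousMap.continuousMapEquiv
    ⟨fun s => (F s).im, Complex.continuous_im.comp F.continuous⟩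
  have hF : F = A.complexify hr + Complex.I • A.complexify hi := by
    ext s
    simp [complexify, hr, hi, mul_comm Complex.I, Complex.re_add_im]
  have hf : f = (gelfandStarTransform A.Elem).symm (A.complexify hr)
      + Complex.I • (gelfandStarTransform A.Elem).symm (A.complexify hi) := by
    rw [← map_smul, ← map_add, ← hF]
    exact ((gelfandStarTransform A.Elem).symm_apply_apply f).symm
  have hint : Integrable (fun s : A.Spectrum => s f) A.beta :=
    F.continuous.integrable_of_hasCompactSupport (HasCompactSupport.of_compactSpace _)
  conv_rhs => rw [hf]
  rw [mean_add, mean_smul, mean_symm_complexify, mean_symm_complexify,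
    ← integral_re_add_im hint, mul_comm]
  rfl

end MeanValueAlgebra
/-! ### Flows -/

/-- `ℝ^d` with its Euclidean structure. -/
abbrev Space (d : ℕ) : Type := EuclideanSpace ℝ (Fin d)

/-- The standard basis vector `e_i`. -/
noncomputable def basisVec {d : ℕ} (i : Fin d) : Space d := EuclideanSpace.single i 1

/-- The Jacobian matrix of the backward flow: `J(τ, x)_{ij} = ∂Φ^i_{-τ} / ∂x_j (x)`. -/
noncomputable def jacobian {d : ℕ} (Φ : ℝ → Space d → Space d) (τ : ℝ) (x : Space d) :
    Matrix (Fin d) (Fin d) ℝ :=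
  Matrix.of fun i j => fderiv ℝ (Φ (-τ)) x (basisVec j) i

/-- A `C^1` volume preserving flow whose Jacobian matrix is bounded uniformly in `τ ∈ ℝ`, locally
uniformly in `x`. -/
structure IsAdmissibleFlow {d : ℕ} (Φ : ℝ → Space d → Space d) : Prop where
  contDiff : ContDiff ℝ 1 fun p : ℝ × Space d => Φ p.1 p.2
  group : ∀ (t s : ℝ) (x : Space d), Φ t (Φ s x) = Φ (t + s) x
  jacobian_bounded : ∀ K : Set (Space d), IsCompact K →
    ∃ C : ℝ, ∀ x ∈ K, ∀ (τ : ℝ) (i j : Fin d), |jacobian Φ τ x i j| ≤ C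
  det_jacobian : ∀ (τ : ℝ) (x : Space d), (jacobian Φ τ x).det = 1

/-! ### Weak gradients -/

/-- `g` is the weak gradient of `f` on `ℝ^d`. -/
def HasWeakGradient {d : ℕ} (f : Space d → ℂ) (g : Fin d → Space d → ℂ) : Prop :=
  LocallyIntegrable f ∧ (∀ i, LocallyIntegrable (g i)) ∧
    ∀ φ : Space d → ℂ, ContDiff ℝ ∞ φ → HasCompactSupport φ → ∀ i,
      ∫ x, f x * fderiv ℝ φ x (basisVec i) = -∫ x, g i x * φ x

/-- `φ` is `ℤ^d`-periodic, i.e. it is a function on the torus `𝕋^d = ℝ^d / ℤ^d`. -/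
def IsPeriodic {d : ℕ} {α : Type*} (φ : Space d → α) : Prop :=
  ∀ (y : Space d) (i : Fin d), φ (y + basisVec i) = φ y

/-- The unit cell `[0, 1)^d`. Integrals and almost-everywhere statements over the torus `𝕋^d` are
expressed over the unit cell. -/
def cell (d : ℕ) : Set (Space d) := {y | ∀ i, y i ∈ Ico (0 : ℝ) 1}

/-- `g` is the weak gradient of `f` on the torus `𝕋^d`. -/
def HasTorusWeakGradient {d : ℕ} (f : Space d → ℂ) (g : Fin d → Space d → ℂ) : Prop :=
  IntegrableOn f (cell d) ∧ (∀ i, IntegrableOn (g i) (cell d)) ∧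
    ∀ φ : Space d → ℂ, ContDiff ℝ ∞ φ → IsPeriodic φ → ∀ i,
      ∫ y in cell d, f y * fderiv ℝ φ y (basisVec i) = -∫ y in cell d, g i y * φ y

/-! ### Convergence along a flow -/

section Convergence

variable (A : MeanValueAlgebra) (d : ℕ) (T : ℝ)

/-- The measure on `(0,T) × ℝ^d`. -/
noncomputable def measTX : Measure (ℝ × Space d) :=
  (volume.restrict (Ioo 0 T)).prod volume

/-- The measure on `(0,T) × ℝ^d × Δ(A)`. -/
noncomputable def measTXS : Measure (ℝ × Space d × A.Spectrum) :=
  (volume.restrict (Ioo 0 T)).prod (volume.prod A.beta)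

/-- The measure on `(0,T) × ℝ^d × Δ(A) × 𝕋^d`. -/
noncomputable def measTXSY : Measure (ℝ × Space d × A.Spectrum × Space d) :=
  (volume.restrict (Ioo 0 T)).prod (volume.prod (A.beta.prod (volume.restrict (cell d))))

/-- A smooth test function `ψ(t, X, τ, y)`, compactly supported in `(t, X) ∈ (0,T) × ℝ^d`, periodic
in `y` and in the algebra `A` as a function of `τ`: a smooth `A`-valued map of `(t, X, y)`. -/
structure IsTestFunction (ψ : ℝ × Space d × Space d → A.Elem) : Prop where
  contDiff : ContDiff ℝ ∞ ψ
  periodic : ∀ (t : ℝ) (X : Space d), IsPeriodic fun y => ψ (t, X, y)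
  support : ∃ K : Set (ℝ × Space d), IsCompact K ∧ K ⊆ Ioo 0 T ×ˢ univ ∧
    ∀ (t : ℝ) (X y : Space d), (t, X) ∉ K → ψ (t, X, y) = 0

/-- The sequence `u n`, attached to the scales `ε n`, in `L²((0,T) × ℝ^d)` weakly `Σ`-converges along
the flow `Φ` to `u₀ ∈ L²((0,T) × ℝ^d × Δ(A) × 𝕋^d)`. -/
def SigmaConverges (Φ : ℝ → Space d → Space d) (ε : ℕ → ℝ) (u : ℕ → ℝ × Space d → ℂ)
    (u₀ : ℝ × Space d × A.Spectrum × Space d → ℂ) : Prop :=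
  (∀ n, MemLp (u n) 2 (measTX d T)) ∧ MemLp u₀ 2 (measTXSY A d T) ∧
    ∀ ψ : ℝ × Space d × Space d → A.Elem, IsTestFunction A d T ψ →
      Tendsto
        (fun n => ∫ p, u n p *
          (ψ (p.1, Φ (-(p.1 / ε n)) p.2, (ε n)⁻¹ • p.2)).1 (p.1 / ε n) ∂(measTX d T))
        atTop
        (𝓝 (∫ q, u₀ q * q.2.2.1 (ψ (q.1, q.2.1, q.2.2.2)) ∂(measTXSY A d T)))

end Convergence

end SigmaFlow

/-! The proof tests `gradu` against `osc`, the products g(t) e_k(x/ε) F(Φ_{-t/ε}(x))(t/ε) with e_k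
an exponential on the torus, and integrates by parts in x. Differentiating F along the flow costs
O(1) and produces the columns of `Jt`; differentiating e_k produces the singular factor 2πi k_i/ε
(`IsFlowJacobian.fderiv_osc`). The structure of the limit is read off one Fourier mode in y at a
time.

Multiplying by ε leaves only the singular term in the limit, so every nonzero mode of u₀ vanishes
(`integral_limit_eq_zero`). Combining the components of the gradient with a vector ξ orthogonal to k
cancels the singular term before the limit (`sum_integral_limit`). For k ≠ 0 what remains involves
only the vanishing mode of u₀, so the mode k of v₀ is parallel to k. It is therefore the mode of a
gradient, and dividing by 2πi k_i and summing the series gives u₁ (`exists_potential_coeff`,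
`exists_corrector`).

For k = 0 every ξ is allowed. With U and V the zero modes of u₀ and v₀, the limit says, for almost
every (t, s), that ∫ V_i φ + U ∑_j s(J_ji) ∂_jφ = 0, a weak form of V = ᵀJ ∇U. The difficulty is to
invert it: J is merely continuous in X, so multiplying φ by entries of J⁻¹ does not give an
admissible test function.

The remedy is to change coordinates. Since det J = 1, the matrix J⁻¹ is the adjugate of J and has
entries in the algebra. Integrating it along segments shows that Φ_τ(X) - Φ_τ(0) belongs to the
algebra as a function of τ, so every character s has a C¹ limit map W_s (`chart`) with derivative
s(J⁻¹). Uniform separation of points and a form of volume preservation hold for the flow uniformly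
in τ, and pass to all s because evaluations are dense in the spectrum (`exists_chart_separation`,
`exists_integral_bump_chart`). In the coordinates W_s the identity says that V_i is the i-th partial
derivative of U. Mollifying with kernels b(W_s(X) - W_s(Z)), which are admissible tests, turns this
into an ordinary weak gradient (`hasWeakGradient_of_chart`).

The null sets obtained for single test functions are merged through a countable C¹-dense family
(`exists_countable_test`). -/

namespace SigmaFlow

/-! ### Determining classes of test functions -/

/-- Integrals against the functions of `F` determine an integrable function. -/
def Determining {X : Type*} [MeasurableSpace X] (μ : Measure X) (F : Set (X → ℂ)) : Prop :=
  ∀ k : X → ℂ, Integrable k μ → (∀ f ∈ F, ∫ x, k x * f x ∂μ = 0) → k =ᵐ[μ] 0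

/-- Rectangles form a π-system generating the product σ-algebra. Arguing with measurable rectangles
avoids any topology on the product, which matters because the spectrum need not be second countable.
-/
theorem ae_eq_zero_of_forall_setIntegral_prod_eq_zero {X Y : Type*} [MeasurableSpace X]
    [MeasurableSpace Y] {μ : Measure X} {ν : Measure Y} {k : X × Y → ℂ}
    (hk : Integrable k (μ.prod ν))
    (h : ∀ S T, MeasurableSet S → MeasurableSet T → ∫ p in S ×ˢ T, k p ∂(μ.prod ν) = 0) :
    k =ᵐ[μ.prod ν] 0 := by
  suffices H : ∀ s, MeasurableSet s → ∫ p in s, k p ∂(μ.prod ν) = 0 from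
    hk.ae_eq_zero_of_forall_setIntegral_eq_zero fun s hs _ => H s hs
  intro s hs
  induction s, hs using MeasurableSpace.induction_on_inter generateFrom_prod.symm isPiSystem_prod with
  | empty => simp
  | basic t ht =>
    obtain ⟨S, hS, T, hT, rfl⟩ := ht
    exact h S T hS hT
  | compl t ht ih =>
    have h1 : ∫ p, k p ∂(μ.prod ν) = 0 := by
      simpa using h univ univ MeasurableSet.univ MeasurableSet.univ
    simpa [ih, h1] using integral_add_compl ht hk
  | iUnion g gd gm ih => simp [integral_iUnion gm gd hk.integrableOn, ih]

/-- Fubini, one variable at a time: for fixed g the partial integral of k·g over y is killed by F,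
hence zero. Integrating it over a set S and swapping, the partial integral of k over S is killed by
G. So k integrates to zero over rectangles. -/
theorem Determining.prod {X Y : Type*} [MeasurableSpace X] [MeasurableSpace Y] {μ : Measure X}
    {ν : Measure Y} [SFinite μ] [SFinite ν] {F : Set (X → ℂ)} {G : Set (Y → ℂ)}
    (hF : Determining μ F) (hG : Determining ν G)
    (bF : ∀ f ∈ F, AEStronglyMeasurable f μ ∧ ∃ C, ∀ x, ‖f x‖ ≤ C)
    (bG : ∀ g ∈ G, AEStronglyMeasurable g ν ∧ ∃ C, ∀ x, ‖g x‖ ≤ C) :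
    Determining (μ.prod ν) (image2 (fun f g p => f p.1 * g p.2) F G) := by
  intro k hk h
  refine ae_eq_zero_of_forall_setIntegral_prod_eq_zero hk fun S T hS hT => ?_
  have key : (fun y => ∫ x in S, k (x, y) ∂μ) =ᵐ[ν] 0 := by
    have hkS : Integrable k ((μ.restrict S).prod ν) := by
      rw [Measure.restrict_prod_eq_prod_univ]
      exact hk.integrableOn
    refine hG _ hkS.integral_prod_right fun g hg => ?_
    obtain ⟨gm, C, hC⟩ := bG g hg
    have hkg : Integrable (fun p : X × Y => k p * g p.2) (μ.prod ν) :=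
      hk.mul_bdd gm.comp_snd (ae_of_all _ fun p => hC p.2)
    have h1 : (fun x => ∫ y, k (x, y) * g y ∂ν) =ᵐ[μ] 0 := by
      refine hF _ hkg.integral_prod_left fun f hf => ?_
      obtain ⟨fm, D, hD⟩ := bF f hf
      have hkgf : Integrable (fun p : X × Y => k p * g p.2 * f p.1) (μ.prod ν) :=
        hkg.mul_bdd fm.comp_fst (ae_of_all _ fun p => hD p.1)
      rw [← h _ (mem_image2_of_mem hf hg)]
      simp_rw [← integral_mul_const]
      rw [← integral_prod _ hkgf]
      exact integral_congr_ae (ae_of_all _ fun p => by ring)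
    have hkgS : Integrable (fun p : X × Y => k p * g p.2) ((μ.restrict S).prod ν) :=
      hkS.mul_bdd gm.comp_snd (ae_of_all _ fun p => hC p.2)
    simp_rw [← integral_mul_const]
    rw [← integral_integral_swap (f := fun x y => k (x, y) * g y) hkgS]
    exact integral_eq_zero_of_ae (ae_restrict_of_ae h1)
  rw [setIntegral_prod _ hk.integrableOn, integral_integral_swap]
  · exact integral_eq_zero_of_ae (ae_restrict_of_ae key)
  · have := hk.integrableOn (s := S ×ˢ T)
    rwa [IntegrableOn, ← Measure.prod_restrict] at this

/-- A closed set has open neighbourhoods of nearly the same measure, and a Urysohn function between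
the two replaces its indicator at the cost of ∫ ‖k‖ over the thin difference. -/
theorem determining_continuous {X : Type*} [TopologicalSpace X] [NormalSpace X]
    [MeasurableSpace X] [BorelSpace X] (μ : Measure X) [IsFiniteMeasure μ] [μ.OuterRegular] :
    Determining μ {f | Continuous f ∧ ∃ C, ∀ x, ‖f x‖ ≤ C} := by
  intro k hk h
  refine ae_eq_zero_of_forall_setIntegral_isClosed_eq_zero hk fun S hS => ?_
  have hV : ∀ n : ℕ, ∃ V, S ⊆ V ∧ IsOpen V ∧ μ (V \ S) ≤ ((n : ENNReal) + 1)⁻¹ := by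
    intro n
    obtain ⟨V, hSV, hVo, hV⟩ := S.exists_isOpen_lt_add (measure_ne_top μ S)
      (ε := ((n : ENNReal) + 1)⁻¹) (by simp)
    refine ⟨V, hSV, hVo, ?_⟩
    rw [measure_sdiff hSV hS.measurableSet.nullMeasurableSet (measure_ne_top μ S)]
    exact tsub_le_iff_left.2 hV.le
  choose V hSV hVo hV using hV
  have hlim : Tendsto (fun n => ∫ x in V n \ S, ‖k x‖ ∂μ) atTop (𝓝 0) := by
    refine hk.norm.tendsto_setIntegral_nhds_zero ?_
    refine tendsto_of_tendsto_of_tendsto_of_le_of_le tendsto_const_nhds ?_ (fun _ => zero_le)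
      hV
    have := (tendsto_add_atTop_iff_nat 1).2 ENNReal.tendsto_inv_nat_nhds_zero
    simpa using this
  refine norm_le_zero_iff.1 (ge_of_tendsto hlim (Eventually.of_forall fun n => ?_))
  obtain ⟨f, hf0, hf1, hf⟩ := exists_continuous_zero_one_of_isClosed (hVo n).isClosed_compl hS
    (disjoint_compl_left_iff_subset.2 (hSV n))
  have hfb : ∀ x, ‖(f x : ℂ)‖ ≤ 1 := fun x => by
    rw [Complex.norm_real, Real.norm_of_nonneg (hf x).1]; exact (hf x).2
  have hfc : Continuous fun x => (f x : ℂ) := Complex.continuous_ofReal.comp f.continuous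
  have hkf : Integrable (fun x => k x * f x) μ :=
    hk.mul_bdd hfc.aestronglyMeasurable (ae_of_all _ hfb)
  have h0 := h (fun x => (f x : ℂ)) ⟨hfc, 1, hfb⟩
  have h1 : ∫ x, k x * f x ∂μ = ∫ x in S, k x ∂μ + ∫ x in V n \ S, k x * f x ∂μ := by
    rw [← integral_add_compl hS.measurableSet hkf]
    congr 1
    · exact setIntegral_congr_fun hS.measurableSet fun x hx => by simp [hf1 hx]
    · refine (setIntegral_eq_of_subset_of_forall_sdiff_eq_zero hS.measurableSet.compl
        (fun x hx => hx.2) fun x hx => ?_)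
      have : x ∉ V n := fun hxV => hx.2 ⟨hxV, hx.1⟩
      simp [hf0 this]
  rw [h0] at h1
  rw [eq_neg_of_add_eq_zero_left h1.symm, norm_neg]
  refine (norm_integral_le_integral_norm _).trans (integral_mono hkf.norm.integrableOn
    hk.norm.integrableOn fun x => ?_)
  rw [norm_mul]
  exact mul_le_of_le_one_right (norm_nonneg _) (hfb x)

theorem determining_contDiff (d : ℕ) :
    Determining (volume : Measure (Space d)) {φ | ContDiff ℝ ∞ φ ∧ HasCompactSupport φ} := by
  intro k hk h
  refine ae_eq_zero_of_integral_contDiff_smul_eq_zero hk.locallyIntegrable fun g hg hgc => ?_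
  rw [← h (fun x => (g x : ℂ)) ⟨Complex.ofRealCLM.contDiff.comp hg,
    hgc.comp_left (g := fun r : ℝ => (r : ℂ)) Complex.ofReal_zero⟩]
  exact integral_congr_ae (ae_of_all _ fun x => by simp [mul_comm])

theorem determining_contDiff_Ioo (T : ℝ) :
    Determining (volume.restrict (Ioo 0 T))
      {g : ℝ → ℂ | ContDiff ℝ ∞ g ∧ HasCompactSupport g ∧ tsupport g ⊆ Ioo 0 T} := by
  intro k hk h
  refine (ae_restrict_iff' measurableSet_Ioo).2
    (isOpen_Ioo.ae_eq_zero_of_integral_contDiff_smul_eq_zero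
      (IntegrableOn.locallyIntegrableOn hk) fun g hg hgc hgs => ?_)
  have hz : HasCompactSupport (fun x => (g x : ℂ)) :=
    hgc.comp_left (g := fun r : ℝ => (r : ℂ)) Complex.ofReal_zero
  have hs : tsupport (fun x => (g x : ℂ)) ⊆ Ioo 0 T :=
    (tsupport_comp_subset (g := fun r : ℝ => (r : ℂ)) Complex.ofReal_zero g).trans hgs
  rw [← h (fun x => (g x : ℂ)) ⟨Complex.ofRealCLM.contDiff.comp hg, hz, hs⟩]
  rw [setIntegral_eq_integral_of_forall_compl_eq_zero]
  · exact integral_congr_ae (ae_of_all _ fun x => by simp [mul_comm])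
  · intro x hx
    have : g x = 0 := image_eq_zero_of_notMem_tsupport fun hx' => hx (hgs hx')
    simp [this]

namespace MeanValueAlgebra

instance (A : MeanValueAlgebra) : A.beta.Regular := by unfold beta; infer_instance

/-- By Gelfand–Naimark the transforms exhaust the continuous functions on the spectrum. -/
theorem determining_gelfand (A : MeanValueAlgebra) :
    Determining A.beta (range fun (f : A.Elem) (s : A.Spectrum) => s f) := by
  intro k hk h
  refine determining_continuous A.beta k hk fun f hf => ?_
  rw [← h _ ⟨(gelfandStarTransform A.Elem).symm ⟨f, hf.1⟩, rfl⟩]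
  refine integral_congr_ae (ae_of_all _ fun s => ?_)
  have := DFunLike.congr_fun ((gelfandStarTransform A.Elem).apply_symm_apply ⟨f, hf.1⟩) s
  simp only [gelfandStarTransform_apply_apply, ContinuousMap.coe_mk] at this
  simp only [this]

end MeanValueAlgebra

/-! ### Fourier analysis on the torus -/

section Torus

variable {d : ℕ}

theorem cell_eq_fundamentalDomain (d : ℕ) :
    cell d = ZSpan.fundamentalDomain (EuclideanSpace.basisFun (Fin d) ℝ).toBasis := by
  ext y
  simp [cell, ZSpan.mem_fundamentalDomain]

theorem measurableSet_cell (d : ℕ) : MeasurableSet (cell d) := by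
  rw [cell_eq_fundamentalDomain]
  exact ZSpan.fundamentalDomain_measurableSet _

theorem volume_cell (d : ℕ) : volume (cell d) = 1 := by
  have h : cell d = (WithLp.ofLp : Space d → Fin d → ℝ) ⁻¹'
      (Set.pi univ fun _ => Ico (0 : ℝ) 1) := by
    ext y
    simp [cell]
  rw [h, (PiLp.volume_preserving_ofLp (Fin d)).measure_preimage
    (MeasurableSet.pi countable_univ fun _ _ => measurableSet_Ico).nullMeasurableSet,
    volume_pi_pi]
  simp

instance isProbabilityMeasure_cell (d : ℕ) :
    IsProbabilityMeasure ((volume : Measure (Space d)).restrict (cell d)) :=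
  ⟨by simp [volume_cell]⟩

theorem isBounded_cell (d : ℕ) : Bornology.IsBounded (cell d) := by
  rw [cell_eq_fundamentalDomain]
  exact ZSpan.fundamentalDomain_isBounded _

theorem IsPeriodic.add_mem_span {α : Type*} {φ : Space d → α} (hφ : IsPeriodic φ) {v : Space d}
    (hv : v ∈ Submodule.span ℤ (range (EuclideanSpace.basisFun (Fin d) ℝ).toBasis)) :
    ∀ y, φ (y + v) = φ y := by
  induction hv using Submodule.span_induction with
  | mem x hx =>
    obtain ⟨i, rfl⟩ := hx
    intro y
    simpa [basisVec] using hφ y i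
  | zero => simp
  | add x z _ _ hx hz => intro y; rw [← add_assoc, hz, hx]
  | smul n x _ hx =>
    have hneg : ∀ y, φ (y - x) = φ y := fun y => by rw [← hx (y - x), sub_add_cancel]
    induction n using Int.induction_on with
    | zero => simp
    | succ n ih => intro y; rw [add_smul, one_smul, ← add_assoc, hx, ih]
    | pred n ih => intro y; rw [sub_smul, one_smul, ← add_sub_assoc, hneg, ih]

/-- A translate of the cell is again a fundamental domain of the lattice, and a periodic function
has the same integral over any two of them. -/
theorem setIntegral_cell_add_right {φ : Space d → ℂ} (hφ : IsPeriodic φ) (h : Space d) :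
    ∫ y in cell d, φ (y + h) = ∫ y in cell d, φ y := by
  let b := (EuclideanSpace.basisFun (Fin d) ℝ).toBasis
  have inv : VAddInvariantMeasure (Submodule.span ℤ (range b)) (Space d) volume :=
    inferInstanceAs <| VAddInvariantMeasure (Submodule.span ℤ (range b)).toAddSubgroup _ _
  have h1 : IsAddFundamentalDomain (Submodule.span ℤ (range b)) (cell d) volume := by
    rw [cell_eq_fundamentalDomain]
    exact ZSpan.isAddFundamentalDomain b volume
  have h2 := h1.vadd_of_comm h
  have h3 := h2.setIntegral_eq h1 (f := φ) fun g x => by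
    rw [Submodule.vadd_def, vadd_eq_add, add_comm]
    exact hφ.add_mem_span g.2 x
  have h4 : (fun y => y + h) '' cell d = (fun y => h + y) '' cell d := by simp_rw [add_comm]
  rw [← (measurePreserving_add_right volume h).setIntegral_image_emb
    (measurableEmbedding_addRight h), h4]
  exact h3

theorem integrableOn_cell_of_continuous {φ : Space d → ℂ} (hφ : Continuous φ) :
    IntegrableOn φ (cell d) :=
  (hφ.continuousOn.integrableOn_compact (isBounded_cell d).isCompact_closure).mono_set
    subset_closure

theorem memLp_cell_of_continuous {φ : Space d → ℂ} (hφ : Continuous φ) (p : ENNReal) :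
    MemLp φ p (volume.restrict (cell d)) := by
  obtain ⟨C, hC⟩ := (isBounded_cell d).isCompact_closure.exists_bound_of_continuousOn
    hφ.continuousOn
  exact MemLp.of_bound hφ.aestronglyMeasurable C
    ((ae_restrict_iff' (measurableSet_cell d)).2 (ae_of_all _ fun y hy => hC y (subset_closure hy)))

/-- Differentiate at t = 0 under the integral of φ(y + t e_i), which does not depend on t. No
boundary terms on the cell have to be matched. -/
theorem setIntegral_cell_fderiv_eq_zero {φ : Space d → ℂ} (hc : ContDiff ℝ 1 φ)
    (hφ : IsPeriodic φ) (i : Fin d) :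
    ∫ y in cell d, fderiv ℝ φ y (basisVec i) = 0 := by
  let ν : Measure (Space d) := volume.restrict (cell d)
  have hd : ∀ (y : Space d) (t : ℝ), HasDerivAt (fun t : ℝ => φ (y + t • basisVec i))
      (fderiv ℝ φ (y + t • basisVec i) (basisVec i)) t := by
    intro y t
    have h1 : HasDerivAt (fun t : ℝ => y + t • basisVec i) (basisVec i) t := by
      simpa using ((hasDerivAt_id t).smul_const (basisVec i : Space d)).const_add y
    exact ((hc.differentiable one_ne_zero _).hasFDerivAt).comp_hasDerivAt t h1
  have hcd : Continuous fun y => fderiv ℝ φ y (basisVec i) :=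
    (hc.continuous_fderiv one_ne_zero).clm_apply continuous_const
  obtain ⟨C, hC⟩ := ((isBounded_cell d).isCompact_closure.prod
    (isCompact_closedBall (0 : ℝ) 1)).exists_bound_of_continuousOn
    (f := fun p : Space d × ℝ => fderiv ℝ φ (p.1 + p.2 • basisVec i) (basisVec i))
    (hcd.comp (by fun_prop)).continuousOn
  have key := (hasDerivAt_integral_of_dominated_loc_of_deriv_le (μ := ν)
    (F := fun t y => φ (y + t • basisVec i))
    (F' := fun t y => fderiv ℝ φ (y + t • basisVec i) (basisVec i)) (x₀ := (0 : ℝ))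
    (s := Metric.closedBall 0 1) (bound := fun _ => C)
    (Metric.closedBall_mem_nhds _ one_pos)
    (Eventually.of_forall fun t => (hc.continuous.comp (by fun_prop)).aestronglyMeasurable)
    (integrableOn_cell_of_continuous (hc.continuous.comp (by fun_prop)))
    (hcd.comp (by fun_prop)).aestronglyMeasurable
    ((ae_restrict_iff' (measurableSet_cell d)).2 (ae_of_all _ fun y hy t ht =>
      hC (y, t) ⟨subset_closure hy, ht⟩))
    (integrable_const C) (ae_of_all _ fun y t _ => hd y t)).2
  simp only [zero_smul, add_zero, ν] at key
  simp_rw [setIntegral_cell_add_right hφ] at key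
  exact key.unique (hasDerivAt_const _ _)

/-- The exponential `y ↦ exp (2 π i k · y)`. -/
noncomputable def expo (k : Fin d → ℤ) (y : Space d) : ℂ :=
  Complex.exp (2 * Real.pi * Complex.I * ∑ i, (k i : ℂ) * (y i : ℂ))

theorem contDiff_expo (k : Fin d → ℤ) : ContDiff ℝ ∞ (expo k) := by
  unfold expo
  refine ContDiff.cexp (contDiff_const.mul (ContDiff.sum fun i _ => contDiff_const.mul ?_))
  exact Complex.ofRealCLM.contDiff.comp (EuclideanSpace.proj (𝕜 := ℝ) i).contDiff

theorem continuous_expo (k : Fin d → ℤ) : Continuous (expo k) := (contDiff_expo k).continuous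

theorem norm_expo (k : Fin d → ℤ) (y : Space d) : ‖expo k y‖ = 1 := by
  have : 2 * Real.pi * Complex.I * ∑ i, (k i : ℂ) * (y i : ℂ)
      = ((2 * Real.pi * ∑ i, (k i : ℝ) * y i : ℝ) : ℂ) * Complex.I := by
    push_cast; ring
  rw [expo, this, Complex.norm_exp_ofReal_mul_I]

theorem conj_expo (k : Fin d → ℤ) (y : Space d) : starRingEnd ℂ (expo k y) = expo (-k) y := by
  rw [expo, ← Complex.exp_conj, expo]
  congr 1
  rw [map_mul, map_mul, map_mul, Complex.conj_I, Complex.conj_ofReal, map_sum]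
  have : starRingEnd ℂ 2 = 2 := Complex.conj_ofNat 2
  simp [this]

theorem expo_mul_expo (k l : Fin d → ℤ) (y : Space d) :
    expo k y * expo l y = expo (k + l) y := by
  rw [expo, expo, ← Complex.exp_add, expo]
  congr 1
  simp [add_mul, Finset.sum_add_distrib]
  ring

theorem expo_zero (y : Space d) : expo 0 y = 1 := by simp [expo]

theorem isPeriodic_expo (k : Fin d → ℤ) : IsPeriodic (expo k) := by
  intro y i
  have h : ∀ j, (((basisVec i : Space d) j : ℝ) : ℂ) = if j = i then 1 else 0 := fun j => by
    simp [basisVec, apply_ite]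
  have : 2 * Real.pi * Complex.I * ∑ j, (k j : ℂ) * (((y + basisVec i : Space d) j : ℝ) : ℂ)
      = 2 * Real.pi * Complex.I * ∑ j, (k j : ℂ) * (y j : ℂ)
        + (k i : ℂ) * (2 * Real.pi * Complex.I) := by
    simp only [PiLp.add_apply, h, Complex.ofReal_add, mul_add, Finset.sum_add_distrib]
    simp
    ring
  rw [expo, this, Complex.exp_add, Complex.exp_int_mul_two_pi_mul_I, mul_one, expo]

theorem fderiv_expo (k : Fin d → ℤ) (y : Space d) (i : Fin d) :
    fderiv ℝ (expo k) y (basisVec i) = 2 * Real.pi * Complex.I * k i * expo k y := by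
  have h1 : ∀ j, HasFDerivAt (fun y : Space d => (k j : ℂ) * (y j : ℂ))
      ((k j : ℂ) • Complex.ofRealCLM.comp (EuclideanSpace.proj (𝕜 := ℝ) j)) y := fun j =>
    ((Complex.ofRealCLM.comp (EuclideanSpace.proj (𝕜 := ℝ) j)).hasFDerivAt).const_mul (k j : ℂ)
  have h2 := ((HasFDerivAt.fun_sum (u := Finset.univ) fun j _ => h1 j).const_mul
    (2 * Real.pi * Complex.I)).cexp
  have h3 : fderiv ℝ (expo k) y = _ := h2.fderiv
  rw [h3]
  have h : ∀ j, (((basisVec i : Space d) j : ℝ) : ℂ) = if j = i then 1 else 0 := fun j => by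
    simp [basisVec, apply_ite]
  simp [h, expo]
  ring

theorem setIntegral_cell_expo (k : Fin d → ℤ) :
    ∫ y in cell d, expo k y = if k = 0 then 1 else 0 := by
  split_ifs with hk
  · subst hk
    simp [expo_zero]
  · obtain ⟨i, hi⟩ : ∃ i, k i ≠ 0 := by
      by_contra! h
      exact hk (funext h)
    have h := setIntegral_cell_fderiv_eq_zero ((contDiff_expo k).of_le (by simp))
      (isPeriodic_expo k) i
    simp_rw [fderiv_expo, integral_const_mul] at h
    refine (mul_eq_zero.1 h).resolve_left ?_
    simp [hi, Real.pi_ne_zero]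

theorem setIntegral_cell_fderiv_mul_expo {φ : Space d → ℂ} (hc : ContDiff ℝ 1 φ)
    (hφ : IsPeriodic φ) (i : Fin d) (k : Fin d → ℤ) :
    ∫ y in cell d, fderiv ℝ φ y (basisVec i) * expo k y
      = -(2 * Real.pi * Complex.I * k i) * ∫ y in cell d, φ y * expo k y := by
  have he : ContDiff ℝ 1 (expo k) := (contDiff_expo k).of_le (by simp)
  have h := setIntegral_cell_fderiv_eq_zero (hc.mul he)
    (fun y j => by simp only [hφ y j, isPeriodic_expo k y j]) i
  have h1 : ∀ y, fderiv ℝ (fun y => φ y * expo k y) y (basisVec i)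
      = fderiv ℝ φ y (basisVec i) * expo k y
        + (2 * Real.pi * Complex.I * k i) * (φ y * expo k y) := by
    intro y
    rw [fderiv_fun_mul (hc.differentiable one_ne_zero y) (he.differentiable one_ne_zero y)]
    simp [fderiv_expo]
    ring
  simp_rw [h1] at h
  have hcd : Continuous fun y => fderiv ℝ φ y (basisVec i) :=
    (hc.continuous_fderiv one_ne_zero).clm_apply continuous_const
  rw [integral_add, integral_const_mul] at h
  · linear_combination h
  · exact integrableOn_cell_of_continuous (hcd.mul (continuous_expo k))
  · exact (integrableOn_cell_of_continuous (hc.continuous.mul (continuous_expo k))).const_mul _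

/-- The projection onto the torus. -/
noncomputable def toTorus (y : Space d) : UnitAddTorus (Fin d) := fun i => (y i : UnitAddCircle)

/-- The section of `toTorus` with values in the unit cell. -/
noncomputable def ofTorus (x : UnitAddTorus (Fin d)) : Space d :=
  WithLp.toLp 2 fun i => (AddCircle.equivIco (1 : ℝ) 0 (x i) : ℝ)

theorem continuous_toTorus : Continuous (toTorus (d := d)) :=
  continuous_pi fun i => (AddCircle.continuous_mk' 1).comp (by fun_prop)

theorem measurable_ofTorus : Measurable (ofTorus (d := d)) := by
  refine (WithLp.measurable_toLp 2 _).comp (measurable_pi_lambda _ fun i => ?_)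
  exact measurable_subtype_coe.comp
    ((AddCircle.measurableEquivIco (1 : ℝ) 0).measurable.comp (measurable_pi_apply i))

theorem ofTorus_toTorus {y : Space d} (hy : y ∈ cell d) : ofTorus (toTorus y) = y := by
  ext i
  simp only [ofTorus, toTorus]
  rw [AddCircle.equivIco_coe_of_mem]
  simpa using hy i

theorem mFourier_toTorus (k : Fin d → ℤ) (y : Space d) :
    UnitAddTorus.mFourier k (toTorus y) = expo k y := by
  simp only [UnitAddTorus.mFourier, ContinuousMap.coe_mk, toTorus, fourier_coe_apply, expo,
    ← Complex.exp_sum, Finset.mul_sum]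
  congr 1
  refine Finset.sum_congr rfl fun i _ => ?_
  simp
  ring

/-- Trigonometric polynomials are uniformly dense in the continuous functions on the torus. The cell
is identified almost everywhere with the torus through `toTorus` and its section, so that this
density applies to the image measure. -/
theorem determining_expo (d : ℕ) :
    Determining ((volume : Measure (Space d)).restrict (cell d)) (range expo) := by
  intro k hk h
  let ν : Measure (Space d) := volume.restrict (cell d)
  let μ : Measure (UnitAddTorus (Fin d)) := ν.map toTorus
  have hq : MeasurePreserving (toTorus (d := d)) ν μ :=
    continuous_toTorus.measurable.measurePreserving ν
  have hcell : ∀ᵐ y ∂ν, y ∈ cell d := ae_restrict_mem (measurableSet_cell d)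
  have hrq : ∀ᵐ y ∂ν, ofTorus (toTorus y) = y := by
    filter_upwards [hcell] with y hy using ofTorus_toTorus hy
  have hr : MeasurePreserving (ofTorus (d := d)) μ ν := by
    refine ⟨measurable_ofTorus, ?_⟩
    rw [Measure.map_map measurable_ofTorus continuous_toTorus.measurable,
      Measure.map_congr (f := ofTorus ∘ toTorus) (g := id) hrq, Measure.map_id]
  have hkr : Integrable (fun x => k (ofTorus x)) μ := hr.integrable_comp_of_integrable hk
  have hkf : ∀ f : C(UnitAddTorus (Fin d), ℂ),
      ∫ x, k (ofTorus x) * f x ∂μ = ∫ y, k y * f (toTorus y) ∂ν := by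
    intro f
    rw [integral_map continuous_toTorus.measurable.aemeasurable]
    · refine integral_congr_ae ?_
      filter_upwards [hrq] with y hy
      rw [hy]
    · exact hkr.aestronglyMeasurable.mul f.continuous.aestronglyMeasurable
  have hfin : IsFiniteMeasure μ := Measure.isFiniteMeasure_map _ _
  have hspan : ∀ f ∈ Submodule.span ℂ (range (UnitAddTorus.mFourier (d := Fin d))),
      ∫ x, k (ofTorus x) * f x ∂μ = 0 := by
    have hint : ∀ f : C(UnitAddTorus (Fin d), ℂ),
        Integrable (fun x => k (ofTorus x) * f x) μ := fun f =>
      hkr.mul_bdd f.continuous.aestronglyMeasurable (ae_of_all _ f.norm_coe_le_norm)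
    intro f hf
    induction hf using Submodule.span_induction with
    | mem x hx =>
      obtain ⟨l, rfl⟩ := hx
      rw [hkf]
      simp_rw [mFourier_toTorus]
      exact h _ ⟨l, rfl⟩
    | zero => simp
    | add f g _ _ hf hg =>
      simp only [ContinuousMap.add_apply, mul_add]
      rw [integral_add (hint f) (hint g), hf, hg, add_zero]
    | smul c f _ hf =>
      simp only [ContinuousMap.smul_apply, smul_eq_mul, mul_left_comm _ c]
      rw [integral_const_mul, hf, mul_zero]
  have hall : ∀ f : C(UnitAddTorus (Fin d), ℂ), ∫ x, k (ofTorus x) * f x ∂μ = 0 := by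
    intro f
    have hf : f ∈ (Submodule.span ℂ
        (range (UnitAddTorus.mFourier (d := Fin d)))).topologicalClosure := by
      rw [UnitAddTorus.span_mFourier_closure_eq_top]; trivial
    refine norm_le_zero_iff.1 (le_of_forall_pos_le_add fun δ hδ => ?_)
    have hC : 0 < ∫ x, ‖k (ofTorus x)‖ ∂μ + 1 := by positivity
    obtain ⟨g, hg, hfg⟩ := Metric.mem_closure_iff.1 hf _ (div_pos hδ hC)
    have hint : ∀ f : C(UnitAddTorus (Fin d), ℂ),
        Integrable (fun x => k (ofTorus x) * f x) μ := fun f =>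
      hkr.mul_bdd f.continuous.aestronglyMeasurable (ae_of_all _ f.norm_coe_le_norm)
    have h1 : ∫ x, k (ofTorus x) * f x ∂μ = ∫ x, k (ofTorus x) * (f - g) x ∂μ := by
      simp only [ContinuousMap.sub_apply, mul_sub]
      rw [integral_sub (hint f) (hint g), hspan g hg, sub_zero]
    rw [h1, zero_add]
    calc ‖∫ x, k (ofTorus x) * (f - g) x ∂μ‖
        ≤ ∫ x, ‖k (ofTorus x)‖ * (δ / (∫ x, ‖k (ofTorus x)‖ ∂μ + 1)) ∂μ := by
          refine norm_integral_le_of_norm_le (hkr.norm.mul_const _) (ae_of_all _ fun x => ?_)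
          rw [norm_mul]
          gcongr
          exact ((f - g).norm_coe_le_norm x).trans (by rw [← dist_eq_norm]; exact hfg.le)
      _ = (∫ x, ‖k (ofTorus x)‖ ∂μ) * (δ / (∫ x, ‖k (ofTorus x)‖ ∂μ + 1)) := integral_mul_const _ _
      _ ≤ (∫ x, ‖k (ofTorus x)‖ ∂μ + 1) * (δ / (∫ x, ‖k (ofTorus x)‖ ∂μ + 1)) := by
          gcongr; linarith
      _ = δ := by field_simp
  have hz := determining_continuous μ _ hkr fun f hf => hall ⟨f, hf.1⟩
  have hz' := hq.quasiMeasurePreserving.ae_eq_comp hz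
  filter_upwards [hz', hrq] with y hy hy'
  simpa [hy'] using hy

end Torus

/-! ### Fourier series in L² of the unit cell -/

section TorusL2

variable {d : ℕ}

/-- The exponentials as elements of `L²` of the unit cell. -/
noncomputable def expoLp (k : Fin d → ℤ) :
    Lp ℂ 2 ((volume : Measure (Space d)).restrict (cell d)) :=
  (memLp_cell_of_continuous (continuous_expo k) 2).toLp _

theorem inner_toLp_toLp {α : Type*} [MeasurableSpace α] {μ : Measure α} {f g : α → ℂ}
    (hf : MemLp f 2 μ) (hg : MemLp g 2 μ) :
    inner ℂ (hf.toLp f) (hg.toLp g) = ∫ a, starRingEnd ℂ (f a) * g a ∂μ := by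
  rw [L2.inner_def]
  refine integral_congr_ae ?_
  filter_upwards [hf.coeFn_toLp, hg.coeFn_toLp] with a h1 h2
  rw [h1, h2, RCLike.inner_apply, mul_comm]

theorem inner_expoLp_toLp (k : Fin d → ℤ) {u : Space d → ℂ}
    (hu : MemLp u 2 (volume.restrict (cell d))) :
    inner ℂ (expoLp k) (hu.toLp u) = ∫ y in cell d, u y * expo (-k) y := by
  rw [expoLp, inner_toLp_toLp]
  simp_rw [conj_expo, mul_comm]

theorem orthonormal_expoLp : Orthonormal ℂ (expoLp (d := d)) := by
  rw [orthonormal_iff_ite]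
  intro k l
  rw [expoLp, expoLp, inner_toLp_toLp]
  simp_rw [conj_expo, expo_mul_expo, setIntegral_cell_expo, neg_add_eq_zero]

/-- The exponentials form a Hilbert basis of `L²` of the unit cell. -/
noncomputable def expoBasis (d : ℕ) :
    HilbertBasis (Fin d → ℤ) ℂ (Lp ℂ 2 ((volume : Measure (Space d)).restrict (cell d))) :=
  HilbertBasis.mkOfOrthogonalEqBot orthonormal_expoLp <| by
    rw [Submodule.eq_bot_iff]
    intro f hf
    have hf' : MemLp f 2 ((volume : Measure (Space d)).restrict (cell d)) := Lp.memLp f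
    have h0 : (f : Space d → ℂ) =ᵐ[volume.restrict (cell d)] 0 := by
      refine determining_expo d f (hf'.integrable (by norm_num)) ?_
      rintro _ ⟨k, rfl⟩
      have := Submodule.inner_right_of_mem_orthogonal
        (Submodule.subset_span (mem_range_self (-k))) hf
      rw [← Lp.toLp_coeFn f hf', inner_expoLp_toLp, neg_neg] at this
      exact this
    exact (Lp.eq_zero_iff_ae_eq_zero).2 h0

/-- The pairing is bilinear rather than sesquilinear, so the Hilbert basis expansion is applied to
the conjugate of f. This is why opposite frequencies are paired. -/
theorem hasSum_parseval {f u : Space d → ℂ} (hf : MemLp f 2 (volume.restrict (cell d)))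
    (hu : MemLp u 2 (volume.restrict (cell d))) :
    HasSum (fun k : Fin d → ℤ =>
        (∫ y in cell d, f y * expo k y) * ∫ y in cell d, u y * expo (-k) y)
      (∫ y in cell d, f y * u y) := by
  have hfc : MemLp (fun y => starRingEnd ℂ (f y)) 2 (volume.restrict (cell d)) := hf.star
  have h := (expoBasis d).hasSum_inner_mul_inner (hfc.toLp _) (hu.toLp _)
  have h1 : ∀ k, inner ℂ (hfc.toLp _) (expoLp k) = ∫ y in cell d, f y * expo k y := fun k => by
    rw [expoLp, inner_toLp_toLp]
    simp
  simpa only [expoBasis, HilbertBasis.coe_mkOfOrthogonalEqBot, inner_expoLp_toLp,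
    inner_toLp_toLp, Complex.conj_conj, h1] using h

theorem lintegral_enorm_sq_eq_eLpNorm {α E : Type*} [MeasurableSpace α] [NormedAddCommGroup E]
    (μ : Measure α) (f : α → E) : ∫⁻ a, ‖f a‖ₑ ^ 2 ∂μ = eLpNorm f 2 μ ^ 2 := by
  have h := eLpNorm_nnreal_pow_eq_lintegral (f := f) (μ := μ) (p := 2) two_ne_zero
  simpa using h.symm

theorem tsum_enorm_sq_fourier_le {u : Space d → ℂ} (hu : MemLp u 2 (volume.restrict (cell d))) :
    ∑' k : Fin d → ℤ, ‖∫ y in cell d, u y * expo (-k) y‖ₑ ^ 2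
      ≤ ∫⁻ y in cell d, ‖u y‖ₑ ^ 2 := by
  have h1 : ∫⁻ y in cell d, ‖u y‖ₑ ^ 2 = ENNReal.ofReal (‖hu.toLp u‖ ^ 2) := by
    rw [lintegral_enorm_sq_eq_eLpNorm, Lp.norm_toLp, ENNReal.ofReal_pow ENNReal.toReal_nonneg,
      ENNReal.ofReal_toReal hu.eLpNorm_ne_top]
  rw [h1, ENNReal.tsum_eq_iSup_sum]
  refine iSup_le fun s => ?_
  have := orthonormal_expoLp.sum_inner_products_le (hu.toLp u) (s := s)
  simp_rw [inner_expoLp_toLp] at this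
  refine le_trans (le_of_eq ?_) (ENNReal.ofReal_le_ofReal this)
  rw [ENNReal.ofReal_sum_of_nonneg fun _ _ => by positivity]
  refine Finset.sum_congr rfl fun k _ => ?_
  rw [ENNReal.ofReal_pow (norm_nonneg _), ofReal_norm]

/-- Parseval writes both sides of the integration by parts formula as series. The factor 2πi k_i
comes from φ on one side and from w on the other, so the terms agree up to sign. -/
theorem hasTorusWeakGradient_of_fourier {u : Space d → ℂ} {w : Fin d → Space d → ℂ}
    (hu : MemLp u 2 (volume.restrict (cell d)))
    (hw : ∀ i, MemLp (w i) 2 (volume.restrict (cell d)))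
    (h : ∀ i k, ∫ y in cell d, w i y * expo (-k) y
      = 2 * Real.pi * Complex.I * k i * ∫ y in cell d, u y * expo (-k) y) :
    HasTorusWeakGradient u w := by
  refine ⟨hu.integrable (by norm_num), fun i => (hw i).integrable (by norm_num),
    fun φ hφ hper i => ?_⟩
  have hφ1 : ContDiff ℝ 1 φ := hφ.of_le (by simp)
  have hcd : Continuous fun y => fderiv ℝ φ y (basisVec i) :=
    (hφ1.continuous_fderiv one_ne_zero).clm_apply continuous_const
  have h1 := hasSum_parseval (memLp_cell_of_continuous hcd 2) hu
  have h2 := (hasSum_parseval (memLp_cell_of_continuous hφ.continuous 2) (hw i)).neg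
  simp_rw [setIntegral_cell_fderiv_mul_expo hφ1 hper] at h1
  simp_rw [h i] at h2
  simp_rw [mul_comm (u _), mul_comm (w i _)]
  convert! h1.unique ?_
  convert! h2 using 2 with k
  ring

end TorusL2

/-! ### First order distributions and their test functions -/

section TestFunctions

variable {d : ℕ}

theorem norm_basisVec (i : Fin d) : ‖(basisVec i : Space d)‖ = 1 := by
  simp [basisVec]

theorem hasCompactSupport_of_norm {E : Type*} [Zero E] {φ : Space d → E} {R : ℝ}
    (h : ∀ x, R < ‖x‖ → φ x = 0) : HasCompactSupport φ :=
  HasCompactSupport.intro (isCompact_closedBall 0 R) fun x hx => h x (by simpa using hx)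

theorem exists_norm_bound_of_hasCompactSupport {E : Type*} [Zero E] {φ : Space d → E}
    (h : HasCompactSupport φ) : ∃ R : ℝ, ∀ x, R < ‖x‖ → φ x = 0 := by
  obtain ⟨R, hR⟩ := h.isCompact.isBounded.exists_norm_le
  exact ⟨R, fun x hx => image_eq_zero_of_notMem_tsupport fun hx' => (hR x hx').not_gt hx⟩

theorem fderiv_eq_zero_of_norm {φ : Space d → ℂ} {R : ℝ} (h : ∀ x, R < ‖x‖ → φ x = 0)
    {x : Space d} (hx : R < ‖x‖) : fderiv ℝ φ x = 0 := by
  have : φ =ᶠ[𝓝 x] fun _ => 0 :=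
    (continuous_norm.continuousAt.eventually (lt_mem_nhds hx)).mono fun y hy => h y hy
  rw [this.fderiv_eq]
  simp

/-- Convolution with a bump commutes with differentiation, so one radius adapted to the uniform
continuity of both φ and its derivative suffices. Keeping it at most 1 confines the enlargement of
the support. -/
theorem exists_smooth_approx {φ : Space d → ℂ} (hφ : ContDiff ℝ 1 φ) {R : ℝ}
    (hR : ∀ x, R < ‖x‖ → φ x = 0) {δ : ℝ} (hδ : 0 < δ) :
    ∃ ψ : Space d → ℂ, ContDiff ℝ ∞ ψ ∧ (∀ x, R + 1 < ‖x‖ → ψ x = 0) ∧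
      (∀ x, ‖φ x - ψ x‖ ≤ δ) ∧
      ∀ x j, ‖fderiv ℝ φ x (basisVec j) - fderiv ℝ ψ x (basisVec j)‖ ≤ δ := by
  have hc : HasCompactSupport φ := hasCompactSupport_of_norm hR
  obtain ⟨r₁, hr₁, h₁⟩ := Metric.uniformContinuous_iff.1
    (hc.uniformContinuous_of_continuous hφ.continuous) δ hδ
  obtain ⟨r₂, hr₂, h₂⟩ := Metric.uniformContinuous_iff.1
    ((hc.fderiv ℝ).uniformContinuous_of_continuous (hφ.continuous_fderiv one_ne_zero)) δ hδ
  let r := min 1 (min r₁ r₂)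
  have hr : 0 < r := by positivity
  let b : ContDiffBump (0 : Space d) := ⟨r / 2, r, by positivity, by linarith⟩
  let ψ : Space d → ℂ := convolution (b.normed volume) φ (ContinuousLinearMap.lsmul ℝ ℝ) volume
  have hL : ContinuousLinearMap.precompR (Space d) (ContinuousLinearMap.lsmul ℝ ℝ : ℝ →L[ℝ] ℂ →L[ℝ] ℂ)
      = ContinuousLinearMap.lsmul ℝ ℝ := by
    ext; simp
  have hder : ∀ x, fderiv ℝ ψ x
      = convolution (b.normed volume) (fderiv ℝ φ) (ContinuousLinearMap.lsmul ℝ ℝ) volume x := by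
    intro x
    have := (hc.hasFDerivAt_convolution_right (ContinuousLinearMap.lsmul ℝ ℝ)
      (b.integrable_normed (μ := volume)).locallyIntegrable hφ x).fderiv
    rw [hL] at this
    exact this
  refine ⟨ψ, ?_, ?_, fun x => ?_, fun x j => ?_⟩
  · exact b.hasCompactSupport_normed.contDiff_convolution_left _ b.contDiff_normed
      hφ.continuous.locallyIntegrable
  · intro x hx
    by_contra hne
    have := support_convolution_subset (ContinuousLinearMap.lsmul ℝ ℝ : ℝ →L[ℝ] ℂ →L[ℝ] ℂ)
      (μ := volume) (f := b.normed volume) (g := φ) hne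
    obtain ⟨y, hy, z, hz, rfl⟩ := Set.mem_add.1 this
    rw [b.support_normed_eq] at hy
    have hz' : ‖z‖ ≤ R := not_lt.1 fun h => hz (hR z h)
    have hy' : ‖y‖ < 1 := by
      have : ‖y‖ < r := by simpa using hy
      exact this.trans_le (min_le_left _ _)
    have := norm_add_le y z
    linarith
  · rw [← dist_eq_norm, dist_comm]
    refine b.dist_normed_convolution_le hφ.continuous.aestronglyMeasurable fun y hy => (h₁ ?_).le
    exact (Metric.mem_ball.1 hy).trans_le ((min_le_right _ _).trans (min_le_left _ _))
  · have h3 : dist (fderiv ℝ ψ x) (fderiv ℝ φ x) ≤ δ := by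
      rw [hder]
      refine b.dist_normed_convolution_le
        (hφ.continuous_fderiv one_ne_zero).aestronglyMeasurable fun y hy => (h₂ ?_).le
      exact (Metric.mem_ball.1 hy).trans_le ((min_le_right _ _).trans (min_le_right _ _))
    rw [← sub_apply]
    refine (ContinuousLinearMap.le_opNorm _ _).trans ?_
    rw [norm_basisVec, mul_one, ← dist_eq_norm, dist_comm]
    exact h3

/-- The integrand `h φ + ∑ j, q j ∂_j φ` of a first order distribution applied to `φ`. -/
noncomputable def firstOrder (h : Space d → ℂ) (q : Fin d → Space d → ℂ) (φ : Space d → ℂ)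
    (x : Space d) : ℂ :=
  h x * φ x + ∑ j, q j x * fderiv ℝ φ x (basisVec j)

theorem locallyIntegrable_mul_of_hasCompactSupport {h φ : Space d → ℂ} (hh : LocallyIntegrable h)
    (hφ : Continuous φ) (hc : HasCompactSupport φ) : Integrable fun x => h x * φ x := by
  obtain ⟨R, hR⟩ := exists_norm_bound_of_hasCompactSupport hc
  obtain ⟨C, hC⟩ := hc.exists_bound_of_continuous hφ
  have h1 : IntegrableOn (fun x => h x * φ x) (Metric.closedBall 0 R) :=
    (hh.integrableOn_isCompact (isCompact_closedBall 0 R)).mul_bdd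
      hφ.aestronglyMeasurable (ae_of_all _ hC)
  refine (integrableOn_iff_integrable_of_support_subset fun x hx => ?_).1 h1
  by_contra hx'
  exact hx (by simp [hR x (by simpa using hx')])

theorem integrable_firstOrder {h : Space d → ℂ} {q : Fin d → Space d → ℂ} {φ : Space d → ℂ}
    (hh : LocallyIntegrable h) (hq : ∀ j, LocallyIntegrable (q j)) (hφ : ContDiff ℝ 1 φ)
    (hc : HasCompactSupport φ) : Integrable (firstOrder h q φ) := by
  refine (locallyIntegrable_mul_of_hasCompactSupport hh hφ.continuous hc).add
    (integrable_finsetSum _ fun j _ => ?_)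
  refine locallyIntegrable_mul_of_hasCompactSupport (hq j)
    ((hφ.continuous_fderiv one_ne_zero).clm_apply continuous_const) ?_
  exact (hc.fderiv ℝ).comp_left (g := fun L : Space d →L[ℝ] ℂ => L (basisVec j)) rfl

/-- On functions supported in a fixed ball a first order distribution with locally integrable
coefficients is continuous for the C¹ norm, with constant at most the L¹ norm of the coefficients on
that ball. -/
theorem integral_firstOrder_eq_zero_of_approx {h : Space d → ℂ} {q : Fin d → Space d → ℂ}
    (hh : LocallyIntegrable h) (hq : ∀ j, LocallyIntegrable (q j)) {φ : Space d → ℂ}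
    (hφ : ContDiff ℝ 1 φ) {R : ℝ} (hR : ∀ x, R < ‖x‖ → φ x = 0)
    (happrox : ∀ δ : ℝ, 0 < δ → ∃ ψ : Space d → ℂ, ContDiff ℝ 1 ψ ∧ (∀ x, R < ‖x‖ → ψ x = 0) ∧
      (∀ x ∈ Metric.closedBall (0 : Space d) R, ‖φ x - ψ x‖ ≤ δ ∧
        ∀ j, ‖fderiv ℝ φ x (basisVec j) - fderiv ℝ ψ x (basisVec j)‖ ≤ δ) ∧
      ∫ x, firstOrder h q ψ x = 0) :
    ∫ x, firstOrder h q φ x = 0 := by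
  let B : Set (Space d) := Metric.closedBall 0 R
  have hB : IsCompact B := isCompact_closedBall 0 R
  let w : Space d → ℝ := fun x => ‖h x‖ + ∑ j, ‖q j x‖
  have hw : IntegrableOn w B := (hh.integrableOn_isCompact hB).norm.add
    (integrable_finsetSum _ fun j _ => ((hq j).integrableOn_isCompact hB).norm)
  have hw0 : 0 ≤ ∫ x in B, w x := integral_nonneg fun x => by positivity
  refine norm_le_zero_iff.1 (le_of_forall_pos_le_add fun η hη => ?_)
  obtain ⟨ψ, hψ, hψR, hclose, h0⟩ := happrox (η / ((∫ x in B, w x) + 1)) (by positivity)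
  have h1 : ∫ x, firstOrder h q φ x = ∫ x, (firstOrder h q φ x - firstOrder h q ψ x) := by
    rw [integral_sub (integrable_firstOrder hh hq hφ (hasCompactSupport_of_norm hR))
      (integrable_firstOrder hh hq hψ (hasCompactSupport_of_norm hψR)), h0, sub_zero]
  have h2 : ∫ x, (firstOrder h q φ x - firstOrder h q ψ x)
      = ∫ x in B, (firstOrder h q φ x - firstOrder h q ψ x) := by
    refine (setIntegral_eq_integral_of_forall_compl_eq_zero fun x hx => ?_).symm
    have hx' : R < ‖x‖ := by simpa [B] using hx
    simp [firstOrder, hR x hx', hψR x hx', fderiv_eq_zero_of_norm hR hx',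
      fderiv_eq_zero_of_norm hψR hx']
  rw [h1, h2, zero_add]
  calc ‖∫ x in B, (firstOrder h q φ x - firstOrder h q ψ x)‖
      ≤ ∫ x in B, w x * (η / ((∫ x in B, w x) + 1)) := by
        refine norm_integral_le_of_norm_le (hw.mul_const _)
          ((ae_restrict_iff' hB.measurableSet).2 (ae_of_all _ fun x hx => ?_))
        obtain ⟨c1, c2⟩ := hclose x hx
        have : firstOrder h q φ x - firstOrder h q ψ x = h x * (φ x - ψ x)
            + ∑ j, q j x * (fderiv ℝ φ x (basisVec j) - fderiv ℝ ψ x (basisVec j)) := by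
          simp only [firstOrder, mul_sub, Finset.sum_sub_distrib]
          ring
        rw [this, add_mul, Finset.sum_mul]
        refine (norm_add_le _ _).trans (add_le_add ?_ ((norm_sum_le _ _).trans
          (Finset.sum_le_sum fun j _ => ?_)))
        · rw [norm_mul]; gcongr
        · rw [norm_mul]; gcongr; exact c2 j
    _ = (∫ x in B, w x) * (η / ((∫ x in B, w x) + 1)) := integral_mul_const _ _
    _ ≤ ((∫ x in B, w x) + 1) * (η / ((∫ x in B, w x) + 1)) := by gcongr; linarith
    _ = η := by field_simp

/-- A first order distribution vanishing on smooth functions vanishes on `C¹` functions. -/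
theorem integral_firstOrder_eq_zero_of_smooth {h : Space d → ℂ} {q : Fin d → Space d → ℂ}
    (hh : LocallyIntegrable h) (hq : ∀ j, LocallyIntegrable (q j))
    (H : ∀ φ : Space d → ℂ, ContDiff ℝ ∞ φ → HasCompactSupport φ → ∫ x, firstOrder h q φ x = 0)
    {φ : Space d → ℂ} (hφ : ContDiff ℝ 1 φ) (hc : HasCompactSupport φ) :
    ∫ x, firstOrder h q φ x = 0 := by
  obtain ⟨R, hR⟩ := exists_norm_bound_of_hasCompactSupport hc
  refine integral_firstOrder_eq_zero_of_approx hh hq hφ (R := R + 1)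
    (fun x hx => hR x (by linarith)) fun δ hδ => ?_
  obtain ⟨ψ, hψ, hψR, h1, h2⟩ := exists_smooth_approx hφ hR hδ
  exact ⟨ψ, hψ.of_le (by simp), hψR, fun x _ => ⟨h1 x, h2 x⟩,
    H ψ hψ (hasCompactSupport_of_norm hψR)⟩

/-- Countably many test functions suffice for first order distributions. -/
theorem exists_countable_test (d : ℕ) : ∃ D : Set (Space d → ℂ), D.Countable ∧
    (∀ φ ∈ D, ContDiff ℝ ∞ φ ∧ HasCompactSupport φ) ∧
    ∀ (h : Space d → ℂ) (q : Fin d → Space d → ℂ), LocallyIntegrable h →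
      (∀ j, LocallyIntegrable (q j)) → (∀ φ ∈ D, ∫ x, firstOrder h q φ x = 0) →
      ∀ φ : Space d → ℂ, ContDiff ℝ 1 φ → HasCompactSupport φ → ∫ x, firstOrder h q φ x = 0 := by
  let S : ℕ → Type := fun n =>
    {φ : Space d → ℂ // ContDiff ℝ ∞ φ ∧ ∀ x, (n : ℝ) < ‖x‖ → φ x = 0}
  let ι : ∀ n, S n → C(Space d, ℂ × (Fin d → ℂ)) := fun n φ =>
    ⟨fun x => (φ.1 x, fun j => fderiv ℝ φ.1 x (basisVec j)),
      φ.2.1.continuous.prodMk (continuous_pi fun j =>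
        (φ.2.1.continuous_fderiv (by simp)).clm_apply continuous_const)⟩
  have key : ∀ n, ∃ t : Set (S n), t.Countable ∧ ∀ φ : S n, ∀ δ : ℝ, 0 < δ → ∃ ψ ∈ t,
      ∀ x ∈ Metric.closedBall (0 : Space d) n, dist (ι n φ x) (ι n ψ x) < δ := by
    intro n
    -- The compact-open topology on maps from ℝ^d is second countable. The topology induced through
    -- φ ↦ (φ, ∇φ) is therefore separable, and closeness in it is uniform C¹ closeness on balls.
    let _ : TopologicalSpace (S n) := TopologicalSpace.induced (ι n) inferInstance
    have : SecondCountableTopology (S n) := (Topology.IsInducing.induced (ι n)).secondCountableTopology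
    obtain ⟨t, ht, htd⟩ := TopologicalSpace.exists_countable_dense (S n)
    refine ⟨t, ht, fun φ δ hδ => ?_⟩
    have hnhds : {g : C(Space d, ℂ × (Fin d → ℂ)) | ∀ x ∈ Metric.closedBall (0 : Space d) n,
        dist (ι n φ x) (g x) < δ} ∈ 𝓝 (ι n φ) := by
      have h1 : Tendsto (fun g : C(Space d, ℂ × (Fin d → ℂ)) => g) (𝓝 (ι n φ)) (𝓝 (ι n φ)) :=
        tendsto_id
      exact Metric.tendstoUniformlyOn_iff.1
        (ContinuousMap.tendsto_iff_forall_isCompact_tendstoUniformlyOn.1 h1 _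
          (isCompact_closedBall 0 (n : ℝ))) δ hδ
    have hpre := (continuous_induced_dom (f := ι n)).continuousAt (x := φ) hnhds
    obtain ⟨ψ, hψ, hψt⟩ := mem_closure_iff_nhds.1 (htd φ) _ hpre
    exact ⟨ψ, hψt, hψ⟩
  choose t ht hd using key
  refine ⟨⋃ n, Subtype.val '' t n, countable_iUnion fun n => (ht n).image _, ?_, ?_⟩
  · rintro φ hφ
    obtain ⟨n, ψ, _, rfl⟩ := mem_iUnion.1 hφ
    exact ⟨ψ.2.1, hasCompactSupport_of_norm ψ.2.2⟩
  · intro h q hh hq H φ hφ hc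
    refine integral_firstOrder_eq_zero_of_smooth hh hq (fun φ hφ hc => ?_) hφ hc
    obtain ⟨R, hR⟩ := exists_norm_bound_of_hasCompactSupport hc
    obtain ⟨n, hn⟩ := exists_nat_ge R
    have hnR : ∀ x, (n : ℝ) < ‖x‖ → φ x = 0 := fun x hx => hR x (hn.trans_lt hx)
    refine integral_firstOrder_eq_zero_of_approx hh hq (hφ.of_le (by simp)) hnR fun δ hδ => ?_
    obtain ⟨ψ, hψt, hψ⟩ := hd n ⟨φ, hφ, hnR⟩ δ hδ
    refine ⟨ψ.1, ψ.2.1.of_le (by simp), ψ.2.2, fun x hx => ?_,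
      H _ (mem_iUnion.2 ⟨n, ψ, hψt, rfl⟩)⟩
    have h1 := hψ x hx
    rw [Prod.dist_eq, max_lt_iff, dist_pi_lt_iff hδ] at h1
    exact ⟨by rw [← dist_eq_norm]; exact h1.1.le, fun j => by
      rw [← dist_eq_norm]; exact (h1.2 j).le⟩

end TestFunctions

/-! ### Elementary consequences of the flow axioms -/

section Flow

variable {d : ℕ} {Φ : ℝ → Space d → Space d}

theorem norm_le_sum_entries (L : Space d →L[ℝ] Space d) :
    ‖L‖ ≤ ∑ i, ∑ j, |L (basisVec j) i| := by
  refine L.opNorm_le_bound (by positivity) fun x => ?_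
  have hx : x = ∑ j, x j • (basisVec j : Space d) := by
    ext i
    simp [basisVec, Finset.sum_apply, Pi.single_apply]
  have h1 : ∀ i, |L x i| ≤ (∑ j, |L (basisVec j) i|) * ‖x‖ := by
    intro i
    have : L x i = ∑ j, x j * L (basisVec j) i := by
      conv_lhs => rw [hx]
      simp [map_sum]
    rw [this, Finset.sum_mul]
    refine (Finset.abs_sum_le_sum_abs _ _).trans (Finset.sum_le_sum fun j _ => ?_)
    rw [abs_mul, mul_comm]
    gcongr
    exact PiLp.norm_apply_le x j
  calc ‖L x‖ ≤ ∑ i, |L x i| := by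
        have h2 : L x = ∑ j, (L x) j • (basisVec j : Space d) := by
          ext i
          simp [basisVec, Finset.sum_apply, Pi.single_apply]
        conv_lhs => rw [h2]
        refine (norm_sum_le _ _).trans (Finset.sum_le_sum fun j _ => ?_)
        rw [norm_smul, norm_basisVec, mul_one, Real.norm_eq_abs]
    _ ≤ ∑ i, (∑ j, |L (basisVec j) i|) * ‖x‖ := Finset.sum_le_sum fun i _ => h1 i
    _ = _ := by rw [Finset.sum_mul]

theorem det_eq_det_entries (L : Space d →L[ℝ] Space d) :
    L.det = (Matrix.of fun i j => L (basisVec j) i).det := by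
  rw [ContinuousLinearMap.det, ← LinearMap.det_toMatrix (EuclideanSpace.basisFun (Fin d) ℝ).toBasis]
  congr 1

namespace IsAdmissibleFlow

variable (hΦ : IsAdmissibleFlow Φ)
include hΦ

theorem contDiff_apply (τ : ℝ) : ContDiff ℝ 1 (Φ τ) :=
  hΦ.contDiff.comp (contDiff_const.prodMk contDiff_id)

theorem differentiable_apply (τ : ℝ) : Differentiable ℝ (Φ τ) :=
  (hΦ.contDiff_apply τ).differentiable one_ne_zero

theorem det_fderiv (τ : ℝ) (x : Space d) : (fderiv ℝ (Φ τ) x).det = 1 := by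
  have := hΦ.det_jacobian (-τ) x
  rwa [jacobian, neg_neg, ← det_eq_det_entries] at this

/-- The group law alone makes Φ₀ idempotent. Its fixed points form a nonempty closed set, which is
also open: near a fixed point Φ₀ is injective because its determinant is 1, and an idempotent
injective map is the identity. Connectedness of ℝ^d concludes. -/
theorem zero_apply (x : Space d) : Φ 0 x = x := by
  have hidem : ∀ x, Φ 0 (Φ 0 x) = Φ 0 x := fun x => by rw [hΦ.group, add_zero]
  have hcont : Continuous (Φ 0) := (hΦ.contDiff_apply 0).continuous
  have hclosed : IsClosed {x | Φ 0 x = x} := isClosed_eq hcont continuous_id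
  have hopen : IsOpen {x | Φ 0 x = x} := by
    rw [isOpen_iff_mem_nhds]
    intro p hp
    have hp' : Φ 0 p = p := hp
    have hs : HasStrictFDerivAt (Φ 0) (fderiv ℝ (Φ 0) p) p :=
      (hΦ.contDiff_apply 0).contDiffAt.hasStrictFDerivAt one_ne_zero
    have hdet : (fderiv ℝ (Φ 0) p).det ≠ 0 := by rw [hΦ.det_fderiv]; exact one_ne_zero
    have hs' : HasStrictFDerivAt (Φ 0)
        (((fderiv ℝ (Φ 0) p).toContinuousLinearEquivOfDetNeZero hdet : Space d ≃L[ℝ] Space d) :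
          Space d →L[ℝ] Space d) p := by simpa using hs
    let e := hs'.toOpenPartialHomeomorph (Φ 0)
    have hsrc : e.source ∈ 𝓝 p :=
      e.open_source.mem_nhds hs'.mem_toOpenPartialHomeomorph_source
    have h2 : ∀ᶠ x in 𝓝 p, Φ 0 x ∈ e.source :=
      hcont.continuousAt.eventually_mem (by rw [hp']; exact hsrc)
    filter_upwards [hsrc, h2] with x hx hx2
    exact e.injOn hx2 hx (hidem x)
  have huniv : {x | Φ 0 x = x} = univ :=
    IsClopen.eq_univ ⟨hclosed, hopen⟩ ⟨Φ 0 0, hidem 0⟩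
  have hx : x ∈ {x | Φ 0 x = x} := huniv ▸ mem_univ x
  exact hx

theorem neg_apply_apply (τ : ℝ) (x : Space d) : Φ (-τ) (Φ τ x) = x := by
  rw [hΦ.group, neg_add_cancel, hΦ.zero_apply]

theorem apply_neg_apply (τ : ℝ) (x : Space d) : Φ τ (Φ (-τ) x) = x := by
  rw [hΦ.group, add_neg_cancel, hΦ.zero_apply]

theorem injective_apply (τ : ℝ) : Function.Injective (Φ τ) := fun x y h => by
  rw [← hΦ.neg_apply_apply τ x, h, hΦ.neg_apply_apply]

theorem measurePreserving_apply (τ : ℝ) : MeasurePreserving (Φ τ) volume volume := by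
  refine ⟨(hΦ.contDiff_apply τ).continuous.measurable, ?_⟩
  refine Measure.ext fun S hS => ?_
  rw [Measure.map_apply (hΦ.contDiff_apply τ).continuous.measurable hS]
  have hpre : Φ τ ⁻¹' S = Φ (-τ) '' S := by
    ext x
    constructor
    · intro hx
      exact ⟨Φ τ x, hx, hΦ.neg_apply_apply τ x⟩
    · rintro ⟨y, hy, rfl⟩
      rw [mem_preimage, hΦ.apply_neg_apply]
      exact hy
  rw [hpre, ← lintegral_abs_det_fderiv_eq_addHaar_image volume hS
    (fun x _ => (hΦ.differentiable_apply (-τ) x).hasFDerivAt.hasFDerivWithinAt)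
    (hΦ.injective_apply (-τ)).injOn]
  simp [hΦ.det_fderiv]

theorem fderiv_neg_comp_fderiv (τ : ℝ) (x : Space d) :
    (fderiv ℝ (Φ (-τ)) (Φ τ x)).comp (fderiv ℝ (Φ τ) x) = ContinuousLinearMap.id ℝ (Space d) := by
  rw [← fderiv_comp x (hΦ.differentiable_apply (-τ) _) (hΦ.differentiable_apply τ x)]
  have : Φ (-τ) ∘ Φ τ = id := funext (hΦ.neg_apply_apply τ)
  rw [this, fderiv_id]

theorem jacobian_mul_jacobian (τ : ℝ) (x : Space d) :
    jacobian Φ τ (Φ τ x) * jacobian Φ (-τ) x = 1 := by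
  ext i j
  have h := congrArg (fun L : Space d →L[ℝ] Space d => L (basisVec j) i)
    (hΦ.fderiv_neg_comp_fderiv τ x)
  have hx : fderiv ℝ (Φ τ) x (basisVec j)
      = ∑ l, (fderiv ℝ (Φ τ) x (basisVec j)) l • (basisVec l : Space d) := by
    ext i
    simp [basisVec, Finset.sum_apply, Pi.single_apply]
  simp only [ContinuousLinearMap.comp_apply, ContinuousLinearMap.id_apply] at h
  rw [hx, map_sum] at h
  simp only [map_smul, WithLp.ofLp_sum, WithLp.ofLp_smul, Finset.sum_apply, Pi.smul_apply,
    smul_eq_mul] at h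
  rw [Matrix.mul_apply, Matrix.one_apply]
  simp only [jacobian, Matrix.of_apply, neg_neg]
  convert! h using 1
  · exact Finset.sum_congr rfl fun l _ => mul_comm _ _
  · simp [basisVec]

/-- With determinant 1 the inverse matrix is the adjugate, a polynomial in the entries. The inverse
Jacobian thus stays in the algebra without any inversion there. -/
theorem adjugate_jacobian (τ : ℝ) (x : Space d) :
    (jacobian Φ τ (Φ τ x)).adjugate = jacobian Φ (-τ) x := by
  have h := congrArg ((jacobian Φ τ (Φ τ x)).adjugate * ·) (hΦ.jacobian_mul_jacobian τ x)
  simp only [mul_one, ← mul_assoc, Matrix.adjugate_mul, hΦ.det_jacobian, one_smul, one_mul] at h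
  exact h.symm

end IsAdmissibleFlow

end Flow

/-! ### Point evaluations -/

namespace MeanValueAlgebra

variable (A : MeanValueAlgebra)

/-- Evaluation at `τ` as a character. -/
noncomputable def evalChar (τ : ℝ) : A.Spectrum :=
  CharacterSpace.equivAlgHom.symm
    { toFun := fun a => a.1 τ
      map_one' := rfl
      map_mul' := fun _ _ => rfl
      map_zero' := rfl
      map_add' := fun _ _ => rfl
      commutes' := fun _ => rfl }

theorem evalChar_apply (τ : ℝ) (a : A.Elem) : A.evalChar τ a = a.1 τ := rfl

theorem elem_ext {a b : A.Elem} (h : ∀ τ, a.1 τ = b.1 τ) : a = b :=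
  Subtype.ext (BoundedContinuousFunction.ext h)

theorem elem_norm_le {a : A.Elem} {C : ℝ} (hC : 0 ≤ C) (h : ∀ τ, ‖a.1 τ‖ ≤ C) : ‖a‖ ≤ C :=
  (BoundedContinuousFunction.norm_le hC).2 h

/-- A Urysohn function separating a character from the closure of the evaluations would be the
transform of an element vanishing at every τ, hence of zero. Through this density, closed conditions
on characters are checked on the flow itself. -/
theorem denseRange_evalChar : DenseRange A.evalChar := by
  intro s₀
  by_contra hs
  obtain ⟨f, hf0, hf1, -⟩ := exists_continuous_zero_one_of_isClosed
    (isClosed_closure (s := range A.evalChar)) (isClosed_singleton (x := s₀))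
    (disjoint_singleton_right.2 hs)
  let F : C(A.Spectrum, ℂ) := ⟨fun s => (f s : ℂ), Complex.continuous_ofReal.comp f.continuous⟩
  let a : A.Elem := (gelfandStarTransform A.Elem).symm F
  have ha : ∀ s : A.Spectrum, s a = f s := fun s =>
    DFunLike.congr_fun ((gelfandStarTransform A.Elem).apply_symm_apply F) s
  have ha0 : a = 0 := A.elem_ext fun τ => by
    rw [← A.evalChar_apply, ha, hf0 (subset_closure (mem_range_self τ))]
    simp
  have := ha s₀
  rw [ha0, map_zero, hf1 rfl] at this
  simp at this

/-- Joint continuity uses that the Gelfand transform is isometric into the continuous functions on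
the compact spectrum, where evaluation is jointly continuous. -/
theorem continuous_char_apply {X : Type*} [TopologicalSpace X] {F : X → A.Elem}
    (hF : Continuous F) : Continuous fun p : A.Spectrum × X => p.1 (F p.2) := by
  have h1 : Continuous fun p : A.Spectrum × X => gelfandTransform ℂ A.Elem (F p.2) :=
    (gelfandTransform_isometry A.Elem).continuous.comp (hF.comp continuous_snd)
  exact h1.eval continuous_fst

theorem star_eq_of_real {a : A.Elem} (h : ∀ τ, ∃ r : ℝ, a.1 τ = r) : star a = a :=
  A.elem_ext fun τ => by
    obtain ⟨r, hr⟩ := h τ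
    change star (a.1 τ) = a.1 τ
    rw [hr]
    exact Complex.conj_ofReal r

/-- Real-valued elements are self-adjoint, and characters of a C*-algebra preserve the star. -/
theorem char_eq_re {a : A.Elem} (h : ∀ τ, ∃ r : ℝ, a.1 τ = r) (s : A.Spectrum) :
    s a = ((s a).re : ℂ) := by
  refine (Complex.conj_eq_iff_re.1 ?_).symm
  have h1 : s (star a) = star (s a) := map_star s a
  rw [A.star_eq_of_real h] at h1
  exact h1.symm

end MeanValueAlgebra

/-! ### The limit charts of the flow -/

section Chart

variable {d : ℕ} {A : MeanValueAlgebra}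

/-- The inverse of the Jacobian matrix `Jt`, i.e. the Jacobian matrix of the forward flow. -/
noncomputable def invJac (Jt : Fin d → Fin d → Space d → A.Elem) (i j : Fin d) (X : Space d) :
    A.Elem :=
  (Matrix.of fun i j => Jt i j X).adjugate i j

theorem continuous_invJac {Jt : Fin d → Fin d → Space d → A.Elem}
    (hJc : ∀ i j, Continuous (Jt i j)) (i j : Fin d) : Continuous (invJac Jt i j) := by
  have h : Continuous fun X => (Matrix.of fun i j => Jt i j X : Matrix (Fin d) (Fin d) A.Elem) :=
    continuous_matrix fun i j => hJc i j
  exact h.matrix_adjugate.matrix_elem i j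

/-- The displacement `Φ_τ(X) - Φ_τ(0)` as an element of the algebra. -/
noncomputable def displacement (Jt : Fin d → Fin d → Space d → A.Elem) (i : Fin d) (X : Space d) :
    A.Elem :=
  ∫ θ in (0 : ℝ)..1, ∑ j, (X j) • invJac Jt i j (θ • X)

/-- The value of the displacement at a character. -/
noncomputable def chart (Jt : Fin d → Fin d → Space d → A.Elem) (s : A.Spectrum) (X : Space d) :
    Space d :=
  WithLp.toLp 2 fun i => (s (displacement Jt i X)).re

variable {Φ : ℝ → Space d → Space d} {Jt : Fin d → Fin d → Space d → A.Elem}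

/-- `Jt` is the flow representation of the Jacobian matrix of the flow `Φ`. -/
structure IsFlowJacobian (Φ : ℝ → Space d → Space d) (Jt : Fin d → Fin d → Space d → A.Elem) :
    Prop where
  flow : IsAdmissibleFlow Φ
  cont : ∀ i j, Continuous (Jt i j)
  eq : ∀ i j X τ, (Jt i j X).1 τ = ((jacobian Φ τ (Φ τ X) i j : ℝ) : ℂ)

namespace IsFlowJacobian

variable (H : IsFlowJacobian Φ Jt)
include H

theorem invJac_apply (i j : Fin d) (X : Space d) (τ : ℝ) :
    (invJac Jt i j X).1 τ = ((jacobian Φ (-τ) X i j : ℝ) : ℂ) := by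
  let ev : A.Elem →+* ℂ := RingHomClass.toRingHom (A.evalChar τ)
  have h1 : (invJac Jt i j X).1 τ = ev.mapMatrix (Matrix.of fun i j => Jt i j X).adjugate i j := rfl
  rw [h1, RingHom.map_adjugate]
  have h2 : ev.mapMatrix (Matrix.of fun i j => Jt i j X)
      = Complex.ofRealHom.mapMatrix (jacobian Φ τ (Φ τ X)) := by
    ext i j
    exact H.eq i j X τ
  rw [h2, ← RingHom.map_adjugate, H.flow.adjugate_jacobian]
  rfl

theorem det_eq_one (X : Space d) : (Matrix.of fun i j => Jt i j X).det = 1 := by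
  refine A.elem_ext fun τ => ?_
  let ev : A.Elem →+* ℂ := RingHomClass.toRingHom (A.evalChar τ)
  have h2 : ev.mapMatrix (Matrix.of fun i j => Jt i j X)
      = Complex.ofRealHom.mapMatrix (jacobian Φ τ (Φ τ X)) := by
    ext i j
    exact H.eq i j X τ
  have h1 : ev (Matrix.of fun i j => Jt i j X).det = 1 := by
    rw [RingHom.map_det, h2, ← RingHom.map_det, H.flow.det_jacobian, map_one]
  exact h1

theorem sum_invJac_mul (X : Space d) (i j : Fin d) :
    ∑ l, invJac Jt i l X * Jt l j X = if i = j then 1 else 0 := by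
  have h := congrFun₂ (Matrix.adjugate_mul (Matrix.of fun i j => Jt i j X)) i j
  rw [H.det_eq_one, one_smul, Matrix.mul_apply, Matrix.one_apply] at h
  exact h

theorem fderiv_apply_basisVec (τ : ℝ) (X : Space d) (i j : Fin d) :
    ((fderiv ℝ (Φ τ) X (basisVec j) i : ℝ) : ℂ) = (invJac Jt i j X).1 τ := by
  rw [H.invJac_apply, jacobian, neg_neg]
  rfl

/-- Uniformity in τ is built into the hypothesis: the norm of the algebra is a supremum over τ, so
continuity of the inverse Jacobian into the algebra makes DΦ_τ equicontinuous on balls. The mean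
value inequality does the rest. -/
theorem exists_derivative_estimate (R : ℝ) {η : ℝ} (hη : 0 < η) :
    ∃ r > 0, ∀ X : Space d, ‖X‖ ≤ R → ∀ Z, ‖Z - X‖ ≤ r → ∀ τ,
      ‖Φ τ Z - Φ τ X - fderiv ℝ (Φ τ) X (Z - X)‖ ≤ η * ‖Z - X‖ := by
  let B : Space d → Fin d → Fin d → A.Elem := fun X i j => invJac Jt i j X
  have hB : Continuous B := continuous_pi fun i => continuous_pi fun j =>
    continuous_invJac H.cont i j
  have hUC := (isCompact_closedBall (0 : Space d) (R + 1)).uniformContinuousOn_of_continuous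
    hB.continuousOn
  -- The operator norm is bounded by the sum of the d² entries; the added 1 keeps the denominator
  -- positive when d = 0.
  have hη' : 0 < η / (d * d + 1) := by positivity
  obtain ⟨r, hr, h⟩ := Metric.uniformContinuousOn_iff.1 hUC _ hη'
  refine ⟨min 1 (r / 2), by positivity, fun X hX Z hZ τ => ?_⟩
  have hder : ∀ Y ∈ Metric.closedBall X (min 1 (r / 2)),
      ‖fderiv ℝ (Φ τ) Y - fderiv ℝ (Φ τ) X‖ ≤ η := by
    intro Y hY
    have hYX : dist Y X ≤ min 1 (r / 2) := hY
    have hY1 : Y ∈ Metric.closedBall (0 : Space d) (R + 1) := by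
      rw [mem_closedBall_zero_iff]
      have h1 := norm_sub_norm_le Y X
      rw [← dist_eq_norm] at h1
      have := hYX.trans (min_le_left _ _)
      linarith
    have hX1 : X ∈ Metric.closedBall (0 : Space d) (R + 1) := by
      rw [mem_closedBall_zero_iff]; linarith
    have h2 := h Y hY1 X hX1 (by have := hYX.trans (min_le_right _ _); linarith)
    refine (norm_le_sum_entries _).trans ?_
    have h3 : ∀ i j, |(fderiv ℝ (Φ τ) Y - fderiv ℝ (Φ τ) X) (basisVec j) i|
        ≤ η / (d * d + 1) := by
      intro i j
      have h4 : (((fderiv ℝ (Φ τ) Y - fderiv ℝ (Φ τ) X) (basisVec j) i : ℝ) : ℂ)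
          = (B Y i j - B X i j).1 τ := by
        simp only [sub_apply, PiLp.sub_apply, Complex.ofReal_sub, H.fderiv_apply_basisVec]
        rfl
      rw [← Real.norm_eq_abs, ← Complex.norm_real, h4]
      refine (BoundedContinuousFunction.norm_coe_le_norm _ τ).trans ?_
      change ‖B Y i j - B X i j‖ ≤ _
      rw [← dist_eq_norm]
      exact ((dist_le_pi_dist _ _ j).trans (dist_le_pi_dist _ _ i)).trans h2.le
    calc _ ≤ ∑ _i : Fin d, ∑ _j : Fin d, η / (d * d + 1) :=
          Finset.sum_le_sum fun i _ => Finset.sum_le_sum fun j _ => h3 i j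
      _ = η * ((d * d) / (d * d + 1)) := by simp; ring
      _ ≤ η * 1 := by
          gcongr
          rw [div_le_one (by positivity)]
          linarith
      _ = η := mul_one η
  refine (convex_closedBall X (min 1 (r / 2))).norm_image_sub_le_of_norm_hasFDerivWithin_le'
    (fun Y _ => (H.flow.differentiable_apply τ Y).hasFDerivAt.hasFDerivWithinAt) hder
    (Metric.mem_closedBall_self (by positivity)) ?_
  rw [Metric.mem_closedBall, dist_eq_norm]
  exact hZ

/-- The entries of the inverse of DΦ_τ(X) are those of `Jt`, whose algebra norms are bounded on the
ball; these norms bound all τ at once. -/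
theorem exists_inverse_bound (R : ℝ) : ∃ M > 0, ∀ X : Space d, ‖X‖ ≤ R → ∀ τ h,
    ‖h‖ ≤ M * ‖fderiv ℝ (Φ τ) X h‖ := by
  have hc : Continuous fun X => ∑ i, ∑ j, ‖Jt i j X‖ := by
    have := H.cont
    fun_prop
  obtain ⟨C, hC⟩ := (isCompact_closedBall (0 : Space d) R).exists_bound_of_continuousOn
    hc.continuousOn
  refine ⟨max C 1, by positivity, fun X hX τ h => ?_⟩
  have h1 := congrArg (fun L : Space d →L[ℝ] Space d => L h) (H.flow.fderiv_neg_comp_fderiv τ X)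
  simp only [ContinuousLinearMap.comp_apply, ContinuousLinearMap.id_apply] at h1
  conv_lhs => rw [← h1]
  refine (ContinuousLinearMap.le_opNorm _ _).trans ?_
  gcongr
  refine (norm_le_sum_entries _).trans (le_trans ?_ (le_max_left C 1))
  refine le_trans ?_ ((le_abs_self _).trans (hC X (by simpa using hX)))
  refine Finset.sum_le_sum fun i _ => Finset.sum_le_sum fun j _ => ?_
  have h2 : ((fderiv ℝ (Φ (-τ)) (Φ τ X) (basisVec j) i : ℝ) : ℂ) = (Jt i j X).1 τ := by
    rw [H.eq]; rfl
  rw [← Real.norm_eq_abs, ← Complex.norm_real, h2]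
  exact BoundedContinuousFunction.norm_coe_le_norm _ τ

/-- The flow separates points, uniformly in time and locally uniformly in space. -/
theorem exists_separation (R : ℝ) : ∃ C > 0, ∃ δ > 0, ∀ X : Space d, ‖X‖ ≤ R → ∀ Z τ,
    ‖Φ τ X - Φ τ Z‖ < δ → ‖X - Z‖ ≤ C * ‖Φ τ X - Φ τ Z‖ := by
  obtain ⟨M, hM, hinv⟩ := H.exists_inverse_bound R
  -- With this η the linearization error, multiplied by M, is half of ‖Z - X‖ and is absorbed.
  obtain ⟨r, hr, hder⟩ := H.exists_derivative_estimate R (η := 1 / (2 * M)) (by positivity)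
  have hloc : ∀ X : Space d, ‖X‖ ≤ R → ∀ Z, ‖Z - X‖ ≤ r → ∀ τ,
      ‖X - Z‖ ≤ 2 * M * ‖Φ τ X - Φ τ Z‖ := by
    intro X hX Z hZ τ
    have h1 := hder X hX Z hZ τ
    have h2 := hinv X hX τ (Z - X)
    have h3 : ‖fderiv ℝ (Φ τ) X (Z - X)‖ ≤ ‖Φ τ Z - Φ τ X‖ + 1 / (2 * M) * ‖Z - X‖ := by
      have := norm_sub_norm_le (fderiv ℝ (Φ τ) X (Z - X)) (Φ τ Z - Φ τ X)
      rw [norm_sub_rev (fderiv ℝ (Φ τ) X (Z - X)) (Φ τ Z - Φ τ X)] at this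
      linarith
    have h4 := h2.trans (mul_le_mul_of_nonneg_left h3 hM.le)
    have h5 : M * (‖Φ τ Z - Φ τ X‖ + 1 / (2 * M) * ‖Z - X‖)
        = M * ‖Φ τ Z - Φ τ X‖ + ‖Z - X‖ / 2 := by field_simp
    rw [norm_sub_rev X Z, norm_sub_rev (Φ τ X)]
    linarith
  refine ⟨2 * M, by positivity, r / (2 * M), by positivity, fun X hX Z τ hZ => ?_⟩
  refine hloc X hX Z (not_lt.1 fun hlt => ?_) τ
  -- The local estimate becomes global by connectedness. The inverse image of a small ball around
  -- Φ_τ(X) is connected and contains X and Z. If Z were farther than r from X, some point of it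
  -- would be at distance exactly r, where the local estimate forces its image out of the ball.
  have hpre : IsPreconnected (Φ (-τ) '' Metric.ball (Φ τ X) (r / (2 * M))) :=
    ((convex_ball _ _).isPreconnected).image _
      (H.flow.contDiff_apply (-τ)).continuous.continuousOn
  have hXm : X ∈ Φ (-τ) '' Metric.ball (Φ τ X) (r / (2 * M)) :=
    ⟨Φ τ X, Metric.mem_ball_self (by positivity), H.flow.neg_apply_apply τ X⟩
  have hZm : Z ∈ Φ (-τ) '' Metric.ball (Φ τ X) (r / (2 * M)) :=
    ⟨Φ τ Z, by rwa [Metric.mem_ball, dist_eq_norm, norm_sub_rev], H.flow.neg_apply_apply τ Z⟩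
  have hivt := hpre.intermediate_value hXm hZm
    (f := fun Y => ‖Y - X‖) (by fun_prop)
  have hrm : r ∈ Icc ‖X - X‖ ‖Z - X‖ := by simpa using ⟨hr.le, hlt.le⟩
  obtain ⟨_, ⟨y, hy, rfl⟩, hYr⟩ := hivt hrm
  simp only at hYr
  have h1 := hloc X hX (Φ (-τ) y) hYr.le τ
  rw [H.flow.apply_neg_apply, norm_sub_rev, hYr, ← dist_eq_norm, dist_comm] at h1
  have h2 : dist y (Φ τ X) < r / (2 * M) := hy
  rw [lt_div_iff₀ (by positivity)] at h2
  linarith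

/-- The fundamental theorem of calculus along the segment from 0 to X. Subtracting Φ_τ(0) is
essential, since Φ_τ(X) alone need not be bounded in τ. -/
theorem displacement_apply (i : Fin d) (X : Space d) (τ : ℝ) :
    (displacement Jt i X).1 τ = ((Φ τ X i - Φ τ 0 i : ℝ) : ℂ) := by
  let ev : A.Elem →L[ℝ] ℂ :=
    ((BoundedContinuousFunction.evalCLM ℂ τ).restrictScalars ℝ).comp
      ((A.carrier.toSubalgebra.toSubmodule.subtypeL).restrictScalars ℝ)
  have hcont : Continuous fun θ : ℝ => ∑ j, (X j) • invJac Jt i j (θ • X) := by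
    have := fun j => continuous_invJac H.cont i j
    fun_prop
  have h1 : (displacement Jt i X).1 τ
      = ∫ θ in (0 : ℝ)..1, ev (∑ j, (X j) • invJac Jt i j (θ • X)) := by
    rw [ContinuousLinearMap.intervalIntegral_comp_comm ev (hcont.intervalIntegrable _ _)]
    rfl
  have hd : ∀ θ : ℝ, HasDerivAt (fun θ : ℝ => ((Φ τ (θ • X) i : ℝ) : ℂ))
      (ev (∑ j, (X j) • invJac Jt i j (θ • X))) θ := by
    intro θ
    have h2 : HasDerivAt (fun θ : ℝ => θ • X) X θ := by
      simpa using (hasDerivAt_id θ).smul_const X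
    have h3 := (H.flow.differentiable_apply τ (θ • X)).hasFDerivAt.comp_hasDerivAt θ h2
    have h4 := ((EuclideanSpace.proj (𝕜 := ℝ) i).hasFDerivAt.comp_hasDerivAt θ h3).ofReal_comp
    refine h4.congr_deriv ?_
    have hX : X = ∑ j, X j • (basisVec j : Space d) := by
      ext i
      simp [basisVec, Finset.sum_apply, Pi.single_apply]
    have h5 : ((fderiv ℝ (Φ τ) (θ • X) X i : ℝ) : ℂ)
        = ∑ j, (X j : ℂ) * ((fderiv ℝ (Φ τ) (θ • X) (basisVec j) i : ℝ) : ℂ) := by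
      conv_lhs => rw [congrArg (fderiv ℝ (Φ τ) (θ • X)) hX]
      simp [map_sum]
    refine h5.trans ?_
    simp_rw [H.fderiv_apply_basisVec, map_sum, map_smul, Complex.real_smul]
    rfl
  rw [h1, intervalIntegral.integral_eq_sub_of_hasDerivAt (fun θ _ => hd θ)
    ((ev.continuous.comp hcont).intervalIntegrable _ _)]
  simp

/-- Differentiability in the norm of the algebra is precisely the linearization estimate for the
flow that is uniform in τ. -/
theorem hasFDerivAt_displacement (i : Fin d) (X : Space d) :
    HasFDerivAt (displacement Jt i)
      (∑ j, (EuclideanSpace.proj (𝕜 := ℝ) j : Space d →L[ℝ] ℝ).smulRight (invJac Jt i j X)) X := by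
  rw [hasFDerivAt_iff_isLittleO, Asymptotics.isLittleO_iff]
  intro η hη
  obtain ⟨r, hr, h⟩ := H.exists_derivative_estimate ‖X‖ hη
  filter_upwards [Metric.closedBall_mem_nhds X hr] with Z hZ
  rw [Metric.mem_closedBall, dist_eq_norm] at hZ
  refine A.elem_norm_le (by positivity) fun τ => ?_
  have h1 := h X le_rfl Z hZ τ
  refine le_trans (le_of_eq ?_) ((PiLp.norm_apply_le _ i).trans h1)
  rw [← Complex.norm_real]
  congr 1
  have hX : Z - X = ∑ j, (Z - X) j • (basisVec j : Space d) := by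
    ext i
    simp [basisVec, Finset.sum_apply, Pi.single_apply]
  have h5 : ((fderiv ℝ (Φ τ) X (Z - X) i : ℝ) : ℂ)
      = ∑ j, ((Z - X) j : ℂ) * ((fderiv ℝ (Φ τ) X (basisVec j) i : ℝ) : ℂ) := by
    conv_lhs => rw [congrArg (fderiv ℝ (Φ τ) X) hX]
    simp [map_sum]
  have h6 : ((∑ j, (EuclideanSpace.proj (𝕜 := ℝ) j : Space d →L[ℝ] ℝ).smulRight
      (invJac Jt i j X)) (Z - X)).1 τ = ∑ j, ((Z - X) j : ℂ) * (invJac Jt i j X).1 τ := by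
    have : ∀ a : A.Elem, a.1 τ = A.evalChar τ a := fun a => rfl
    simp only [this, sum_apply, ContinuousLinearMap.smulRight_apply, map_sum]
    rfl
  have h7 : (displacement Jt i Z - displacement Jt i X
      - (∑ j, (EuclideanSpace.proj (𝕜 := ℝ) j : Space d →L[ℝ] ℝ).smulRight
      (invJac Jt i j X)) (Z - X)).1 τ = (displacement Jt i Z).1 τ - (displacement Jt i X).1 τ
      - ((∑ j, (EuclideanSpace.proj (𝕜 := ℝ) j : Space d →L[ℝ] ℝ).smulRight
      (invJac Jt i j X)) (Z - X)).1 τ := rfl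
  rw [h7, h6, H.displacement_apply, H.displacement_apply]
  simp_rw [← H.fderiv_apply_basisVec]
  rw [← h5]
  simp

end IsFlowJacobian

end Chart

/-! ### Passage from the flow to the charts by density of evaluations -/

section Chart

variable {d : ℕ} {A : MeanValueAlgebra} {Φ : ℝ → Space d → Space d}
  {Jt : Fin d → Fin d → Space d → A.Elem}

namespace IsFlowJacobian

variable (H : IsFlowJacobian Φ Jt)
include H

/-- At an evaluation the chart is the flow up to a translation, which disappears from the
differences of chart values used below. -/
theorem chart_evalChar (τ : ℝ) (X : Space d) : chart Jt (A.evalChar τ) X = Φ τ X - Φ τ 0 := by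
  ext i
  simp [chart, A.evalChar_apply, H.displacement_apply]

theorem continuous_displacement (i : Fin d) : Continuous (displacement Jt i) :=
  continuous_iff_continuousAt.2 fun X => (H.hasFDerivAt_displacement i X).continuousAt

theorem continuous_chart : Continuous fun p : A.Spectrum × Space d => chart Jt p.1 p.2 := by
  unfold chart
  refine (PiLp.continuous_toLp 2 _).comp (continuous_pi fun i => ?_)
  exact Complex.continuous_re.comp (A.continuous_char_apply (H.continuous_displacement i))

theorem hasFDerivAt_chart_apply (s : A.Spectrum) (i : Fin d) (X : Space d) :
    HasFDerivAt (fun X => chart Jt s X i)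
      (∑ j, (s (invJac Jt i j X)).re • (EuclideanSpace.proj (𝕜 := ℝ) j : Space d →L[ℝ] ℝ)) X := by
  let L : A.Elem →L[ℝ] ℝ :=
    Complex.reCLM.comp ((CharacterSpace.toCLM s).restrictScalars ℝ)
  have h := L.hasFDerivAt.comp X (H.hasFDerivAt_displacement i X)
  refine h.congr_fderiv ?_
  ext v
  simp only [ContinuousLinearMap.comp_apply, sum_apply, ContinuousLinearMap.smulRight_apply,
    map_sum, map_smul, smul_apply, smul_eq_mul]
  exact Finset.sum_congr rfl fun j _ => mul_comm _ _

theorem contDiff_chart (s : A.Spectrum) : ContDiff ℝ 1 (chart Jt s) := by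
  refine contDiff_euclidean.2 fun i => ?_
  refine contDiff_one_iff_hasFDerivAt.2 ⟨_, ?_, H.hasFDerivAt_chart_apply s i⟩
  refine continuous_finsetSum _ fun j _ => Continuous.smul
    (f := fun X => (s (invJac Jt i j X)).re) ?_ continuous_const
  exact Complex.continuous_re.comp
    ((map_continuous (CharacterSpace.toCLM s)).comp (continuous_invJac H.cont i j))

theorem fderiv_chart (s : A.Spectrum) (X : Space d) (i j : Fin d) :
    fderiv ℝ (chart Jt s) X (basisVec j) i = (s (invJac Jt i j X)).re := by
  have h1 := ((H.contDiff_chart s).differentiable one_ne_zero X).hasFDerivAt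
  have h2 := ((EuclideanSpace.proj (𝕜 := ℝ) i).hasFDerivAt.comp X h1).unique
    (H.hasFDerivAt_chart_apply s i X)
  have h3 := congrArg (fun L : Space d →L[ℝ] ℝ => L (basisVec j)) h2
  simpa [basisVec, sum_apply, Pi.single_apply] using h3

theorem char_invJac_eq_re (s : A.Spectrum) (i j : Fin d) (X : Space d) :
    s (invJac Jt i j X) = ((s (invJac Jt i j X)).re : ℂ) :=
  A.char_eq_re (fun τ => ⟨_, H.invJac_apply i j X τ⟩) s

theorem sum_char_invJac_mul (s : A.Spectrum) (X : Space d) (i j : Fin d) :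
    ∑ l, s (invJac Jt i l X) * s (Jt l j X) = if i = j then 1 else 0 := by
  have h := congrArg s (H.sum_invJac_mul X i j)
  rw [map_sum] at h
  simp_rw [map_mul] at h
  rw [h]
  split_ifs <;> simp

theorem exists_chart_separation (R : ℝ) : ∃ C > 0, ∃ δ > 0, ∀ X : Space d, ‖X‖ ≤ R →
    ∀ (Z : Space d) (s : A.Spectrum), ‖chart Jt s X - chart Jt s Z‖ < δ →
      ‖X - Z‖ ≤ C * ‖chart Jt s X - chart Jt s Z‖ := by
  obtain ⟨C, hC, δ, hδ, h⟩ := H.exists_separation R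
  refine ⟨C, hC, δ, hδ, fun X hX Z s => ?_⟩
  have hc : ∀ X : Space d, Continuous fun s : A.Spectrum => chart Jt s X := fun X =>
    H.continuous_chart.comp (by fun_prop : Continuous fun s : A.Spectrum => (s, X))
  have hn : Continuous fun s : A.Spectrum => ‖chart Jt s X - chart Jt s Z‖ :=
    ((hc X).sub (hc Z)).norm
  -- An implication with a strict inequality as premise becomes a union of two closed conditions, so
  -- that it survives the limit in s.
  have hclosed : IsClosed {s : A.Spectrum | δ ≤ ‖chart Jt s X - chart Jt s Z‖ ∨
      ‖X - Z‖ ≤ C * ‖chart Jt s X - chart Jt s Z‖} :=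
    (isClosed_le continuous_const hn).union (isClosed_le continuous_const (hn.const_mul C))
  have hall := A.denseRange_evalChar.induction_on
    (p := fun s : A.Spectrum => δ ≤ ‖chart Jt s X - chart Jt s Z‖ ∨
      ‖X - Z‖ ≤ C * ‖chart Jt s X - chart Jt s Z‖) s hclosed fun τ => by
    rw [H.chart_evalChar, H.chart_evalChar, sub_sub_sub_cancel_right]
    by_cases hlt : ‖Φ τ X - Φ τ Z‖ < δ
    · exact Or.inr (h X hX Z τ hlt)
    · exact Or.inl (not_lt.1 hlt)
  intro hlt
  exact hall.resolve_left hlt.not_ge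

/-- The form of volume preservation that passes to limits in s. At evaluations it is invariance of
Lebesgue measure under Φ_τ. Separation confines the integrand to a ball independent of s, which
makes the integral continuous in s. -/
theorem exists_integral_bump_chart (R : ℝ) : ∃ δ > 0, ∀ b : ContDiffBump (0 : Space d),
    b.rOut < δ → ∀ X : Space d, ‖X‖ ≤ R → ∀ s : A.Spectrum,
      ∫ Z, b.normed volume (chart Jt s X - chart Jt s Z) = 1 := by
  obtain ⟨C, hC, δ, hδ, h⟩ := H.exists_chart_separation R
  refine ⟨δ, hδ, fun b hb X hX s => ?_⟩
  have hcont : Continuous fun s : A.Spectrum =>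
      ∫ Z, b.normed volume (chart Jt s X - chart Jt s Z) := by
    refine continuousOn_univ.1 (continuousOn_integral_of_compact_support
      (isCompact_closedBall X (C * δ)) (Continuous.continuousOn ?_) ?_)
    · have h1 : Continuous fun p : A.Spectrum × Space d => chart Jt p.1 X :=
        H.continuous_chart.comp (by fun_prop : Continuous fun p : A.Spectrum × Space d => (p.1, X))
      exact b.continuous_normed.comp (h1.sub H.continuous_chart)
    · intro s Z _ hZ
      by_contra hne
      have hsupp : chart Jt s X - chart Jt s Z ∈ Function.support (b.normed volume) := hne
      rw [b.support_normed_eq, mem_ball_zero_iff] at hsupp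
      refine hZ ?_
      rw [Metric.mem_closedBall, dist_comm, dist_eq_norm]
      refine (h X hX Z s (hsupp.trans hb)).trans ?_
      gcongr
      exact (hsupp.trans hb).le
  refine A.denseRange_evalChar.induction_on
    (p := fun s : A.Spectrum => ∫ Z, b.normed volume (chart Jt s X - chart Jt s Z) = 1) s
    (isClosed_eq hcont continuous_const) fun τ => ?_
  simp_rw [H.chart_evalChar, sub_sub_sub_cancel_right]
  have hemb : MeasurableEmbedding (Φ τ) :=
    (H.flow.contDiff_apply τ).continuous.measurableEmbedding (H.flow.injective_apply τ)
  rw [(H.flow.measurePreserving_apply τ).integral_comp hemb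
    (g := fun w => b.normed volume (Φ τ X - w)), integral_sub_left_eq_self]
  exact b.integral_normed

end IsFlowJacobian

end Chart

/-! ### Weak gradients obtained by mollification in a chart -/

section ChartGradient

variable {d : ℕ} {A : MeanValueAlgebra} {Φ : ℝ → Space d → Space d}
  {Jt : Fin d → Fin d → Space d → A.Elem}

/-- A normalized bump function, with complex values. -/
noncomputable def bump (b : ContDiffBump (0 : Space d)) (w : Space d) : ℂ :=
  (b.normed volume w : ℂ)

theorem contDiff_bump (b : ContDiffBump (0 : Space d)) : ContDiff ℝ ∞ (bump b) :=
  Complex.ofRealCLM.contDiff.comp b.contDiff_normed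

theorem bump_eq_zero (b : ContDiffBump (0 : Space d)) {w : Space d} (hw : b.rOut < ‖w‖) :
    bump b w = 0 := by
  have : w ∉ Function.support (b.normed volume) := by
    rw [b.support_normed_eq, mem_ball_zero_iff]
    exact hw.not_gt
  simp [bump, Function.notMem_support.1 this]

theorem fderiv_bump_eq_zero (b : ContDiffBump (0 : Space d)) {w : Space d} (hw : b.rOut < ‖w‖) :
    fderiv ℝ (bump b) w = 0 :=
  fderiv_eq_zero_of_norm (fun _ hx => bump_eq_zero b hx) hw

theorem exists_bump_sequence (d : ℕ) {c : ℝ} (hc : 0 < c) : ∃ b : ℕ → ContDiffBump (0 : Space d),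
    (∀ m, (b m).rOut ≤ c) ∧ Tendsto (fun m => (b m).rOut) atTop (𝓝 0) := by
  refine ⟨fun m => ⟨c / (m + 1) / 2, c / (m + 1), by positivity, half_lt_self (by positivity)⟩,
    fun m => div_le_self hc.le (by simp), ?_⟩
  exact tendsto_const_div_atTop_nhds_zero_nat c |>.comp (tendsto_add_atTop_nat 1) |>.congr
    fun m => by simp

/-- Mollification in the coordinates given by a chart. -/
noncomputable def chartMollify (Jt : Fin d → Fin d → Space d → A.Elem) (s : A.Spectrum)
    (b : ContDiffBump (0 : Space d)) (g : Space d → ℂ) (X : Space d) : ℂ :=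
  ∫ Z, bump b (chart Jt s X - chart Jt s Z) * g Z

namespace IsFlowJacobian

variable (H : IsFlowJacobian Φ Jt)
include H

theorem fderiv_comp_chart_sub (s : A.Spectrum) {f : Space d → ℂ} (hf : ContDiff ℝ 1 f)
    (c X : Space d) (j : Fin d) :
    fderiv ℝ (fun X => f (chart Jt s X - c)) X (basisVec j)
      = ∑ l, fderiv ℝ f (chart Jt s X - c) (basisVec l) * s (invJac Jt l j X) := by
  have h1 := ((H.contDiff_chart s).differentiable one_ne_zero X).hasFDerivAt.sub_const c
  have h2 := (hf.differentiable one_ne_zero (chart Jt s X - c)).hasFDerivAt.comp X h1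
  have h3 : fderiv ℝ (fun X => f (chart Jt s X - c)) X = _ := h2.fderiv
  have hx : fderiv ℝ (chart Jt s) X (basisVec j)
      = ∑ l, (fderiv ℝ (chart Jt s) X (basisVec j)) l • (basisVec l : Space d) := by
    ext i
    simp [basisVec, Finset.sum_apply, Pi.single_apply]
  rw [h3, ContinuousLinearMap.comp_apply, hx, map_sum]
  refine Finset.sum_congr rfl fun l _ => ?_
  rw [map_smul, H.fderiv_chart, Complex.real_smul, ← H.char_invJac_eq_re, mul_comm]

theorem fderiv_comp_sub_chart (s : A.Spectrum) {f : Space d → ℂ} (hf : ContDiff ℝ 1 f)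
    (c X : Space d) (j : Fin d) :
    fderiv ℝ (fun X => f (c - chart Jt s X)) X (basisVec j)
      = -∑ l, fderiv ℝ f (c - chart Jt s X) (basisVec l) * s (invJac Jt l j X) := by
  have hneg : ContDiff ℝ 1 fun w => f (-w) := hf.comp contDiff_neg
  have h1 := H.fderiv_comp_chart_sub s hneg c X j
  simp only [neg_sub] at h1
  rw [h1, ← Finset.sum_neg_distrib]
  refine Finset.sum_congr rfl fun l _ => ?_
  have h2 := (hf.differentiable one_ne_zero (-(chart Jt s X - c))).hasFDerivAt.comp
    (chart Jt s X - c) (hasFDerivAt_id _).neg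
  have h3 : fderiv ℝ (fun w => f (-w)) (chart Jt s X - c) = _ := h2.fderiv
  rw [h3]
  simp

/-- The mollification is an average of g with nonnegative weights of total mass 1, so its error is
at most the oscillation of g on the support of the weights. -/
theorem norm_chartMollify_sub_le {s : A.Spectrum} {b : ContDiffBump (0 : Space d)}
    {g : Space d → ℂ} (hg : Continuous g) {X : Space d} {η : ℝ}
    (h1 : ∫ Z, b.normed volume (chart Jt s X - chart Jt s Z) = 1)
    (hη : ∀ Z, ‖chart Jt s X - chart Jt s Z‖ ≤ b.rOut → ‖g Z - g X‖ ≤ η) :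
    ‖chartMollify Jt s b g X - g X‖ ≤ η := by
  have hint : Integrable fun Z => b.normed volume (chart Jt s X - chart Jt s Z) :=
    integrable_of_integral_eq_one h1
  have hintc : Integrable fun Z => bump b (chart Jt s X - chart Jt s Z) := hint.ofReal
  have hbound : ∀ Z, ‖bump b (chart Jt s X - chart Jt s Z) * (g Z - g X)‖
      ≤ b.normed volume (chart Jt s X - chart Jt s Z) * η := by
    intro Z
    rw [norm_mul]
    by_cases hZ : ‖chart Jt s X - chart Jt s Z‖ ≤ b.rOut
    · rw [bump, Complex.norm_real, Real.norm_of_nonneg (b.nonneg_normed _)]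
      exact mul_le_mul_of_nonneg_left (hη Z hZ) (b.nonneg_normed _)
    · have h0 := bump_eq_zero b (not_le.1 hZ)
      rw [h0]
      have : b.normed volume (chart Jt s X - chart Jt s Z) = 0 := by
        simpa [bump] using h0
      simp [this]
  have hcont : Continuous fun Z => bump b (chart Jt s X - chart Jt s Z) :=
    (contDiff_bump b).continuous.comp (continuous_const.sub (H.contDiff_chart s).continuous)
  have hint2 : Integrable fun Z => bump b (chart Jt s X - chart Jt s Z) * (g Z - g X) :=
    (hint.mul_const η).mono' (hcont.mul (hg.sub continuous_const)).aestronglyMeasurable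
      (ae_of_all _ hbound)
  have hone : ∫ Z, bump b (chart Jt s X - chart Jt s Z) * g X = g X := by
    rw [integral_mul_const]
    have : ∫ Z, bump b (chart Jt s X - chart Jt s Z) = 1 := by
      unfold bump
      rw [integral_complex_ofReal, h1, Complex.ofReal_one]
    rw [this, one_mul]
  have hsplit : chartMollify Jt s b g X - g X
      = ∫ Z, bump b (chart Jt s X - chart Jt s Z) * (g Z - g X) := by
    have : chartMollify Jt s b g X = ∫ Z, (bump b (chart Jt s X - chart Jt s Z) * (g Z - g X)
        + bump b (chart Jt s X - chart Jt s Z) * g X) :=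
      integral_congr_ae (ae_of_all _ fun Z => by ring)
    rw [this, integral_add hint2 (hintc.mul_const _), hone, add_sub_cancel_right]
  rw [hsplit]
  calc _ ≤ ∫ Z, b.normed volume (chart Jt s X - chart Jt s Z) * η :=
        norm_integral_le_of_norm_le (hint.mul_const η) (ae_of_all _ hbound)
    _ = η := by rw [integral_mul_const, h1, one_mul]

/-- Mollification in a chart converges to the identity, tested against locally integrable
functions. -/
theorem tendsto_integral_chartMollify (s : A.Spectrum) {b : ℕ → ContDiffBump (0 : Space d)}
    (hb : Tendsto (fun m => (b m).rOut) atTop (𝓝 0)) {g h : Space d → ℂ} (hg : Continuous g)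
    {R : ℝ} (hR : ∀ x, R < ‖x‖ → g x = 0) (hh : LocallyIntegrable h)
    (hmeas : ∀ m, Integrable fun X => h X * chartMollify Jt s (b m) g X) :
    Tendsto (fun m => ∫ X, h X * chartMollify Jt s (b m) g X) atTop (𝓝 (∫ X, h X * g X)) := by
  -- Mollification may enlarge the support of g. Once the kernels have radius below 1/C, the ball of
  -- radius R + 1 contains everything.
  obtain ⟨C, hC, δ, hδ, hsep⟩ := H.exists_chart_separation (R + 1)
  obtain ⟨δ', hδ', hone⟩ := H.exists_integral_bump_chart (R + 1)
  have hgc := hasCompactSupport_of_norm hR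
  let B : Set (Space d) := Metric.closedBall 0 (R + 1)
  have hB : IsCompact B := isCompact_closedBall 0 _
  have hhB : IntegrableOn h B := hh.integrableOn_isCompact hB
  have hhg : Integrable fun X => h X * g X := locallyIntegrable_mul_of_hasCompactSupport hh hg hgc
  rw [Metric.tendsto_atTop]
  intro κ hκ
  have hI : 0 ≤ ∫ X in B, ‖h X‖ := by positivity
  let η := κ / 2 / ((∫ X in B, ‖h X‖) + 1)
  have hη : 0 < η := by positivity
  obtain ⟨r, hr, hgr⟩ := Metric.uniformContinuous_iff.1
    (hgc.uniformContinuous_of_continuous hg) η hη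
  have hsmall : ∀ᶠ m in atTop, (b m).rOut < min (min δ δ') (min (r / C) (1 / C)) :=
    hb.eventually (gt_mem_nhds (by positivity))
  obtain ⟨N, hN⟩ := eventually_atTop.1 hsmall
  refine ⟨N, fun m hm => ?_⟩
  have h1 := (hN m hm).trans_le ((min_le_left _ _).trans (min_le_left _ _))
  have h2 := (hN m hm).trans_le ((min_le_left _ _).trans (min_le_right _ _))
  have h3 := (hN m hm).trans_le ((min_le_right _ _).trans (min_le_left _ _))
  have h4 := (hN m hm).trans_le ((min_le_right _ _).trans (min_le_right _ _))
  rw [lt_div_iff₀ hC] at h3 h4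
  have hin : ∀ X ∈ B, ‖chartMollify Jt s (b m) g X - g X‖ ≤ η := by
    intro X hX
    have hX' : ‖X‖ ≤ R + 1 := by simpa [B] using hX
    refine H.norm_chartMollify_sub_le hg (hone (b m) h2 X hX' s) fun Z hZ => ?_
    rw [← dist_eq_norm]
    refine (hgr ?_).le
    rw [dist_comm, dist_eq_norm]
    refine (hsep X hX' Z s (hZ.trans_lt h1)).trans_lt ?_
    have := mul_le_mul_of_nonneg_left hZ hC.le
    linarith
  have hout : ∀ X, X ∉ B → chartMollify Jt s (b m) g X - g X = 0 := by
    intro X hX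
    have hX' : R + 1 < ‖X‖ := by simpa [B] using hX
    rw [hR X (by linarith), sub_zero, chartMollify]
    refine integral_eq_zero_of_ae (ae_of_all _ fun Z => ?_)
    by_cases hZ : R < ‖Z‖
    · simp [hR Z hZ]
    · change bump (b m) (chart Jt s X - chart Jt s Z) * g Z = 0
      rw [bump_eq_zero, zero_mul]
      refine lt_of_not_ge fun hle => ?_
      rw [norm_sub_rev] at hle
      have h5 := hsep Z (by linarith) X s (hle.trans_lt h1)
      have h6 := mul_le_mul_of_nonneg_left hle hC.le
      have h7 := norm_sub_norm_le X Z
      rw [norm_sub_rev] at h7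
      linarith [not_lt.1 hZ]
  rw [dist_eq_norm, ← integral_sub (hmeas m) hhg]
  have hrest : ∫ X, (h X * chartMollify Jt s (b m) g X - h X * g X)
      = ∫ X in B, (h X * chartMollify Jt s (b m) g X - h X * g X) := by
    refine (setIntegral_eq_integral_of_forall_compl_eq_zero fun X hX => ?_).symm
    rw [← mul_sub, hout X hX, mul_zero]
  rw [hrest]
  calc _ ≤ ∫ X in B, ‖h X‖ * η := by
        refine norm_integral_le_of_norm_le (hhB.norm.mul_const _)
          ((ae_restrict_iff' hB.measurableSet).2 (ae_of_all _ fun X hX => ?_))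
        rw [← mul_sub, norm_mul]
        gcongr
        exact hin X hX
    _ = (∫ X in B, ‖h X‖) * η := integral_mul_const _ _
    _ ≤ ((∫ X in B, ‖h X‖) + 1) * η := by gcongr; linarith
    _ = κ / 2 := by simp only [η]; field_simp
    _ < κ := by linarith

/-- The kernel confines X to a ball when Z is in the support of g, so local integrability of h is
enough. -/
theorem integrable_kernel (s : A.Spectrum) {f g h : Space d → ℂ} {R : ℝ} {δ : ℝ}
    (hf : Continuous f) (hfδ : ∀ w, δ < ‖w‖ → f w = 0) (hg : Continuous g)
    (hR : ∀ x, R < ‖x‖ → g x = 0) (hh : LocallyIntegrable h) {R' : ℝ}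
    (hsupp : ∀ X Z, ‖Z‖ ≤ R → ‖chart Jt s X - chart Jt s Z‖ ≤ δ → ‖X‖ ≤ R') :
    Integrable (fun p : Space d × Space d =>
      h p.1 * (f (chart Jt s p.1 - chart Jt s p.2) * g p.2)) (volume.prod volume) := by
  let B : Set (Space d) := Metric.closedBall 0 R'
  have hhB : Integrable (B.indicator h) :=
    (integrable_indicator_iff measurableSet_closedBall).2
      (hh.integrableOn_isCompact (isCompact_closedBall 0 R'))
  have hgi : Integrable g := hg.integrable_of_hasCompactSupport (hasCompactSupport_of_norm hR)
  obtain ⟨M, hM⟩ := (hasCompactSupport_of_norm hfδ).exists_bound_of_continuous hf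
  have hW := (H.contDiff_chart s).continuous
  have h1 := (hhB.mul_prod hgi).mul_bdd (g := fun p : Space d × Space d =>
    f (chart Jt s p.1 - chart Jt s p.2)) (c := M)
    (hf.comp (by fun_prop)).aestronglyMeasurable (ae_of_all _ fun p => hM _)
  refine h1.congr (ae_of_all _ fun p => ?_)
  simp only
  by_cases hp : p.1 ∈ B
  · rw [indicator_of_mem hp]; ring
  · rw [indicator_of_notMem hp, zero_mul, zero_mul]
    by_cases hZ : R < ‖p.2‖
    · simp [hR _ hZ]
    · rw [hfδ, zero_mul, mul_zero]
      refine lt_of_not_ge fun hle => hp ?_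
      simpa [B] using hsupp p.1 p.2 (not_lt.1 hZ) hle

/-- A function whose derivatives along the columns of the Jacobian matrix of the flow are
functions has a weak gradient. -/
theorem hasWeakGradient_of_chart (s : A.Spectrum) {U : Space d → ℂ} {v : Fin d → Space d → ℂ}
    (hU : LocallyIntegrable U) (hv : ∀ i, LocallyIntegrable (v i))
    (hD : ∀ φ : Space d → ℂ, ContDiff ℝ 1 φ → HasCompactSupport φ → ∀ i,
      ∫ x, firstOrder (v i) (fun j x => U x * s (Jt j i x)) φ x = 0) :
    HasWeakGradient U fun k x => ∑ i, v i x * s (invJac Jt i k x) := by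
  have hBc : ∀ i k, Continuous fun x => s (invJac Jt i k x) := fun i k =>
    (map_continuous (CharacterSpace.toCLM s)).comp (continuous_invJac H.cont i k)
  have hW := (H.contDiff_chart s).continuous
  refine ⟨hU, fun k => ?_, fun φ hφ hc k => ?_⟩
  · refine locallyIntegrable_finsetSum _ fun i _ => ?_
    exact locallyIntegrableOn_univ.1 (((hv i).locallyIntegrableOn univ).mul_continuousOn
      (hBc i k).continuousOn isClosed_univ.isLocallyClosed)
  · have hφ1 : ContDiff ℝ 1 φ := hφ.of_le (by simp)
    obtain ⟨R, hR⟩ := exists_norm_bound_of_hasCompactSupport hc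
    obtain ⟨C, hC, δ, hδ, hsep⟩ := H.exists_chart_separation R
    -- The first bound keeps the kernels strictly within the range of the separation estimate, the
    -- second keeps X within distance 1 of the support of φ.
    let c : ℝ := min (δ / 2) (1 / C)
    have hc0 : 0 < c := by positivity
    obtain ⟨b, hbr, hb⟩ := exists_bump_sequence d hc0
    have hsupp : ∀ m X Z, ‖Z‖ ≤ R → ‖chart Jt s X - chart Jt s Z‖ ≤ (b m).rOut → ‖X‖ ≤ R + 1 := by
      intro m X Z hZ hXZ
      have h1 : ‖chart Jt s Z - chart Jt s X‖ ≤ c := by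
        rw [norm_sub_rev]; exact hXZ.trans (hbr m)
      have h2 := hsep Z hZ X s (h1.trans_lt ((min_le_left _ _).trans_lt (half_lt_self hδ)))
      have h3 := mul_le_mul_of_nonneg_left (h1.trans (min_le_right _ _)) hC.le
      rw [mul_one_div_cancel hC.ne'] at h3
      have h4 := norm_sub_norm_le X Z
      rw [norm_sub_rev] at h4
      linarith
    -- These weights are what the chain rule produces when the Z_k-derivative of b(W_s(X) - W_s(Z))
    -- meets φ. They are only continuous and are never differentiated.
    let g : Fin d → Space d → ℂ := fun i Z => s (invJac Jt i k Z) * φ Z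
    let gk : Space d → ℂ := fun Z => fderiv ℝ φ Z (basisVec k)
    have hg : ∀ i, Continuous (g i) := fun i => (hBc i k).mul hφ.continuous
    have hgk : Continuous gk := (hφ1.continuous_fderiv one_ne_zero).clm_apply continuous_const
    have hgR : ∀ i x, R < ‖x‖ → g i x = 0 := fun i x hx => by simp [g, hR x hx]
    have hgkR : ∀ x, R < ‖x‖ → gk x = 0 := fun x hx => by simp [gk, fderiv_eq_zero_of_norm hR hx]
    have hbump : ∀ m, ContDiff ℝ 1 (bump (b m)) := fun m => (contDiff_bump (b m)).of_le (by simp)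
    have hdb : ∀ m i, Continuous fun w => fderiv ℝ (bump (b m)) w (basisVec i) := fun m i =>
      ((hbump m).continuous_fderiv one_ne_zero).clm_apply continuous_const
    have hdb0 : ∀ m i w, (b m).rOut < ‖w‖ → fderiv ℝ (bump (b m)) w (basisVec i) = 0 :=
      fun m i w hw => by rw [fderiv_bump_eq_zero (b m) hw]; rfl
    have hiv : ∀ m i, Integrable (fun p : Space d × Space d =>
        v i p.1 * (bump (b m) (chart Jt s p.1 - chart Jt s p.2) * g i p.2))
        (volume.prod volume) := fun m i =>
      H.integrable_kernel s (f := bump (b m)) (hbump m).continuous (fun w hw => bump_eq_zero (b m) hw) (hg i)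
        (hgR i) (hv i) (hsupp m)
    have hiU : ∀ m i, Integrable (fun p : Space d × Space d =>
        U p.1 * (fderiv ℝ (bump (b m)) (chart Jt s p.1 - chart Jt s p.2) (basisVec i) * g i p.2))
        (volume.prod volume) := fun m i =>
      H.integrable_kernel s (f := fun w => fderiv ℝ (bump (b m)) w (basisVec i)) (hdb m i) (hdb0 m i) (hg i) (hgR i) hU (hsupp m)
    have hik : ∀ m, Integrable (fun p : Space d × Space d =>
        U p.1 * (bump (b m) (chart Jt s p.1 - chart Jt s p.2) * gk p.2))
        (volume.prod volume) := fun m =>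
      H.integrable_kernel s (f := bump (b m)) (hbump m).continuous (fun w hw => bump_eq_zero (b m) hw) hgk
        hgkR hU (hsupp m)
    have hmv : ∀ m i, Integrable fun X => v i X * chartMollify Jt s (b m) (g i) X := fun m i => by
      have := (hiv m i).integral_prod_left
      simp_rw [integral_const_mul] at this
      exact this
    have hmU : ∀ m, Integrable fun X => U X * chartMollify Jt s (b m) gk X := fun m => by
      have := (hik m).integral_prod_left
      simp_rw [integral_const_mul] at this
      exact this
    -- Integrating by parts in Z moves the derivative from φ to the kernel; the two minus signs
    -- cancel.
    have hparts : ∀ m X, chartMollify Jt s (b m) gk X = ∑ i, ∫ Z,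
        fderiv ℝ (bump (b m)) (chart Jt s X - chart Jt s Z) (basisVec i) * g i Z := by
      intro m X
      have hχ : ContDiff ℝ 1 fun Z => bump (b m) (chart Jt s X - chart Jt s Z) :=
        (hbump m).comp (contDiff_const.sub (H.contDiff_chart s))
      have hχd : Continuous fun Z =>
          fderiv ℝ (fun Z => bump (b m) (chart Jt s X - chart Jt s Z)) Z (basisVec k) :=
        (hχ.continuous_fderiv one_ne_zero).clm_apply continuous_const
      have h1 := integral_mul_fderiv_eq_neg_fderiv_mul_of_integrable (μ := volume)
        (f := fun Z => bump (b m) (chart Jt s X - chart Jt s Z)) (g := φ) (v := basisVec k)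
        ((hχd.mul hφ.continuous).integrable_of_hasCompactSupport hc.mul_left)
        ((hχ.continuous.mul hgk).integrable_of_hasCompactSupport
          (hasCompactSupport_of_norm hgkR).mul_left)
        ((hχ.continuous.mul hφ.continuous).integrable_of_hasCompactSupport hc.mul_left)
        (fun x _ => hχ.differentiable one_ne_zero x) fun x _ => hφ1.differentiable one_ne_zero x
      rw [chartMollify]
      refine h1.trans ?_
      rw [← integral_neg, ← integral_finsetSum]
      · refine integral_congr_ae (ae_of_all _ fun Z => ?_)
        simp only [H.fderiv_comp_sub_chart s (hbump m), g]
        rw [neg_mul, neg_neg, Finset.sum_mul]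
        exact Finset.sum_congr rfl fun i _ => mul_assoc _ _ _
      · intro i _
        exact (((hdb m i).comp (continuous_const.sub hW)).mul
          (hg i)).integrable_of_hasCompactSupport (hasCompactSupport_of_norm (hgR i)).mul_left
    -- For fixed Z the kernel is a C¹ test function of X. Its derivative along column i of J is the
    -- i-th partial derivative of the bump, because J⁻¹J is the identity.
    have htest : ∀ m i Z, ∫ X, (v i X * (bump (b m) (chart Jt s X - chart Jt s Z) * g i Z)
        + U X * (fderiv ℝ (bump (b m)) (chart Jt s X - chart Jt s Z) (basisVec i) * g i Z))
        = 0 := by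
      intro m i Z
      by_cases hZ : R < ‖Z‖
      · simp [hgR i Z hZ]
      · have h1 := hD (fun X => bump (b m) (chart Jt s X - chart Jt s Z))
          ((hbump m).comp ((H.contDiff_chart s).sub contDiff_const))
          (hasCompactSupport_of_norm (R := R + 1) fun X hX => bump_eq_zero _
            (lt_of_not_ge fun hle => hX.not_ge (hsupp m X Z (not_lt.1 hZ) hle))) i
        have h2 : ∀ X, firstOrder (v i) (fun j x => U x * s (Jt j i x))
            (fun X => bump (b m) (chart Jt s X - chart Jt s Z)) X
            = v i X * bump (b m) (chart Jt s X - chart Jt s Z)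
              + U X * fderiv ℝ (bump (b m)) (chart Jt s X - chart Jt s Z) (basisVec i) := by
          intro X
          rw [firstOrder]
          congr 1
          simp_rw [H.fderiv_comp_chart_sub s (hbump m), Finset.mul_sum]
          rw [Finset.sum_comm]
          have h3 : ∀ l, ∑ j, U X * s (Jt j i X) * (fderiv ℝ (bump (b m))
              (chart Jt s X - chart Jt s Z) (basisVec l) * s (invJac Jt l j X))
              = U X * fderiv ℝ (bump (b m)) (chart Jt s X - chart Jt s Z) (basisVec l)
                * if l = i then 1 else 0 := by
            intro l
            rw [← H.sum_char_invJac_mul s X l i, Finset.mul_sum]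
            exact Finset.sum_congr rfl fun j _ => by ring
          simp_rw [h3]
          simp
        simp_rw [h2] at h1
        rw [← zero_mul (g i Z), ← h1, ← integral_mul_const]
        exact integral_congr_ae (ae_of_all _ fun X => by ring)
    -- Integrate the tested identity over Z, exchange the integrals and insert the integration by
    -- parts. This is the desired formula at mollification level m.
    have hkey : ∀ m, ∑ i, ∫ X, v i X * chartMollify Jt s (b m) (g i) X
        = -∫ X, U X * chartMollify Jt s (b m) gk X := by
      intro m
      have h1 : ∀ i, ∫ X, v i X * chartMollify Jt s (b m) (g i) X
          = -∫ X, U X * ∫ Z,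
            fderiv ℝ (bump (b m)) (chart Jt s X - chart Jt s Z) (basisVec i) * g i Z := by
        intro i
        have h2 : ∫ Z, ∫ X, (v i X * (bump (b m) (chart Jt s X - chart Jt s Z) * g i Z)
            + U X * (fderiv ℝ (bump (b m)) (chart Jt s X - chart Jt s Z) (basisVec i) * g i Z))
            = 0 := by simp_rw [htest]; simp
        rw [← integral_integral_swap ((hiv m i).add (hiU m i)),
          integral_integral ((hiv m i).add (hiU m i))] at h2
        rw [integral_add (hiv m i) (hiU m i), integral_prod _ (hiv m i),
          integral_prod _ (hiU m i)] at h2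
        simp_rw [integral_const_mul] at h2
        exact eq_neg_of_add_eq_zero_left h2
      simp_rw [h1, Finset.sum_neg_distrib, hparts, Finset.mul_sum]
      rw [integral_finsetSum]
      intro i _
      have := (hiU m i).integral_prod_left
      simp_rw [integral_const_mul] at this
      exact this
    have hlim1 := tendsto_finsetSum Finset.univ fun i (_ : i ∈ Finset.univ) =>
      H.tendsto_integral_chartMollify s hb (hg i) (hgR i) (hv i) fun m => hmv m i
    have hlim2 := (H.tendsto_integral_chartMollify s hb hgk hgkR hU hmU).neg
    have hfin := tendsto_nhds_unique (hlim1.congr hkey) hlim2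
    rw [← integral_finsetSum] at hfin
    · rw [eq_neg_iff_add_eq_zero, ← neg_eq_iff_add_eq_zero, ← hfin]
      refine integral_congr_ae (ae_of_all _ fun x => ?_)
      simp only [g, Finset.sum_mul]
      exact Finset.sum_congr rfl fun i _ => by ring
    · intro i _
      exact locallyIntegrable_mul_of_hasCompactSupport (hv i) (hg i)
        (hasCompactSupport_of_norm (hgR i))

end IsFlowJacobian

end ChartGradient

theorem MeanValueAlgebra.norm_char_le (A : MeanValueAlgebra) (s : A.Spectrum) (a : A.Elem) :
    ‖s a‖ ≤ ‖a‖ := by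
  have hc : Continuous fun s : A.Spectrum => ‖s a‖ :=
    (A.continuous_char_apply (X := Unit) (F := fun _ => a) continuous_const).norm.comp
      (by fun_prop : Continuous fun s : A.Spectrum => (s, ()))
  exact A.denseRange_evalChar.induction_on (p := fun s : A.Spectrum => ‖s a‖ ≤ ‖a‖) s
    (isClosed_le hc continuous_const) fun τ => BoundedContinuousFunction.norm_coe_le_norm a.1 τ

/-! ### Oscillating test functions and bounds uniform in the scale -/

section Oscillating

variable {d : ℕ} {T : ℝ} {A : MeanValueAlgebra} {Φ : ℝ → Space d → Space d}

/-- Evaluation at `τ` as a real linear map. -/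
noncomputable def evalCLM (A : MeanValueAlgebra) (τ : ℝ) : A.Elem →L[ℝ] ℂ :=
  ((BoundedContinuousFunction.evalCLM ℂ τ).restrictScalars ℝ).comp
    ((A.carrier.toSubalgebra.toSubmodule.subtypeL).restrictScalars ℝ)

theorem evalCLM_apply (τ : ℝ) (a : A.Elem) : evalCLM A τ a = a.1 τ := rfl

/-- The oscillating function `g(t) e_k(x/ε) F(Φ_{-t/ε}(x))(t/ε)`. -/
noncomputable def osc (Φ : ℝ → Space d → Space d) (ε : ℝ) (g : ℝ → ℂ) (k : Fin d → ℤ)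
    (F : Space d → A.Elem) (p : ℝ × Space d) : ℂ :=
  g p.1 * expo k (ε⁻¹ • p.2) * (F (Φ (-(p.1 / ε)) p.2)).1 (p.1 / ε)

theorem continuous_flow (hΦ : IsAdmissibleFlow Φ) (ε : ℝ) :
    Continuous fun p : ℝ × Space d => Φ (-(p.1 / ε)) p.2 :=
  hΦ.contDiff.continuous.comp
    (by fun_prop : Continuous fun p : ℝ × Space d => (-(p.1 / ε), p.2))

theorem continuous_osc (hΦ : IsAdmissibleFlow Φ) (ε : ℝ) {g : ℝ → ℂ} (hg : Continuous g)
    (k : Fin d → ℤ) {F : Space d → A.Elem} (hF : Continuous F) : Continuous (osc Φ ε g k F) := by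
  have h1 : Continuous fun p : ℝ × Space d => (F (Φ (-(p.1 / ε)) p.2)).1 :=
    continuous_subtype_val.comp (hF.comp (continuous_flow hΦ ε))
  have h2 : Continuous fun p : ℝ × Space d => (F (Φ (-(p.1 / ε)) p.2)).1 (p.1 / ε) :=
    h1.eval (by fun_prop)
  exact ((hg.comp continuous_fst).mul ((continuous_expo k).comp (by fun_prop))).mul h2

/-- The map `(t, x) ↦ (t, Φ_{-t/ε}(x))` preserves the measure. -/
theorem measurePreserving_flow (hΦ : IsAdmissibleFlow Φ) (ε : ℝ) :
    MeasurePreserving (fun p : ℝ × Space d => (p.1, Φ (-(p.1 / ε)) p.2)) (measTX d T)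
      (measTX d T) := by
  refine (MeasurePreserving.id _).skew_product
    (g := fun t x => Φ (-(t / ε)) x) ?_ (ae_of_all _ fun t => ?_)
  · exact (continuous_flow hΦ ε).measurable
  · exact (hΦ.measurePreserving_apply _).map_eq

/-- The points which the flow brings into a ball. -/
def flowBall (Φ : ℝ → Space d → Space d) (ε R : ℝ) : Set (ℝ × Space d) :=
  {p | ‖Φ (-(p.1 / ε)) p.2‖ ≤ R}

/-- The measure of `(0,T) × B_R`. -/
noncomputable def ballMass (d : ℕ) (T R : ℝ) : ENNReal :=
  measTX d T (univ ×ˢ Metric.closedBall 0 R)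

theorem ballMass_ne_top (d : ℕ) (T R : ℝ) : ballMass d T R ≠ ⊤ := by
  rw [ballMass, measTX, Measure.prod_prod]
  exact ENNReal.mul_ne_top (by simp) (ProperSpace.isCompact_closedBall _ _).measure_ne_top

/-- The supports of the oscillating functions move with ε, but their containing sets have constant
measure, so Cauchy–Schwarz bounds do not depend on ε. -/
theorem measure_flowBall (hΦ : IsAdmissibleFlow Φ) (ε R : ℝ) :
    measTX d T (flowBall Φ ε R) = ballMass d T R := by
  rw [ballMass, ← (measurePreserving_flow hΦ ε).measure_preimage
    (MeasurableSet.univ.prod measurableSet_closedBall).nullMeasurableSet]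
  congr 1
  ext p
  simp [flowBall]

theorem setIntegral_norm_le_of_memLp_two {α : Type*} [MeasurableSpace α] {μ : Measure α}
    {u : α → ℂ} (hu : MemLp u 2 μ) {S : Set α} (hS : μ S ≠ ⊤) :
    IntegrableOn u S μ ∧
      ∫ a in S, ‖u a‖ ∂μ ≤ (eLpNorm u 2 μ * μ S ^ (1 / 2 : ℝ)).toReal := by
  have : IsFiniteMeasure (μ.restrict S) := ⟨by simpa using hS.lt_top⟩
  have h2 : MemLp u 2 (μ.restrict S) := hu.restrict S
  have h1 : Integrable u (μ.restrict S) := h2.integrable (by norm_num)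
  refine ⟨h1, ?_⟩
  rw [integral_norm_eq_lintegral_enorm h1.aestronglyMeasurable, ← eLpNorm_one_eq_lintegral_enorm]
  refine ENNReal.toReal_mono ?_ ?_
  · exact ENNReal.mul_ne_top hu.eLpNorm_ne_top (ENNReal.rpow_ne_top_of_nonneg (by norm_num) hS)
  · refine (eLpNorm_le_eLpNorm_mul_rpow_measure_univ (p := 1) (q := 2) (by norm_num)
      h1.aestronglyMeasurable).trans ?_
    have h3 : 1 / ENNReal.toReal 1 - 1 / ENNReal.toReal 2 = (1 / 2 : ℝ) := by norm_num
    rw [Measure.restrict_apply_univ, h3]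
    gcongr
    exact Measure.restrict_le_self

theorem norm_osc_le {ε G M : ℝ} {g : ℝ → ℂ} (hG : ∀ t, ‖g t‖ ≤ G) (k : Fin d → ℤ)
    {F : Space d → A.Elem} (hM : ∀ X, ‖F X‖ ≤ M) (p : ℝ × Space d) :
    ‖osc Φ ε g k F p‖ ≤ G * M := by
  rw [osc, norm_mul, norm_mul, norm_expo, mul_one]
  have h1 : ‖(F (Φ (-(p.1 / ε)) p.2)).1 (p.1 / ε)‖ ≤ M :=
    (BoundedContinuousFunction.norm_coe_le_norm _ _).trans (hM _)
  have h0 : 0 ≤ G := (norm_nonneg _).trans (hG 0)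
  gcongr
  exact hG _

theorem osc_eq_zero {ε : ℝ} {g : ℝ → ℂ} {k : Fin d → ℤ} {F : Space d → A.Elem} {R : ℝ}
    (hR : ∀ X, R < ‖X‖ → F X = 0) {p : ℝ × Space d} (hp : p ∉ flowBall Φ ε R) :
    osc Φ ε g k F p = 0 := by
  rw [osc, hR _ (not_le.1 hp)]
  simp

theorem integrable_mul_osc (hΦ : IsAdmissibleFlow Φ) {ε G M R : ℝ} {g : ℝ → ℂ} (hg : Continuous g)
    (hG : ∀ t, ‖g t‖ ≤ G) (k : Fin d → ℤ) {F : Space d → A.Elem} (hF : Continuous F)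
    (hM : ∀ X, ‖F X‖ ≤ M) (hR : ∀ X, R < ‖X‖ → F X = 0) {u : ℝ × Space d → ℂ}
    (hu : MemLp u 2 (measTX d T)) :
    Integrable (fun p => u p * osc Φ ε g k F p) (measTX d T) := by
  have h1 := (setIntegral_norm_le_of_memLp_two hu (S := flowBall Φ ε R)
    (by rw [measure_flowBall hΦ]; exact ballMass_ne_top d T R)).1
  have h2 : IntegrableOn (fun p => u p * osc Φ ε g k F p) (flowBall Φ ε R) (measTX d T) :=
    h1.mul_bdd (continuous_osc hΦ ε hg k hF).aestronglyMeasurable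
      (ae_of_all _ (norm_osc_le hG k hM))
  refine (integrableOn_iff_integrable_of_support_subset fun p hp => ?_).1 h2
  by_contra hp'
  exact hp (by simp [osc_eq_zero hR hp'])

theorem norm_integral_mul_osc_le (hΦ : IsAdmissibleFlow Φ) {ε G M R : ℝ} {g : ℝ → ℂ}
    (hG : ∀ t, ‖g t‖ ≤ G) (k : Fin d → ℤ) {F : Space d → A.Elem}
    (hM : ∀ X, ‖F X‖ ≤ M) (hR : ∀ X, R < ‖X‖ → F X = 0) {u : ℝ × Space d → ℂ}
    (hu : MemLp u 2 (measTX d T)) :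
    ‖∫ p, u p * osc Φ ε g k F p ∂(measTX d T)‖
      ≤ (eLpNorm u 2 (measTX d T) * ballMass d T R ^ (1 / 2 : ℝ)).toReal * (G * M) := by
  have hS : measTX d T (flowBall Φ ε R) ≠ ⊤ := by
    rw [measure_flowBall hΦ]; exact ballMass_ne_top d T R
  obtain ⟨h1, h2⟩ := setIntegral_norm_le_of_memLp_two hu hS
  rw [measure_flowBall hΦ] at h2
  have h0 : 0 ≤ G * M :=
    mul_nonneg ((norm_nonneg _).trans (hG 0)) ((norm_nonneg _).trans (hM 0))
  rw [← setIntegral_eq_integral_of_forall_compl_eq_zero (s := flowBall Φ ε R) fun p hp => by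
    rw [osc_eq_zero hR hp, mul_zero]]
  calc _ ≤ ∫ p in flowBall Φ ε R, ‖u p‖ * (G * M) ∂(measTX d T) := by
        refine norm_integral_le_of_norm_le (h1.norm.mul_const _) (ae_of_all _ fun p => ?_)
        rw [norm_mul]
        gcongr
        exact norm_osc_le hG k hM p
    _ = (∫ p in flowBall Φ ε R, ‖u p‖ ∂(measTX d T)) * (G * M) := integral_mul_const _ _
    _ ≤ _ := by gcongr

end Oscillating

/-! ### Convergence against oscillating test functions -/

section OscillatingLimit

variable {d : ℕ} {T : ℝ} {A : MeanValueAlgebra} {Φ : ℝ → Space d → Space d}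

/-- The limit test function `g(t) e_k(y) s(F(X))`. -/
noncomputable def limTest (g : ℝ → ℂ) (k : Fin d → ℤ) (F : Space d → A.Elem)
    (q : ℝ × Space d × A.Spectrum × Space d) : ℂ :=
  g q.1 * expo k q.2.2.2 * q.2.2.1 (F q.2.1)

/-- A Carathéodory argument: continuity in X and measurability in s. Joint continuity would only
give Borel measurability for the product topology, whose σ-algebra can exceed the product σ-algebra.
-/
theorem measurable_char_apply {X : Type*} [TopologicalSpace X] [TopologicalSpace.MetrizableSpace X]
    [SecondCountableTopology X] [MeasurableSpace X] [OpensMeasurableSpace X] {F : X → A.Elem}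
    (hF : Continuous F) : Measurable fun p : X × A.Spectrum => p.2 (F p.1) := by
  refine measurable_uncurry_of_continuous_of_measurable (u := fun (x : X) (s : A.Spectrum) => s (F x))
    (fun s => ?_) fun x => ?_
  · exact (map_continuous (CharacterSpace.toCLM s)).comp hF
  · exact (gelfandTransform ℂ A.Elem (F x)).continuous.measurable

theorem measurable_limTest {g : ℝ → ℂ} (hg : Continuous g) (k : Fin d → ℤ) {F : Space d → A.Elem}
    (hF : Continuous F) : Measurable (limTest (A := A) g k F) := by
  unfold limTest
  have h1 := (measurable_char_apply hF).comp (g := fun p : Space d × A.Spectrum => p.2 (F p.1))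
    (f := fun q : ℝ × Space d × A.Spectrum × Space d => (q.2.1, q.2.2.1)) (by fun_prop)
  exact ((hg.measurable.comp measurable_fst).mul ((continuous_expo k).measurable.comp
    (by fun_prop))).mul h1

theorem norm_limTest_le {G M : ℝ} {g : ℝ → ℂ} (hG : ∀ t, ‖g t‖ ≤ G) (k : Fin d → ℤ)
    {F : Space d → A.Elem} (hM : ∀ X, ‖F X‖ ≤ M) (q : ℝ × Space d × A.Spectrum × Space d) :
    ‖limTest g k F q‖ ≤ G * M := by
  rw [limTest, norm_mul, norm_mul, norm_expo, mul_one]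
  have h1 : ‖q.2.2.1 (F q.2.1)‖ ≤ M := (A.norm_char_le _ _).trans (hM _)
  have h0 : 0 ≤ G := (norm_nonneg _).trans (hG 0)
  gcongr
  exact hG _

/-- The points with `‖X‖ ≤ R`. -/
def limBall (A : MeanValueAlgebra) (d : ℕ) (R : ℝ) : Set (ℝ × Space d × A.Spectrum × Space d) :=
  {q | ‖q.2.1‖ ≤ R}

theorem measure_limBall (R : ℝ) : measTXSY A d T (limBall A d R) = ballMass d T R := by
  have : limBall A d R = univ ×ˢ (Metric.closedBall 0 R ×ˢ (univ ×ˢ univ)) := by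
    ext q; simp [limBall]
  rw [this, measTXSY, Measure.prod_prod, Measure.prod_prod, Measure.prod_prod, ballMass, measTX,
    Measure.prod_prod]
  simp

theorem limTest_eq_zero {g : ℝ → ℂ} {k : Fin d → ℤ} {F : Space d → A.Elem} {R : ℝ}
    (hR : ∀ X, R < ‖X‖ → F X = 0) {q : ℝ × Space d × A.Spectrum × Space d}
    (hq : q ∉ limBall A d R) : limTest g k F q = 0 := by
  rw [limTest, hR _ (not_le.1 hq), map_zero, mul_zero]

theorem integrable_mul_limTest {G M R : ℝ} {g : ℝ → ℂ} (hg : Continuous g)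
    (hG : ∀ t, ‖g t‖ ≤ G) (k : Fin d → ℤ) {F : Space d → A.Elem} (hF : Continuous F)
    (hM : ∀ X, ‖F X‖ ≤ M) (hR : ∀ X, R < ‖X‖ → F X = 0)
    {u : ℝ × Space d × A.Spectrum × Space d → ℂ} (hu : MemLp u 2 (measTXSY A d T)) :
    Integrable (fun q => u q * limTest g k F q) (measTXSY A d T) := by
  have h1 := (setIntegral_norm_le_of_memLp_two hu (S := limBall A d R)
    (by rw [measure_limBall]; exact ballMass_ne_top d T R)).1
  have h2 : IntegrableOn (fun q => u q * limTest g k F q) (limBall A d R) (measTXSY A d T) :=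
    h1.mul_bdd (measurable_limTest hg k hF).aestronglyMeasurable
      (ae_of_all _ (norm_limTest_le hG k hM))
  refine (integrableOn_iff_integrable_of_support_subset fun p hp => ?_).1 h2
  by_contra hp'
  exact hp (by simp [limTest_eq_zero hR hp'])

theorem norm_integral_mul_limTest_le {G M R : ℝ} {g : ℝ → ℂ}
    (hG : ∀ t, ‖g t‖ ≤ G) (k : Fin d → ℤ) {F : Space d → A.Elem}
    (hM : ∀ X, ‖F X‖ ≤ M) (hR : ∀ X, R < ‖X‖ → F X = 0)
    {u : ℝ × Space d × A.Spectrum × Space d → ℂ} (hu : MemLp u 2 (measTXSY A d T)) :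
    ‖∫ q, u q * limTest g k F q ∂(measTXSY A d T)‖
      ≤ (eLpNorm u 2 (measTXSY A d T) * ballMass d T R ^ (1 / 2 : ℝ)).toReal * (G * M) := by
  have hS : measTXSY A d T (limBall A d R) ≠ ⊤ := by
    rw [measure_limBall]; exact ballMass_ne_top d T R
  obtain ⟨h1, h2⟩ := setIntegral_norm_le_of_memLp_two hu hS
  rw [measure_limBall] at h2
  have h0 : 0 ≤ G * M :=
    mul_nonneg ((norm_nonneg _).trans (hG 0)) ((norm_nonneg _).trans (hM 0))
  rw [← setIntegral_eq_integral_of_forall_compl_eq_zero (s := limBall A d R) fun p hp => by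
    rw [limTest_eq_zero hR hp, mul_zero]]
  calc _ ≤ ∫ p in limBall A d R, ‖u p‖ * (G * M) ∂(measTXSY A d T) := by
        refine norm_integral_le_of_norm_le (h1.norm.mul_const _) (ae_of_all _ fun p => ?_)
        rw [norm_mul]
        gcongr
        exact norm_limTest_le hG k hM p
    _ = (∫ p in limBall A d R, ‖u p‖ ∂(measTXSY A d T)) * (G * M) := integral_mul_const _ _
    _ ≤ _ := by gcongr

theorem isTestFunction_prod {g : ℝ → ℂ} (hg : ContDiff ℝ ∞ g) (hgc : HasCompactSupport g)
    (hgT : tsupport g ⊆ Ioo 0 T) (k : Fin d → ℤ) {F : Space d → A.Elem} (hF : ContDiff ℝ ∞ F)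
    (hFc : HasCompactSupport F) :
    IsTestFunction A d T fun p : ℝ × Space d × Space d =>
      (g p.1 * expo k p.2.2) • F p.2.1 := by
  refine ⟨?_, fun t X y i => ?_, tsupport g ×ˢ tsupport F, hgc.isCompact.prod hFc.isCompact,
    prod_mono hgT (subset_univ _), fun t X y h => ?_⟩
  · exact ((hg.comp contDiff_fst).mul ((contDiff_expo k).comp
      (contDiff_snd.comp contDiff_snd))).smul (hF.comp (contDiff_fst.comp contDiff_snd))
  · simp only [isPeriodic_expo k y i]
  · rcases not_and_or.1 (fun h' => h (mk_mem_prod h'.1 h'.2)) with h' | h'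
    · simp [image_eq_zero_of_notMem_tsupport h']
    · simp [image_eq_zero_of_notMem_tsupport h']

theorem SigmaConverges.tendsto_osc {ε : ℕ → ℝ} {u : ℕ → ℝ × Space d → ℂ}
    {u₀ : ℝ × Space d × A.Spectrum × Space d → ℂ} (hu : SigmaConverges A d T Φ ε u u₀)
    {g : ℝ → ℂ} (hg : ContDiff ℝ ∞ g) (hgc : HasCompactSupport g)
    (hgT : tsupport g ⊆ Ioo 0 T) (k : Fin d → ℤ) {F : Space d → A.Elem} (hF : ContDiff ℝ ∞ F)
    (hFc : HasCompactSupport F) :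
    Tendsto (fun n => ∫ p, u n p * osc Φ (ε n) g k F p ∂(measTX d T)) atTop
      (𝓝 (∫ q, u₀ q * limTest g k F q ∂(measTXSY A d T))) := by
  have h := hu.2.2 _ (isTestFunction_prod hg hgc hgT k hF hFc)
  refine (h.congr fun n => ?_).trans_eq ?_
  · rfl
  · congr 1
    refine integral_congr_ae (ae_of_all _ fun q => ?_)
    simp only [limTest]
    rw [map_smul, smul_eq_mul]

/-- For a bounded sequence the oscillating test functions need only be continuous in space. -/
theorem SigmaConverges.tendsto_osc_of_continuous (hΦ : IsAdmissibleFlow Φ) {ε : ℕ → ℝ}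
    {u : ℕ → ℝ × Space d → ℂ}
    {u₀ : ℝ × Space d × A.Spectrum × Space d → ℂ} (hu : SigmaConverges A d T Φ ε u u₀)
    (hbdd : ∃ C : NNReal, ∀ n, eLpNorm (u n) 2 (measTX d T) ≤ C)
    {g : ℝ → ℂ} (hg : ContDiff ℝ ∞ g) (hgc : HasCompactSupport g)
    (hgT : tsupport g ⊆ Ioo 0 T) (k : Fin d → ℤ) {F : Space d → A.Elem} (hF : Continuous F)
    (hFc : HasCompactSupport F) :
    Tendsto (fun n => ∫ p, u n p * osc Φ (ε n) g k F p ∂(measTX d T)) atTop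
      (𝓝 (∫ q, u₀ q * limTest g k F q ∂(measTXSY A d T))) := by
  obtain ⟨C, hC⟩ := hbdd
  obtain ⟨G, hG⟩ := hgc.exists_bound_of_continuous hg.continuous
  obtain ⟨R, hR⟩ := exists_norm_bound_of_hasCompactSupport hFc
  obtain ⟨M, hM⟩ := hFc.exists_bound_of_continuous hF
  have hG0 : 0 ≤ G := (norm_nonneg _).trans (hG 0)
  let m := ballMass d T R ^ (1 / 2 : ℝ)
  have hm : m ≠ ⊤ := ENNReal.rpow_ne_top_of_nonneg (by norm_num) (ballMass_ne_top d T R)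
  let D₁ := (C * m).toReal * G
  let D₂ := (eLpNorm u₀ 2 (measTXSY A d T) * m).toReal * G
  have hD₁ : 0 ≤ D₁ := by positivity
  have hD₂ : 0 ≤ D₂ := by positivity
  rw [Metric.tendsto_atTop]
  intro κ hκ
  let η := κ / 3 / (D₁ + D₂ + 1)
  have hη : 0 < η := by positivity
  have hD₁η : D₁ * η ≤ κ / 3 := by
    simp only [η]
    rw [mul_div_left_comm]
    exact mul_le_of_le_one_right (by positivity) ((div_le_one (by positivity)).2 (by linarith))
  have hD₂η : D₂ * η ≤ κ / 3 := by
    simp only [η]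
    rw [mul_div_left_comm]
    exact mul_le_of_le_one_right (by positivity) ((div_le_one (by positivity)).2 (by linarith))
  -- The support of F' lies in that of F, so the same ball controls both. The error is then at most
  -- η times a constant independent of n, by the bound on the sequence.
  obtain ⟨F', hF', hFF', hsupp⟩ := hF.exists_contDiff_approx (⊤ : ℕ∞) (ε := fun _ => η)
    continuous_const fun _ => hη
  have hR' : ∀ X, R < ‖X‖ → F' X = 0 := fun X hX => by
    by_contra h
    exact hsupp h (hR X hX)
  have hF'c : HasCompactSupport F' := hasCompactSupport_of_norm hR'
  obtain ⟨M', hM'⟩ := hF'c.exists_bound_of_continuous hF'.continuous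
  have hdiff : ∀ X, ‖(F - F') X‖ ≤ η := fun X => by
    rw [Pi.sub_apply, ← dist_eq_norm, dist_comm]; exact (hFF' X).le
  have hdR : ∀ X, R < ‖X‖ → (F - F') X = 0 := fun X hX => by simp [hR X hX, hR' X hX]
  have hlim := hu.tendsto_osc hg hgc hgT k hF' hF'c
  obtain ⟨N, hN⟩ := Metric.tendsto_atTop.1 hlim (κ / 3) (by positivity)
  refine ⟨N, fun n hn => ?_⟩
  have h1 : ‖∫ p, u n p * osc Φ (ε n) g k F p ∂(measTX d T)
      - ∫ p, u n p * osc Φ (ε n) g k F' p ∂(measTX d T)‖ ≤ κ / 3 := by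
    rw [← integral_sub (integrable_mul_osc hΦ hg.continuous hG k hF hM hR (hu.1 n))
      (integrable_mul_osc hΦ hg.continuous hG k hF'.continuous hM' hR' (hu.1 n))]
    have e : ∀ p, u n p * osc Φ (ε n) g k F p - u n p * osc Φ (ε n) g k F' p
        = u n p * osc Φ (ε n) g k (F - F') p := fun p => by
      rw [← mul_sub, osc, osc, osc, ← mul_sub]; rfl
    simp_rw [e]
    refine (norm_integral_mul_osc_le hΦ hG k hdiff hdR (hu.1 n)).trans (le_trans ?_ hD₁η)
    rw [← mul_assoc]
    simp only [D₁]
    gcongr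
    · exact ENNReal.mul_ne_top ENNReal.coe_ne_top hm
    · exact hC n
  have h2 : ‖∫ q, u₀ q * limTest g k F' q ∂(measTXSY A d T)
      - ∫ q, u₀ q * limTest g k F q ∂(measTXSY A d T)‖ ≤ κ / 3 := by
    rw [norm_sub_rev, ← integral_sub (integrable_mul_limTest hg.continuous hG k hF hM hR hu.2.1)
      (integrable_mul_limTest hg.continuous hG k hF'.continuous hM' hR' hu.2.1)]
    have e : ∀ q, u₀ q * limTest g k F q - u₀ q * limTest g k F' q
        = u₀ q * limTest g k (F - F') q := fun q => by
      rw [← mul_sub, limTest, limTest, limTest, ← mul_sub, Pi.sub_apply, map_sub]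
    simp_rw [e]
    refine (norm_integral_mul_limTest_le hG k hdiff hdR hu.2.1).trans (le_trans ?_ hD₂η)
    rw [← mul_assoc]
  have h3 := hN n hn
  rw [dist_eq_norm] at h3 ⊢
  set a := ∫ p, u n p * osc Φ (ε n) g k F p ∂(measTX d T)
  set b := ∫ p, u n p * osc Φ (ε n) g k F' p ∂(measTX d T)
  set c := ∫ q, u₀ q * limTest g k F' q ∂(measTXSY A d T)
  set e := ∫ q, u₀ q * limTest g k F q ∂(measTXSY A d T)
  have : a - e = (a - b) + (b - c) + (c - e) := by ring
  rw [this]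
  refine (norm_add₃_le).trans_lt ?_
  linarith

end OscillatingLimit

/-! ### Integration by parts at fixed scale -/

section LevelEps

variable {d : ℕ} {T : ℝ} {A : MeanValueAlgebra} {Φ : ℝ → Space d → Space d}
  {Jt : Fin d → Fin d → Space d → A.Elem}

/-- The oscillating functions inherit only C¹ regularity from the flow, so the weak gradient has to
be tested beyond smooth functions. -/
theorem HasWeakGradient.integral_mul_eq {f : Space d → ℂ} {w : Fin d → Space d → ℂ}
    (h : HasWeakGradient f w) {φ : Space d → ℂ} (hφ : ContDiff ℝ 1 φ) (hc : HasCompactSupport φ)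
    (i : Fin d) : ∫ x, w i x * φ x = -∫ x, f x * fderiv ℝ φ x (basisVec i) := by
  have hz : LocallyIntegrable (fun _ : Space d => (0 : ℂ)) := locallyIntegrable_zero
  have hq : ∀ j, LocallyIntegrable (if j = i then f else fun _ => 0) := fun j => by
    split_ifs
    · exact h.1
    · exact hz
  have e : ∀ φ x, firstOrder (w i) (fun j => if j = i then f else fun _ => 0) φ x
      = w i x * φ x + f x * fderiv ℝ φ x (basisVec i) := by
    intro φ x
    have : ∀ j, (if j = i then f else fun _ => 0) x * fderiv ℝ φ x (basisVec j)
        = if j = i then f x * fderiv ℝ φ x (basisVec j) else 0 := fun j => by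
      split_ifs <;> simp
    simp [firstOrder, this]
  have hi : ∀ φ : Space d → ℂ, ContDiff ℝ 1 φ → HasCompactSupport φ →
      Integrable (fun x => w i x * φ x) ∧
      Integrable fun x => f x * fderiv ℝ φ x (basisVec i) := fun φ hφ hc =>
    ⟨locallyIntegrable_mul_of_hasCompactSupport (h.2.1 i) hφ.continuous hc,
      locallyIntegrable_mul_of_hasCompactSupport h.1
        ((hφ.continuous_fderiv one_ne_zero).clm_apply continuous_const)
        ((hc.fderiv ℝ).comp_left (g := fun L : Space d →L[ℝ] ℂ => L (basisVec i)) rfl)⟩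
  have key := integral_firstOrder_eq_zero_of_smooth (h.2.1 i) hq (fun φ hφ hc => by
    have hφ1 : ContDiff ℝ 1 φ := hφ.of_le (by simp)
    simp_rw [e]
    rw [integral_add (hi φ hφ1 hc).1 (hi φ hφ1 hc).2, h.2.2 φ hφ hc i, add_neg_cancel]) hφ hc
  simp_rw [e] at key
  rw [integral_add (hi φ hφ hc).1 (hi φ hφ hc).2] at key
  exact eq_neg_of_add_eq_zero_left key

theorem hasCompactSupport_osc (hΦ : IsAdmissibleFlow Φ) (ε : ℝ) (g : ℝ → ℂ) (k : Fin d → ℤ)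
    {F : Space d → A.Elem} {R : ℝ} (hR : ∀ X, R < ‖X‖ → F X = 0) (t : ℝ) :
    HasCompactSupport fun x => osc Φ ε g k F (t, x) := by
  refine HasCompactSupport.intro ((ProperSpace.isCompact_closedBall (0 : Space d) R).image
    (hΦ.contDiff_apply (t / ε)).continuous) fun x hx => osc_eq_zero hR fun hx' => hx ?_
  exact ⟨Φ (-(t / ε)) x, by simpa [flowBall] using hx', hΦ.apply_neg_apply _ _⟩

theorem contDiff_osc (hΦ : IsAdmissibleFlow Φ) (ε : ℝ) (g : ℝ → ℂ) (k : Fin d → ℤ)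
    {F : Space d → A.Elem} (hF : ContDiff ℝ 1 F) (t : ℝ) :
    ContDiff ℝ 1 fun x => osc Φ ε g k F (t, x) := by
  have h1 : ContDiff ℝ 1 fun x => evalCLM A (t / ε) (F (Φ (-(t / ε)) x)) :=
    (evalCLM A (t / ε)).contDiff.comp (hF.comp (hΦ.contDiff_apply _))
  have h2 : ContDiff ℝ 1 fun x : Space d => expo k (ε⁻¹ • x) :=
    ((contDiff_expo k).of_le (by simp)).comp (contDiff_id.const_smul ε⁻¹)
  exact (ContDiff.mul (contDiff_const (c := g t)) h2).mul h1

/-- The spatial derivatives of a test function in the coordinates of the flow. -/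
noncomputable def flowDeriv (Jt : Fin d → Fin d → Space d → A.Elem) (F : Space d → A.Elem)
    (i j : Fin d) (X : Space d) : A.Elem :=
  fderiv ℝ F X (basisVec j) * Jt j i X

/-- The chain rule, with J(τ, x) rewritten as `Jt` at X = Φ_{-τ}(x). The first term is again a sum
of oscillating functions, while all of the 1/ε sits in front of the original one. -/
theorem IsFlowJacobian.fderiv_osc (H : IsFlowJacobian Φ Jt) (ε : ℝ) (g : ℝ → ℂ) (k : Fin d → ℤ)
    {F : Space d → A.Elem} (hF : ContDiff ℝ 1 F) (t : ℝ) (x : Space d) (i : Fin d) :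
    fderiv ℝ (fun x => osc Φ ε g k F (t, x)) x (basisVec i)
      = ∑ j, osc Φ ε g k (flowDeriv Jt F i j) (t, x)
        + 2 * Real.pi * Complex.I * k i * (ε : ℂ)⁻¹ * osc Φ ε g k F (t, x) := by
  let τ := t / ε
  have h1 : HasFDerivAt (fun x => evalCLM A τ (F (Φ (-τ) x)))
      ((evalCLM A τ).comp ((fderiv ℝ F (Φ (-τ) x)).comp (fderiv ℝ (Φ (-τ)) x))) x :=
    (evalCLM A τ).hasFDerivAt.comp x ((hF.differentiable one_ne_zero _).hasFDerivAt.comp x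
      (H.flow.differentiable_apply (-τ) x).hasFDerivAt)
  have h2 : HasFDerivAt (fun x : Space d => expo k (ε⁻¹ • x))
      ((fderiv ℝ (expo k) (ε⁻¹ • x)).comp (ε⁻¹ • ContinuousLinearMap.id ℝ (Space d))) x :=
    (((contDiff_expo k).differentiable (by simp)) _).hasFDerivAt.comp x
      ((hasFDerivAt_id x).const_smul ε⁻¹)
  have h3 : fderiv ℝ (fun x => osc Φ ε g k F (t, x)) x = _ :=
    ((h2.const_mul (g t)).mul h1).fderiv
  have hx : fderiv ℝ (Φ (-τ)) x (basisVec i)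
      = ∑ j, jacobian Φ τ x j i • (basisVec j : Space d) := by
    ext l
    simp [basisVec, jacobian, Finset.sum_apply, Pi.single_apply]
  have hJ : ∀ j, ((jacobian Φ τ x j i : ℝ) : ℂ) = (Jt j i (Φ (-τ) x)).1 τ := fun j => by
    rw [H.eq, H.flow.apply_neg_apply]
  have h4 : evalCLM A τ (fderiv ℝ F (Φ (-τ) x) (fderiv ℝ (Φ (-τ)) x (basisVec i)))
      = ∑ j, (flowDeriv Jt F i j (Φ (-τ) x)).1 τ := by
    rw [hx, map_sum, map_sum]
    refine Finset.sum_congr rfl fun j _ => ?_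
    rw [map_smul, map_smul, Complex.real_smul, hJ, mul_comm]
    rfl
  have h5 : fderiv ℝ (expo k) (ε⁻¹ • x) (ε⁻¹ • (basisVec i : Space d))
      = (ε : ℂ)⁻¹ * (2 * Real.pi * Complex.I * k i * expo k (ε⁻¹ • x)) := by
    rw [map_smul, fderiv_expo, Complex.real_smul, Complex.ofReal_inv]
  rw [h3]
  simp only [add_apply, smul_apply,
    ContinuousLinearMap.comp_apply, ContinuousLinearMap.id_apply, smul_eq_mul, h4, h5,
    evalCLM_apply]
  simp only [osc, ← Finset.mul_sum, τ]
  ring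

theorem continuous_flowDeriv (hJc : ∀ i j, Continuous (Jt i j)) {F : Space d → A.Elem}
    (hF : ContDiff ℝ 1 F) (i j : Fin d) : Continuous (flowDeriv Jt F i j) :=
  ((hF.continuous_fderiv one_ne_zero).clm_apply continuous_const).mul (hJc j i)

theorem flowDeriv_eq_zero {F : Space d → A.Elem} {R : ℝ} (hR : ∀ X, R < ‖X‖ → F X = 0)
    (i j : Fin d) (X : Space d) (hX : R < ‖X‖) : flowDeriv Jt F i j X = 0 := by
  have : F =ᶠ[𝓝 X] fun _ => 0 :=
    (continuous_norm.continuousAt.eventually (lt_mem_nhds hX)).mono fun y hy => hR y hy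
  rw [flowDeriv, this.fderiv_eq]
  simp

/-- Integration by parts against an oscillating test function. -/
theorem IsFlowJacobian.integral_grad_mul_osc (H : IsFlowJacobian Φ Jt) {ε : ℝ}
    {u : ℝ × Space d → ℂ} {gradu : Fin d → ℝ × Space d → ℂ} (hu : MemLp u 2 (measTX d T))
    (hgradu : ∀ i, MemLp (gradu i) 2 (measTX d T))
    (hw : ∀ᵐ t ∂(volume.restrict (Ioo 0 T)),
      HasWeakGradient (fun x => u (t, x)) (fun i x => gradu i (t, x)))
    {g : ℝ → ℂ} (hg : Continuous g) (hgc : HasCompactSupport g) (k : Fin d → ℤ)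
    {F : Space d → A.Elem} (hF : ContDiff ℝ 1 F) (hFc : HasCompactSupport F) (i : Fin d) :
    ∫ p, gradu i p * osc Φ ε g k F p ∂(measTX d T)
      = -∑ j, ∫ p, u p * osc Φ ε g k (flowDeriv Jt F i j) p ∂(measTX d T)
        - 2 * Real.pi * Complex.I * k i * (ε : ℂ)⁻¹
          * ∫ p, u p * osc Φ ε g k F p ∂(measTX d T) := by
  obtain ⟨G, hG⟩ := hgc.exists_bound_of_continuous hg
  obtain ⟨R, hR⟩ := exists_norm_bound_of_hasCompactSupport hFc
  obtain ⟨M, hM⟩ := hFc.exists_bound_of_continuous hF.continuous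
  have hDc := fun j => continuous_flowDeriv H.cont hF i j
  have hDR := fun j => flowDeriv_eq_zero (Jt := Jt) hR i j
  choose N hN using fun j => (hasCompactSupport_of_norm (hDR j)).exists_bound_of_continuous (hDc j)
  have i1 := integrable_mul_osc H.flow (ε := ε) hg hG k hF.continuous hM hR (hgradu i)
  have i2 := fun j => integrable_mul_osc H.flow (ε := ε) hg hG k (hDc j) (hN j) (hDR j) hu
  have i3 := integrable_mul_osc H.flow (ε := ε) hg hG k hF.continuous hM hR hu
  set c : ℂ := 2 * Real.pi * Complex.I * k i * (ε : ℂ)⁻¹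
  have i4 : Integrable (fun p => u p * (∑ j, osc Φ ε g k (flowDeriv Jt F i j) p
      + c * osc Φ ε g k F p)) (measTX d T) := by
    refine ((integrable_finsetSum Finset.univ fun j _ => i2 j).add (i3.const_mul c)).congr
      (ae_of_all _ fun p => ?_)
    simp only [Pi.add_apply, mul_add, Finset.mul_sum]
    ring
  have hsum : ∫ p, u p * (∑ j, osc Φ ε g k (flowDeriv Jt F i j) p + c * osc Φ ε g k F p)
      ∂(measTX d T) = ∑ j, ∫ p, u p * osc Φ ε g k (flowDeriv Jt F i j) p ∂(measTX d T)
        + c * ∫ p, u p * osc Φ ε g k F p ∂(measTX d T) := by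
    rw [← integral_finsetSum _ fun j _ => i2 j, ← integral_const_mul,
      ← integral_add (integrable_finsetSum Finset.univ fun j _ => i2 j) (i3.const_mul c)]
    refine integral_congr_ae (ae_of_all _ fun p => ?_)
    simp only [mul_add, Finset.mul_sum]
    ring
  have hmain : ∫ p, gradu i p * osc Φ ε g k F p ∂(measTX d T)
      = -∫ p, u p * (∑ j, osc Φ ε g k (flowDeriv Jt F i j) p + c * osc Φ ε g k F p)
        ∂(measTX d T) := by
    rw [measTX] at i1 i4 ⊢
    rw [integral_prod _ i1, integral_prod _ i4, ← integral_neg]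
    refine integral_congr_ae ?_
    filter_upwards [hw] with t ht
    have h1 := ht.integral_mul_eq (contDiff_osc H.flow ε g k hF t)
      (hasCompactSupport_osc H.flow ε g k hR t) i
    simp_rw [H.fderiv_osc ε g k hF t] at h1
    exact h1
  rw [hmain, hsum]
  ring

end LevelEps

/-! ### Limit identities for single Fourier modes -/

section Limit

variable {d : ℕ} {T : ℝ} {A : MeanValueAlgebra} {Φ : ℝ → Space d → Space d}
  {Jt : Fin d → Fin d → Space d → A.Elem} {ε : ℕ → ℝ} {u : ℕ → ℝ × Space d → ℂ}
  {gradu : ℕ → Fin d → ℝ × Space d → ℂ}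
  {u₀ : ℝ × Space d × A.Spectrum × Space d → ℂ}
  {v₀ : Fin d → ℝ × Space d × A.Spectrum × Space d → ℂ}

/-- The data of the compactness theorem. -/
structure GradientSequence (T : ℝ) (Φ : ℝ → Space d → Space d)
    (Jt : Fin d → Fin d → Space d → A.Elem) (ε : ℕ → ℝ) (u : ℕ → ℝ × Space d → ℂ)
    (gradu : ℕ → Fin d → ℝ × Space d → ℂ) (u₀ : ℝ × Space d × A.Spectrum × Space d → ℂ)
    (v₀ : Fin d → ℝ × Space d × A.Spectrum × Space d → ℂ) : Prop where
  flowJacobian : IsFlowJacobian Φ Jt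
  eps_pos : ∀ n, 0 < ε n
  eps_tendsto : Tendsto ε atTop (𝓝 0)
  weakGradient : ∀ n, ∀ᵐ t ∂(volume.restrict (Ioo 0 T)),
    HasWeakGradient (fun x => u n (t, x)) (fun i x => gradu n i (t, x))
  bounded : ∃ C : NNReal, ∀ n, eLpNorm (u n) 2 (measTX d T) ≤ C
  conv : SigmaConverges A d T Φ ε u u₀
  conv_grad : ∀ i, SigmaConverges A d T Φ ε (fun n => gradu n i) (v₀ i)

namespace GradientSequence

variable (S : GradientSequence T Φ Jt ε u gradu u₀ v₀)
include S

theorem integral_grad_mul_osc (n : ℕ) {g : ℝ → ℂ} (hg : Continuous g)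
    (hgc : HasCompactSupport g) (k : Fin d → ℤ)
    {F : Space d → A.Elem} (hF : ContDiff ℝ 1 F) (hFc : HasCompactSupport F) (i : Fin d) :
    ∫ p, gradu n i p * osc Φ (ε n) g k F p ∂(measTX d T)
      = -∑ j, ∫ p, u n p * osc Φ (ε n) g k (flowDeriv Jt F i j) p ∂(measTX d T)
        - 2 * Real.pi * Complex.I * k i * (ε n : ℂ)⁻¹
          * ∫ p, u n p * osc Φ (ε n) g k F p ∂(measTX d T) :=
  S.flowJacobian.integral_grad_mul_osc (S.conv.1 n) (fun i => (S.conv_grad i).1 n)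
    (S.weakGradient n) hg hgc k hF hFc i

/-- `flowDeriv` contains the Jacobian and is merely continuous in X, so the extension to continuous
tests is needed; it is available for u because that sequence is bounded. -/
theorem tendsto_flowDeriv {g : ℝ → ℂ} (hg : ContDiff ℝ ∞ g)
    (hgc : HasCompactSupport g) (hgT : tsupport g ⊆ Ioo 0 T) (k : Fin d → ℤ)
    {F : Space d → A.Elem} (hF : ContDiff ℝ ∞ F) (hFc : HasCompactSupport F) (i j : Fin d) :
    Tendsto (fun n => ∫ p, u n p * osc Φ (ε n) g k (flowDeriv Jt F i j) p ∂(measTX d T)) atTop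
      (𝓝 (∫ q, u₀ q * limTest g k (flowDeriv Jt F i j) q ∂(measTXSY A d T))) := by
  obtain ⟨R, hR⟩ := exists_norm_bound_of_hasCompactSupport hFc
  exact S.conv.tendsto_osc_of_continuous S.flowJacobian.flow S.bounded hg hgc hgT k
    (continuous_flowDeriv S.flowJacobian.cont (hF.of_le (by simp)) i j)
    (hasCompactSupport_of_norm (flowDeriv_eq_zero hR i j))

theorem integral_limit_eq_zero {g : ℝ → ℂ} (hg : ContDiff ℝ ∞ g)
    (hgc : HasCompactSupport g) (hgT : tsupport g ⊆ Ioo 0 T) {k : Fin d → ℤ} (hk : k ≠ 0)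
    {F : Space d → A.Elem} (hF : ContDiff ℝ ∞ F) (hFc : HasCompactSupport F) :
    ∫ q, u₀ q * limTest g k F q ∂(measTXSY A d T) = 0 := by
  obtain ⟨i, hi⟩ : ∃ i, k i ≠ 0 := by
    by_contra! h
    exact hk (funext h)
  have hεc : Tendsto (fun n => (ε n : ℂ)) atTop (𝓝 0) := by
    have := (Complex.continuous_ofReal.tendsto 0).comp S.eps_tendsto
    rwa [Complex.ofReal_zero] at this
  -- After multiplication by ε the gradient and flow derivative terms tend to zero, as convergent
  -- quantities times ε; the singular term becomes a nonzero multiple of the pairing with u.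
  have h1 := hεc.mul ((S.conv_grad i).tendsto_osc hg hgc hgT k hF hFc)
  have h2 := hεc.mul (tendsto_finsetSum Finset.univ fun j (_ : j ∈ Finset.univ) =>
    S.tendsto_flowDeriv hg hgc hgT k hF hFc i j)
  have h3 := (S.conv.tendsto_osc hg hgc hgT k hF hFc).const_mul (2 * Real.pi * Complex.I * k i)
  have h4 := h1.add h2
  rw [zero_mul, zero_mul, add_zero] at h4
  have h5 := tendsto_nhds_unique (h4.congr fun n => ?_) h3.neg
  · have := (neg_eq_zero.1 h5.symm)
    refine (mul_eq_zero.1 this).resolve_left ?_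
    simp [hi, Real.pi_ne_zero]
  · rw [S.integral_grad_mul_osc n hg.continuous hgc k (hF.of_le (by simp)) hFc i]
    have hne : (ε n : ℂ) ≠ 0 := by exact_mod_cast (S.eps_pos n).ne'
    field_simp
    ring

/-- Orthogonality of ξ to k cancels the 1/ε terms exactly for each n, before any limit is taken. -/
theorem sum_integral_limit {g : ℝ → ℂ} (hg : ContDiff ℝ ∞ g)
    (hgc : HasCompactSupport g) (hgT : tsupport g ⊆ Ioo 0 T) (k : Fin d → ℤ)
    {F : Space d → A.Elem} (hF : ContDiff ℝ ∞ F) (hFc : HasCompactSupport F) {ξ : Fin d → ℂ}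
    (hξ : ∑ i, ξ i * k i = 0) :
    ∑ i, ξ i * ∫ q, v₀ i q * limTest g k F q ∂(measTXSY A d T)
      = -∑ i, ξ i * ∑ j, ∫ q, u₀ q * limTest g k (flowDeriv Jt F i j) q ∂(measTXSY A d T) := by
  have h1 := tendsto_finsetSum Finset.univ fun i (_ : i ∈ Finset.univ) =>
    ((S.conv_grad i).tendsto_osc hg hgc hgT k hF hFc).const_mul (ξ i)
  have h2 := (tendsto_finsetSum Finset.univ fun i (_ : i ∈ Finset.univ) =>
    (tendsto_finsetSum Finset.univ fun j (_ : j ∈ Finset.univ) =>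
      S.tendsto_flowDeriv hg hgc hgT k hF hFc i j).const_mul (ξ i)).neg
  refine tendsto_nhds_unique (h1.congr fun n => ?_) h2
  simp_rw [S.integral_grad_mul_osc n hg.continuous hgc k (hF.of_le (by simp)) hFc]
  have : ∀ i, ξ i * (-∑ j, ∫ p, u n p * osc Φ (ε n) g k (flowDeriv Jt F i j) p ∂(measTX d T)
        - 2 * Real.pi * Complex.I * k i * (ε n : ℂ)⁻¹
          * ∫ p, u n p * osc Φ (ε n) g k F p ∂(measTX d T))
      = -(ξ i * ∑ j, ∫ p, u n p * osc Φ (ε n) g k (flowDeriv Jt F i j) p ∂(measTX d T))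
        - (ξ i * k i) * (2 * Real.pi * Complex.I * (ε n : ℂ)⁻¹
          * ∫ p, u n p * osc Φ (ε n) g k F p ∂(measTX d T)) := fun i => by ring
  simp_rw [this]
  rw [Finset.sum_sub_distrib, ← Finset.sum_mul, hξ, zero_mul, sub_zero, Finset.sum_neg_distrib]

end GradientSequence

end Limit

/-! ### Partial Fourier series -/

theorem MemLp.ae_slice {α β : Type*} [MeasurableSpace α] [MeasurableSpace β] {μ : Measure α}
    {ν : Measure β} [SFinite ν] {f : α × β → ℂ} (hf : MemLp f 2 (μ.prod ν)) :
    ∀ᵐ a ∂μ, MemLp (fun y => f (a, y)) 2 ν := by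
  have hm : AEMeasurable (fun z => ‖f z‖ₑ ^ 2) (μ.prod ν) :=
    hf.aestronglyMeasurable.enorm.pow_const 2
  have h1 : ∫⁻ a, ∫⁻ y, ‖f (a, y)‖ₑ ^ 2 ∂ν ∂μ ≠ ⊤ := by
    rw [← lintegral_prod _ hm, lintegral_enorm_sq_eq_eLpNorm]
    exact ENNReal.pow_ne_top hf.eLpNorm_ne_top
  filter_upwards [hf.aestronglyMeasurable.prodMk_left, ae_lt_top' hm.lintegral_prod_right' h1]
    with a h2 h3
  refine ⟨h2, ?_⟩
  rw [lintegral_enorm_sq_eq_eLpNorm] at h3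
  exact (ENNReal.pow_lt_top_iff.1 h3).resolve_right two_ne_zero

section PartialFourier

variable {d : ℕ} {α : Type*} [MeasurableSpace α] {μ : Measure α}

/-- The Fourier coefficients in the last variable. -/
noncomputable def coeff (f : α × Space d → ℂ) (k : Fin d → ℤ) (a : α) : ℂ :=
  ∫ y in cell d, f (a, y) * expo (-k) y

variable {f h : α × Space d → ℂ}

theorem aestronglyMeasurable_coeff
    (hf : AEStronglyMeasurable f (μ.prod (volume.restrict (cell d)))) (k : Fin d → ℤ) :
    AEStronglyMeasurable (coeff f k) μ :=
  AEStronglyMeasurable.integral_prod_right' (f := fun p : α × Space d => f p * expo (-k) p.2)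
    (hf.mul ((continuous_expo (-k)).measurable.comp measurable_snd).aestronglyMeasurable)

/-- Bessel on almost every slice, then Tonelli to exchange sum and integral. -/
theorem tsum_eLpNorm_coeff_sq_le (hf : MemLp f 2 (μ.prod (volume.restrict (cell d)))) :
    ∑' k, eLpNorm (coeff f k) 2 μ ^ 2
      ≤ eLpNorm f 2 (μ.prod (volume.restrict (cell d))) ^ 2 := by
  simp_rw [← lintegral_enorm_sq_eq_eLpNorm]
  rw [← lintegral_tsum fun k =>
      (aestronglyMeasurable_coeff hf.aestronglyMeasurable k).enorm.pow_const 2,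
    lintegral_prod _ (hf.aestronglyMeasurable.enorm.pow_const 2)]
  refine lintegral_mono_ae ?_
  filter_upwards [MemLp.ae_slice hf] with a ha
  exact tsum_enorm_sq_fourier_le ha

theorem eLpNorm_coeff_le (hf : MemLp f 2 (μ.prod (volume.restrict (cell d)))) (k : Fin d → ℤ) :
    eLpNorm (coeff f k) 2 μ ≤ eLpNorm f 2 (μ.prod (volume.restrict (cell d))) :=
  (ENNReal.pow_le_pow_left_iff two_ne_zero).1 ((ENNReal.le_tsum k).trans (tsum_eLpNorm_coeff_sq_le hf))

theorem memLp_coeff (hf : MemLp f 2 (μ.prod (volume.restrict (cell d)))) (k : Fin d → ℤ) :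
    MemLp (coeff f k) 2 μ :=
  ⟨aestronglyMeasurable_coeff hf.aestronglyMeasurable k,
    (eLpNorm_coeff_le hf k).trans_lt hf.eLpNorm_lt_top⟩

theorem integrable_mul_expo {u : Space d → ℂ} (hu : MemLp u 2 (volume.restrict (cell d)))
    (k : Fin d → ℤ) : IntegrableOn (fun y => u y * expo k y) (cell d) :=
  (hu.integrable (by norm_num)).mul_bdd (c := 1) (continuous_expo k).aestronglyMeasurable
    (ae_of_all _ fun y => (norm_expo k y).le)

theorem coeff_sub (hf : MemLp f 2 (μ.prod (volume.restrict (cell d))))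
    (hh : MemLp h 2 (μ.prod (volume.restrict (cell d)))) (k : Fin d → ℤ) :
    coeff (f - h) k =ᵐ[μ] coeff f k - coeff h k := by
  filter_upwards [MemLp.ae_slice hf, MemLp.ae_slice hh] with a h1 h2
  simp only [coeff, Pi.sub_apply, sub_mul]
  exact integral_sub (integrable_mul_expo h1 _) (integrable_mul_expo h2 _)

omit [MeasurableSpace α] in
theorem coeff_mul_expo (b : α → ℂ) (k l : Fin d → ℤ) (a : α) :
    coeff (fun p : α × Space d => b p.1 * expo k p.2) l a = if k = l then b a else 0 := by
  simp only [coeff, mul_assoc, expo_mul_expo]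
  rw [integral_const_mul, setIntegral_cell_expo]
  simp [← sub_eq_add_neg, sub_eq_zero]

theorem ae_eq_zero_of_coeff (hf : MemLp f 2 (μ.prod (volume.restrict (cell d))))
    (h : ∀ k, coeff f k =ᵐ[μ] 0) : f =ᵐ[μ.prod (volume.restrict (cell d))] 0 := by
  have hm : AEMeasurable (fun z => ‖f z‖ₑ ^ 2) (μ.prod (volume.restrict (cell d))) :=
    hf.aestronglyMeasurable.enorm.pow_const 2
  have h1 : ∫⁻ z, ‖f z‖ₑ ^ 2 ∂(μ.prod (volume.restrict (cell d))) = 0 := by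
    rw [lintegral_prod _ hm]
    refine (lintegral_congr_ae ?_).trans lintegral_zero
    filter_upwards [MemLp.ae_slice hf, ae_all_iff.2 h] with a h1 h2
    have h3 : (fun y => f (a, y)) =ᵐ[volume.restrict (cell d)] 0 := by
      refine determining_expo d _ (h1.integrable (by norm_num)) ?_
      rintro _ ⟨k, rfl⟩
      simpa [coeff] using h2 (-k)
    refine (lintegral_congr_ae ?_).trans lintegral_zero
    filter_upwards [h3] with y hy
    simp [hy]
  filter_upwards [(lintegral_eq_zero_iff' hm).1 h1] with z hz
  simpa using hz

theorem coeff_congr (hfh : f =ᵐ[μ.prod (volume.restrict (cell d))] h) (k : Fin d → ℤ) :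
    coeff f k =ᵐ[μ] coeff h k := by
  filter_upwards [Measure.ae_ae_of_ae_prod hfh] with a ha
  refine integral_congr_ae ?_
  filter_upwards [ha] with y hy
  rw [hy]

theorem coeff_add (hf : MemLp f 2 (μ.prod (volume.restrict (cell d))))
    (hh : MemLp h 2 (μ.prod (volume.restrict (cell d)))) (k : Fin d → ℤ) :
    coeff (f + h) k =ᵐ[μ] coeff f k + coeff h k := by
  filter_upwards [MemLp.ae_slice hf, MemLp.ae_slice hh] with a h1 h2
  simp only [coeff, Pi.add_apply, add_mul]
  exact integral_add (integrable_mul_expo h1 _) (integrable_mul_expo h2 _)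

/-- The Fourier coefficient as an additive map between `L²` spaces. -/
noncomputable def coeffHom (μ : Measure α) (k : Fin d → ℤ) :
    Lp ℂ 2 (μ.prod ((volume : Measure (Space d)).restrict (cell d))) →+ Lp ℂ 2 μ :=
  AddMonoidHom.mk' (fun f => (memLp_coeff (Lp.memLp f) k).toLp _) fun f h => by
    rw [← MemLp.toLp_add, MemLp.toLp_eq_toLp_iff]
    exact (coeff_congr (Lp.coeFn_add f h) k).trans (coeff_add (Lp.memLp f) (Lp.memLp h) k)

theorem coeffHom_apply (k : Fin d → ℤ)
    (f : Lp ℂ 2 (μ.prod ((volume : Measure (Space d)).restrict (cell d)))) :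
    coeffHom μ k f = (memLp_coeff (Lp.memLp f) k).toLp _ := rfl

theorem continuous_coeffHom (k : Fin d → ℤ) : Continuous (coeffHom μ k) := by
  refine AddMonoidHomClass.continuous_of_bound (coeffHom μ k) 1 fun f => ?_
  rw [coeffHom_apply, Lp.norm_toLp, one_mul, Lp.norm_def]
  exact ENNReal.toReal_mono (Lp.eLpNorm_ne_top f) (eLpNorm_coeff_le (Lp.memLp f) k)

theorem eLpNorm_mul_expo {b : α → ℂ} (hb : MemLp b 2 μ) (k : Fin d → ℤ) :
    eLpNorm (fun p : α × Space d => b p.1 * expo k p.2) 2 (μ.prod (volume.restrict (cell d)))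
      = eLpNorm b 2 μ := by
  rw [← eLpNorm_comp_measurePreserving hb.aestronglyMeasurable
    (measurePreserving_fst (ν := (volume : Measure (Space d)).restrict (cell d)))]
  exact eLpNorm_congr_norm_ae (ae_of_all _ fun p => by simp [norm_expo])

theorem memLp_mul_expo {b : α → ℂ} (hb : MemLp b 2 μ) (k : Fin d → ℤ) :
    MemLp (fun p : α × Space d => b p.1 * expo k p.2) 2 (μ.prod (volume.restrict (cell d))) :=
  ⟨hb.aestronglyMeasurable.comp_fst.mul
    ((continuous_expo k).measurable.comp measurable_snd).aestronglyMeasurable,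
    (eLpNorm_mul_expo hb k).trans_lt hb.eLpNorm_lt_top⟩

variable [SFinite μ]

theorem inner_mul_expo_eq_zero {b c : α → ℂ} (hb : MemLp b 2 μ) (hc : MemLp c 2 μ)
    {k l : Fin d → ℤ} (hkl : k ≠ l) :
    inner ℂ ((memLp_mul_expo hb k).toLp _) ((memLp_mul_expo hc l).toLp _) = 0 := by
  have hi : Integrable (fun p : α × Space d =>
      starRingEnd ℂ (b p.1 * expo k p.2) * (c p.1 * expo l p.2))
      (μ.prod (volume.restrict (cell d))) :=
    (memLp_mul_expo hb k).star.integrable_mul (memLp_mul_expo hc l)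
  rw [inner_toLp_toLp, integral_prod _ hi]
  refine (integral_congr_ae (ae_of_all _ fun a => ?_)).trans (integral_zero _ _)
  have : ∀ y : Space d, starRingEnd ℂ (b a * expo k y) * (c a * expo l y)
      = starRingEnd ℂ (b a) * c a * expo (-k + l) y := fun y => by
    rw [map_mul, conj_expo, ← expo_mul_expo]
    ring
  simp only [this]
  rw [integral_const_mul, setIntegral_cell_expo, if_neg, mul_zero]
  rwa [neg_add_eq_zero]

/-- Square summable Fourier coefficients define an `L²` function. -/
theorem exists_memLp_of_coeff {b : (Fin d → ℤ) → α → ℂ} (hb : ∀ k, MemLp (b k) 2 μ)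
    (hs : ∑' k, eLpNorm (b k) 2 μ ^ 2 ≠ ⊤) :
    ∃ u : α × Space d → ℂ, MemLp u 2 (μ.prod (volume.restrict (cell d))) ∧
      ∀ k, coeff u k =ᵐ[μ] b k := by
  obtain ⟨e, he⟩ : ∃ e : (Fin d → ℤ) → Lp ℂ 2 (μ.prod (volume.restrict (cell d))),
    ∀ k, e k = (memLp_mul_expo (hb k) k).toLp _ := ⟨_, fun _ => rfl⟩
  -- The terms b_k(a) e_k(y) are pairwise orthogonal in L² of the product, so square summability of
  -- their norms gives convergence of the series there.
  have ho : OrthogonalFamily ℂ (fun k => ℂ ∙ e k) fun k => (ℂ ∙ e k).subtypeₗᵢ := by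
    refine OrthogonalFamily.of_pairwise fun k l hkl => Submodule.isOrtho_span.2 ?_
    rintro _ rfl _ rfl
    rw [he, he]
    exact inner_mul_expo_eq_zero (hb k) (hb l) hkl
  have hsum : Summable e := by
    refine (ho.summable_iff_norm_sq_summable
      fun k => ⟨e k, Submodule.mem_span_singleton_self _⟩).2 ?_
    refine (ENNReal.summable_toReal hs).congr fun k => ?_
    rw [ENNReal.toReal_pow, Submodule.coe_norm, he, Lp.norm_toLp, eLpNorm_mul_expo (hb k)]
  refine ⟨(∑' k, e k : Lp ℂ 2 (μ.prod (volume.restrict (cell d)))), Lp.memLp _, fun k => ?_⟩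
  have h1 := hsum.hasSum.map (coeffHom μ k) (continuous_coeffHom k)
  have h2 : ∀ l, coeffHom μ k (e l) = if l = k then (hb k).toLp _ else 0 := fun l => by
    have h3 : coeff (e l) k =ᵐ[μ] fun a => if l = k then b l a else 0 := by
      rw [he]
      refine (coeff_congr (memLp_mul_expo (hb l) l).coeFn_toLp k).trans (ae_of_all _ fun a => ?_)
      exact coeff_mul_expo (b l) l k a
    rw [coeffHom_apply]
    split_ifs with hlk
    · subst hlk
      rw [MemLp.toLp_eq_toLp_iff]
      simpa using h3
    · rw [Lp.eq_zero_iff_ae_eq_zero]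
      refine (MemLp.coeFn_toLp _).trans ?_
      simp only [hlk, if_false] at h3
      exact h3
  have h4 := h1.unique ((hasSum_ite_eq k ((hb k).toLp _)).congr_fun h2)
  rwa [coeffHom_apply, MemLp.toLp_eq_toLp_iff] at h4

end PartialFourier

/-! ### Separating the periodic variable and identifying functions on the spectrum -/

section Reduction

variable {d : ℕ} {T : ℝ} {A : MeanValueAlgebra}

instance : SFinite (measTXS A d T) := by unfold measTXS; infer_instance

/-- Adjoining the periodic variable. -/
noncomputable def joinCell (A : MeanValueAlgebra) (d : ℕ) :
    (ℝ × Space d × A.Spectrum) × Space d ≃ᵐ ℝ × Space d × A.Spectrum × Space d :=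
  MeasurableEquiv.prodAssoc.trans ((MeasurableEquiv.refl ℝ).prodCongr MeasurableEquiv.prodAssoc)

theorem joinCell_apply (z : (ℝ × Space d × A.Spectrum) × Space d) :
    joinCell A d z = (z.1.1, z.1.2.1, z.1.2.2, z.2) := rfl

theorem measurePreserving_joinCell :
    MeasurePreserving (joinCell A d) ((measTXS A d T).prod (volume.restrict (cell d)))
      (measTXSY A d T) :=
  ((MeasurePreserving.id _).prod (measurePreserving_prodAssoc volume A.beta _)).comp
    (measurePreserving_prodAssoc (volume.restrict (Ioo 0 T)) (volume.prod A.beta)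
      (volume.restrict (cell d)))

/-- Forgetting the periodic variable. -/
theorem measurePreserving_forgetCell :
    MeasurePreserving (fun q : ℝ × Space d × A.Spectrum × Space d => (q.1, q.2.1, q.2.2.1))
      (measTXSY A d T) (measTXS A d T) :=
  measurePreserving_fst.comp (measurePreserving_joinCell (A := A) (d := d) (T := T)).symm

theorem MemLp.comp_joinCell {h : ℝ × Space d × A.Spectrum × Space d → ℂ}
    (hh : MemLp h 2 (measTXSY A d T)) :
    MemLp (h ∘ joinCell A d) 2 ((measTXS A d T).prod (volume.restrict (cell d))) :=
  hh.comp_measurePreserving measurePreserving_joinCell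

/-- The Fourier coefficients in the periodic variable. -/
noncomputable def cellCoeff (h : ℝ × Space d × A.Spectrum × Space d → ℂ) (k : Fin d → ℤ) :
    ℝ × Space d × A.Spectrum → ℂ :=
  coeff (h ∘ joinCell A d) k

theorem memLp_cellCoeff {h : ℝ × Space d × A.Spectrum × Space d → ℂ}
    (hh : MemLp h 2 (measTXSY A d T)) (k : Fin d → ℤ) :
    MemLp (cellCoeff h k) 2 (measTXS A d T) :=
  memLp_coeff (MemLp.comp_joinCell hh) k

theorem cellCoeff_forgetCell (U : ℝ × Space d × A.Spectrum → ℂ) (k : Fin d → ℤ)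
    (p : ℝ × Space d × A.Spectrum) :
    cellCoeff (fun q => U (q.1, q.2.1, q.2.2.1)) k p = if 0 = k then U p else 0 := by
  have := coeff_mul_expo U 0 k p
  simp only [expo_zero, mul_one] at this
  exact this

/-- The test function `g(t) s(F(X))`. -/
noncomputable def spectralTest (g : ℝ → ℂ) (F : Space d → A.Elem)
    (p : ℝ × Space d × A.Spectrum) : ℂ :=
  g p.1 * p.2.2 (F p.2.1)

/-- Fubini in y. The frequency is negated because the coefficient of order k is the integral against
the exponential of frequency -k. -/
theorem integral_mul_limTest {h : ℝ × Space d × A.Spectrum × Space d → ℂ}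
    (hh : MemLp h 2 (measTXSY A d T)) {g : ℝ → ℂ} (hg : Continuous g) {G : ℝ}
    (hG : ∀ t, ‖g t‖ ≤ G) (k : Fin d → ℤ) {F : Space d → A.Elem} (hF : Continuous F)
    (hFc : HasCompactSupport F) :
    Integrable (fun p => cellCoeff h k p * spectralTest g F p) (measTXS A d T) ∧
    ∫ q, h q * limTest g (-k) F q ∂(measTXSY A d T)
      = ∫ p, cellCoeff h k p * spectralTest g F p ∂(measTXS A d T) := by
  obtain ⟨M, hM⟩ := hFc.exists_bound_of_continuous hF
  obtain ⟨R, hR⟩ := exists_norm_bound_of_hasCompactSupport hFc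
  have h1 : Integrable ((fun q => h q * limTest g (-k) F q) ∘ joinCell A d)
      ((measTXS A d T).prod (volume.restrict (cell d))) :=
    measurePreserving_joinCell.integrable_comp_of_integrable
      (integrable_mul_limTest hg hG (-k) hF hM hR hh)
  have h2 : ∀ p, ∫ y in cell d, ((fun q => h q * limTest g (-k) F q) ∘ joinCell A d) (p, y)
      = cellCoeff h k p * spectralTest g F p := fun p => by
    rw [cellCoeff, coeff, ← integral_mul_const]
    refine integral_congr_ae (ae_of_all _ fun y => ?_)
    simp only [Function.comp_apply, limTest, spectralTest, joinCell_apply]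
    ring
  constructor
  · simpa only [h2] using h1.integral_prod_left
  · rw [← measurePreserving_joinCell.integral_comp' (fun q => h q * limTest g (-k) F q)]
    refine (integral_prod _ h1).trans ?_
    simp only [h2]

theorem integrable_mul_spectralTest {w : ℝ × Space d × A.Spectrum → ℂ}
    (hw : MemLp w 2 (measTXS A d T)) {g : ℝ → ℂ} (hg : Continuous g) {G : ℝ}
    (hG : ∀ t, ‖g t‖ ≤ G) {F : Space d → A.Elem} (hF : Continuous F)
    (hFc : HasCompactSupport F) :
    Integrable (fun p => w p * spectralTest g F p) (measTXS A d T) := by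
  have := (integral_mul_limTest (hw.comp_measurePreserving measurePreserving_forgetCell) hg hG 0
    hF hFc).1
  refine this.congr (ae_of_all _ fun p => ?_)
  have h0 := cellCoeff_forgetCell w 0 p
  rw [if_pos rfl] at h0
  simp only [← h0]
  rfl

theorem spectralTest_smul (g : ℝ → ℂ) (φ : Space d → ℂ) (f : A.Elem)
    (p : ℝ × Space d × A.Spectrum) :
    spectralTest g (fun X => φ X • f) p = g p.1 * (φ p.2.1 * p.2.2 f) := by
  rw [spectralTest, map_smul, smul_eq_mul]

theorem ae_eq_zero_of_integral_spectralTest {w : ℝ × Space d × A.Spectrum → ℂ}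
    (hw : MemLp w 2 (measTXS A d T))
    (h : ∀ g : ℝ → ℂ, ContDiff ℝ ∞ g → HasCompactSupport g → tsupport g ⊆ Ioo 0 T →
      ∀ φ : Space d → ℂ, ContDiff ℝ ∞ φ → HasCompactSupport φ → ∀ f : A.Elem,
        ∫ p, w p * spectralTest g (fun X => φ X • f) p ∂(measTXS A d T) = 0) :
    w =ᵐ[measTXS A d T] 0 := by
  have bddc : ∀ {X : Type} [TopologicalSpace X] [MeasurableSpace X] [BorelSpace X]
      [SecondCountableTopology X] {f : X → ℂ} (μ : Measure X), Continuous f → HasCompactSupport f →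
      AEStronglyMeasurable f μ ∧ ∃ C, ∀ x, ‖f x‖ ≤ C := fun μ hf hc =>
    ⟨hf.aestronglyMeasurable, hc.exists_bound_of_continuous hf⟩
  have hdet := (determining_contDiff_Ioo T).prod
    ((determining_contDiff d).prod A.determining_gelfand
      (fun φ hφ => bddc _ hφ.1.continuous hφ.2) ?_) (fun g hg => bddc _ hg.1.continuous hg.2.1) ?_
  rotate_left
  · rintro _ ⟨f, rfl⟩
    exact ⟨((gelfandTransform ℂ A.Elem f).continuous).aestronglyMeasurable, ‖f‖,
      fun s => A.norm_char_le s f⟩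
  · rintro _ ⟨φ, hφ, _, ⟨f, rfl⟩, rfl⟩
    obtain ⟨C, hC⟩ := hφ.2.exists_bound_of_continuous hφ.1.continuous
    refine ⟨((hφ.1.continuous.comp continuous_fst).mul
      ((gelfandTransform ℂ A.Elem f).continuous.comp continuous_snd)).aestronglyMeasurable,
      C * ‖f‖, fun x => ?_⟩
    rw [norm_mul]
    exact mul_le_mul (hC _) (A.norm_char_le _ _) (norm_nonneg _) ((norm_nonneg _).trans (hC 0))
  -- An L² function on the unbounded space need not be integrable, as determining classes require.
  -- It is cut off by a bump equal to 1 on the ball, which is then absorbed into the test function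
  -- φ.
  have key : ∀ n : ℕ, ∀ᵐ p ∂(measTXS A d T), ‖p.2.1‖ ≤ n → w p = 0 := by
    intro n
    let b : ContDiffBump (0 : Space d) := ⟨n + 1, n + 2, by positivity, by linarith⟩
    let χ : Space d → ℂ := fun x => (b x : ℂ)
    have hχ : ContDiff ℝ ∞ χ := Complex.ofRealCLM.contDiff.comp b.contDiff
    have hχc : HasCompactSupport χ :=
      b.hasCompactSupport.comp_left (g := fun r : ℝ => (r : ℂ)) Complex.ofReal_zero
    have hi := integrable_mul_spectralTest hw (g := fun _ => 1) continuous_const (G := 1)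
      (fun _ => by simp) (F := fun X => χ X • (1 : A.Elem)) (hχ.continuous.smul continuous_const)
      hχc.smul_right
    have := hdet _ hi ?_
    · filter_upwards [this] with p hp hpn
      have h1 : χ p.2.1 = 1 := by
        simp only [χ]
        rw [b.one_of_mem_closedBall, Complex.ofReal_one]
        simp only [mem_closedBall_zero_iff, b]
        linarith
      simpa [spectralTest, h1] using hp
    · rintro _ ⟨g, hg, _, ⟨φ, hφ, _, ⟨f, rfl⟩, rfl⟩, rfl⟩
      rw [← h g hg.1 hg.2.1 hg.2.2 (fun x => χ x * φ x) (hχ.mul hφ.1) hφ.2.mul_left f, measTXS]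
      refine integral_congr_ae (ae_of_all _ fun p => ?_)
      simp only [spectralTest_smul, map_one]
      ring
  filter_upwards [ae_all_iff.2 key] with p hp
  obtain ⟨n, hn⟩ := exists_nat_ge ‖p.2.1‖
  exact hp n hn

end Reduction

/-! ### Structure of the limits: zero mode, weak gradient and corrector -/

section LimitStructure

variable {d : ℕ} {T : ℝ} {A : MeanValueAlgebra} {Φ : ℝ → Space d → Space d}
  {Jt : Fin d → Fin d → Space d → A.Elem} {ε : ℕ → ℝ} {u : ℕ → ℝ × Space d → ℂ}
  {gradu : ℕ → Fin d → ℝ × Space d → ℂ}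
  {u₀ : ℝ × Space d × A.Spectrum × Space d → ℂ}
  {v₀ : Fin d → ℝ × Space d × A.Spectrum × Space d → ℂ}

theorem spectralTest_flowDeriv (g : ℝ → ℂ) {φ : Space d → ℂ} (hφ : ContDiff ℝ 1 φ) (f : A.Elem)
    (i j : Fin d) (p : ℝ × Space d × A.Spectrum) :
    spectralTest g (flowDeriv Jt (fun X => φ X • f) i j) p
      = g p.1 * p.2.2 f * (fderiv ℝ φ p.2.1 (basisVec j) * p.2.2 (Jt j i p.2.1)) := by
  have h : fderiv ℝ (fun X => φ X • f) p.2.1 (basisVec j)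
      = fderiv ℝ φ p.2.1 (basisVec j) • f := by
    rw [((hφ.differentiable one_ne_zero _).hasFDerivAt.smul_const f).fderiv]
    rfl
  rw [spectralTest, flowDeriv, h, map_mul, map_smul, smul_eq_mul]
  ring

/-- Reordering the variables so that `X` comes last. -/
noncomputable def swapSpectrum (A : MeanValueAlgebra) (d : ℕ) :
    (ℝ × A.Spectrum) × Space d ≃ᵐ ℝ × Space d × A.Spectrum :=
  MeasurableEquiv.prodAssoc.trans ((MeasurableEquiv.refl ℝ).prodCongr MeasurableEquiv.prodComm)

theorem swapSpectrum_apply (r : ℝ × A.Spectrum) (X : Space d) :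
    swapSpectrum A d (r, X) = (r.1, X, r.2) := rfl

theorem measurePreserving_swapSpectrum :
    MeasurePreserving (swapSpectrum A d)
      (((volume.restrict (Ioo 0 T)).prod A.beta).prod volume) (measTXS A d T) :=
  ((MeasurePreserving.id _).prod Measure.measurePreserving_swap).comp
    (measurePreserving_prodAssoc (volume.restrict (Ioo 0 T)) A.beta volume)

namespace GradientSequence

variable (S : GradientSequence T Φ Jt ε u gradu u₀ v₀)
include S

theorem cellCoeff_eq_zero {k : Fin d → ℤ} (hk : k ≠ 0) :
    cellCoeff u₀ k =ᵐ[measTXS A d T] 0 := by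
  refine ae_eq_zero_of_integral_spectralTest (memLp_cellCoeff S.conv.2.1 k)
    fun g hg hgc hgT φ hφ hφc f => ?_
  obtain ⟨G, hG⟩ := hgc.exists_bound_of_continuous hg.continuous
  have hF : ContDiff ℝ ∞ fun X => φ X • f := hφ.smul contDiff_const
  rw [← (integral_mul_limTest S.conv.2.1 hg.continuous hG k hF.continuous hφc.smul_right).2]
  exact S.integral_limit_eq_zero hg hgc hgT (neg_ne_zero.2 hk) hF hφc.smul_right

theorem sum_integral_cellCoeff {g : ℝ → ℂ} (hg : ContDiff ℝ ∞ g)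
    (hgc : HasCompactSupport g) (hgT : tsupport g ⊆ Ioo 0 T) (k : Fin d → ℤ)
    {F : Space d → A.Elem} (hF : ContDiff ℝ ∞ F) (hFc : HasCompactSupport F) {ξ : Fin d → ℂ}
    (hξ : ∑ i, ξ i * k i = 0) :
    ∑ i, ξ i * ∫ p, cellCoeff (v₀ i) k p * spectralTest g F p ∂(measTXS A d T)
      = -∑ i, ξ i * ∑ j, ∫ p, cellCoeff u₀ k p * spectralTest g (flowDeriv Jt F i j) p
        ∂(measTXS A d T) := by
  obtain ⟨G, hG⟩ := hgc.exists_bound_of_continuous hg.continuous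
  obtain ⟨R, hR⟩ := exists_norm_bound_of_hasCompactSupport hFc
  have h := S.sum_integral_limit hg hgc hgT (-k) hF hFc (ξ := ξ) (by simp [hξ])
  simp_rw [fun i => (integral_mul_limTest (S.conv_grad i).2.1 hg.continuous hG k hF.continuous
    hFc).2, fun i j => (integral_mul_limTest S.conv.2.1 hg.continuous hG k
    (continuous_flowDeriv S.flowJacobian.cont (hF.of_le (by simp)) i j)
    (hasCompactSupport_of_norm (flowDeriv_eq_zero hR i j))).2] at h
  exact h

theorem cellCoeff_grad_parallel {k : Fin d → ℤ} (hk : k ≠ 0) (i l : Fin d) :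
    ∀ᵐ p ∂(measTXS A d T), (k l : ℂ) * cellCoeff (v₀ i) k p = k i * cellCoeff (v₀ l) k p := by
  have hm := fun i => memLp_cellCoeff (S.conv_grad i).2.1 k
  have h0 := ae_eq_zero_of_integral_spectralTest (((hm i).const_mul (k l : ℂ)).sub
    ((hm l).const_mul (k i : ℂ))) fun g hg hgc hgT φ hφ hφc f => ?_
  · filter_upwards [h0] with p hp
    exact sub_eq_zero.1 hp
  · obtain ⟨G, hG⟩ := hgc.exists_bound_of_continuous hg.continuous
    have hF : ContDiff ℝ ∞ fun X => φ X • f := hφ.smul contDiff_const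
    have hi := fun i => integrable_mul_spectralTest (hm i) hg.continuous hG hF.continuous
      (hφc.smul_right (f' := fun _ => f))
    have h1 := S.sum_integral_cellCoeff hg hgc hgT k hF hφc.smul_right
      -- The vector k_l e_i - k_i e_l is orthogonal to k, and pairing with it measures the failure
      -- of parallelism in the coordinates i and l.
      (ξ := fun m => (if m = i then (k l : ℂ) else 0) - if m = l then (k i : ℂ) else 0)
      (by simp [sub_mul, Finset.sum_sub_distrib]; ring)
    have h2 : ∀ i j, ∫ p, cellCoeff u₀ k p
        * spectralTest g (flowDeriv Jt (fun X => φ X • f) i j) p ∂(measTXS A d T) = 0 :=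
      fun i j => by
        refine (integral_congr_ae ?_).trans (integral_zero _ _)
        filter_upwards [S.cellCoeff_eq_zero hk] with p hp
        simp [hp]
    simp only [h2, sub_mul, Finset.sum_sub_distrib, ite_mul, zero_mul, Finset.sum_ite_eq',
      Finset.mem_univ, if_true, Finset.sum_const_zero, mul_zero, neg_zero] at h1
    rw [← h1, ← integral_const_mul, ← integral_const_mul,
      ← integral_sub ((hi i).const_mul _) ((hi l).const_mul _)]
    refine integral_congr_ae (ae_of_all _ fun p => ?_)
    simp only [Pi.sub_apply]
    ring

theorem ae_eq_cellCoeff_zero :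
    ∀ᵐ q ∂(measTXSY A d T), u₀ q = cellCoeff u₀ 0 (q.1, q.2.1, q.2.2.1) := by
  have hU := (memLp_cellCoeff S.conv.2.1 0).comp_measurePreserving
    (measurePreserving_forgetCell (A := A) (d := d) (T := T))
  have hd := MemLp.comp_joinCell (S.conv.2.1.sub hU)
  have h0 := ae_eq_zero_of_coeff hd fun k => ?_
  · have := (measurePreserving_joinCell (A := A) (d := d) (T := T)).symm.quasiMeasurePreserving.ae
      h0
    filter_upwards [this] with q hq
    simp only [Function.comp_apply, MeasurableEquiv.apply_symm_apply] at hq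
    exact sub_eq_zero.1 hq
  · refine (coeff_sub (MemLp.comp_joinCell S.conv.2.1) (MemLp.comp_joinCell hU) k).trans ?_
    by_cases hk : k = 0
    · subst hk
      refine ae_of_all _ fun p => ?_
      have := cellCoeff_forgetCell (cellCoeff u₀ 0) 0 p
      rw [if_pos rfl] at this
      exact sub_eq_zero.2 this.symm
    · filter_upwards [S.cellCoeff_eq_zero hk] with p hp
      have := cellCoeff_forgetCell (cellCoeff u₀ 0) k p
      rw [if_neg (Ne.symm hk)] at this
      exact (congrArg₂ (· - ·) hp this).trans (sub_zero _)

/-- At k = 0 the vector ξ = e_i is admissible, so the limit identity holds for each component.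
Varying g and f localizes it in (t, s), outside a null set that still depends on φ. -/
theorem integral_firstOrder_eq_zero {φ : Space d → ℂ} (hφ : ContDiff ℝ ∞ φ)
    (hφc : HasCompactSupport φ) (i : Fin d) :
    ∀ᵐ r ∂((volume.restrict (Ioo 0 T)).prod A.beta),
      ∫ X, firstOrder (fun X => cellCoeff (v₀ i) 0 (r.1, X, r.2))
        (fun j X => cellCoeff u₀ 0 (r.1, X, r.2) * r.2 (Jt j i X)) φ X = 0 := by
  have hφ1 : ContDiff ℝ 1 φ := hφ.of_le (by simp)
  have hF : ∀ f : A.Elem, ContDiff ℝ ∞ fun X => φ X • f := fun f => hφ.smul contDiff_const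
  have hFc : ∀ f : A.Elem, HasCompactSupport fun X => φ X • f := fun f => hφc.smul_right
  have hV := memLp_cellCoeff (S.conv_grad i).2.1 0
  have hU := memLp_cellCoeff S.conv.2.1 0
  have iV : ∀ {g : ℝ → ℂ}, Continuous g → (∃ G, ∀ t, ‖g t‖ ≤ G) → ∀ f : A.Elem,
      Integrable (fun p => cellCoeff (v₀ i) 0 p * spectralTest g (fun X => φ X • f) p)
        (measTXS A d T) := fun hg ⟨G, hG⟩ f =>
    integrable_mul_spectralTest hV hg hG (hF f).continuous (hFc f)
  have iU : ∀ {g : ℝ → ℂ}, Continuous g → (∃ G, ∀ t, ‖g t‖ ≤ G) → ∀ (f : A.Elem) (j : Fin d),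
      Integrable (fun p => cellCoeff u₀ 0 p
        * spectralTest g (flowDeriv Jt (fun X => φ X • f) i j) p) (measTXS A d T) :=
    fun hg ⟨G, hG⟩ f j => by
      obtain ⟨R, hR⟩ := exists_norm_bound_of_hasCompactSupport (hFc f)
      exact integrable_mul_spectralTest hU hg hG
        (continuous_flowDeriv S.flowJacobian.cont ((hF f).of_le (by simp)) i j)
        (hasCompactSupport_of_norm (flowDeriv_eq_zero hR i j))
  let Ψ : ℝ × Space d × A.Spectrum → ℂ := fun p =>
    firstOrder (fun X => cellCoeff (v₀ i) 0 (p.1, X, p.2.2))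
      (fun j X => cellCoeff u₀ 0 (p.1, X, p.2.2) * p.2.2 (Jt j i X)) φ p.2.1
  have eΨ : ∀ (g : ℝ → ℂ) (f : A.Elem) p, Ψ p * (g p.1 * p.2.2 f)
      = cellCoeff (v₀ i) 0 p * spectralTest g (fun X => φ X • f) p
        + ∑ j, cellCoeff u₀ 0 p * spectralTest g (flowDeriv Jt (fun X => φ X • f) i j) p := by
    intro g f p
    simp only [Ψ, firstOrder, spectralTest_smul, spectralTest_flowDeriv g hφ1, add_mul,
      Finset.sum_mul]
    congr 1
    · ring
    · exact Finset.sum_congr rfl fun j _ => by ring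
  have iΨ : ∀ {g : ℝ → ℂ}, Continuous g → (∃ G, ∀ t, ‖g t‖ ≤ G) → ∀ f : A.Elem,
      Integrable (fun p => Ψ p * (g p.1 * p.2.2 f)) (measTXS A d T) := fun hg hG f => by
    simp only [eΨ]
    exact (iV hg hG f).add (integrable_finsetSum _ fun j _ => iU hg hG f j)
  have i1 : Integrable (Ψ ∘ swapSpectrum A d)
      (((volume.restrict (Ioo 0 T)).prod A.beta).prod volume) := by
    refine measurePreserving_swapSpectrum.integrable_comp_of_integrable ?_
    simpa using iΨ (g := fun _ => 1) continuous_const ⟨1, fun _ => by simp⟩ 1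
  have hdet := (determining_contDiff_Ioo T).prod A.determining_gelfand
    (fun g hg => ⟨hg.1.continuous.aestronglyMeasurable,
      hg.2.1.exists_bound_of_continuous hg.1.continuous⟩) (by
      rintro _ ⟨f, rfl⟩
      exact ⟨((gelfandTransform ℂ A.Elem f).continuous).aestronglyMeasurable, ‖f‖,
        fun s => A.norm_char_le s f⟩)
  refine hdet _ i1.integral_prod_left ?_
  rintro _ ⟨g, hg, _, ⟨f, rfl⟩, rfl⟩
  have hG := hg.2.1.exists_bound_of_continuous hg.1.continuous
  have i2 := measurePreserving_swapSpectrum.integrable_comp_of_integrable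
    (iΨ hg.1.continuous hG f)
  have e1 := (integral_prod _ i2).symm.trans
    (measurePreserving_swapSpectrum.integral_comp' fun p => Ψ p * (g p.1 * p.2.2 f))
  simp only [Function.comp_apply, swapSpectrum_apply, integral_mul_const] at e1
  refine e1.trans ?_
  simp only [eΨ]
  rw [integral_add (iV hg.1.continuous hG f)
    (integrable_finsetSum _ fun j _ => iU hg.1.continuous hG f j),
    integral_finsetSum _ fun j _ => iU hg.1.continuous hG f j]
  have h1 := S.sum_integral_cellCoeff hg.1 hg.2.1 hg.2.2 0 (hF f) (hFc f) (ξ := Pi.single i 1)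
    (by simp)
  simp only [Pi.single_apply, ite_mul, one_mul, zero_mul, Finset.sum_ite_eq', Finset.mem_univ,
    if_true] at h1
  rw [h1, neg_add_cancel]

theorem hasWeakGradient_cellCoeff :
    ∀ᵐ r ∂((volume.restrict (Ioo 0 T)).prod A.beta),
      HasWeakGradient (fun X => cellCoeff u₀ 0 (r.1, X, r.2)) fun k X =>
        ∑ i, cellCoeff (v₀ i) 0 (r.1, X, r.2) * r.2 (invJac Jt i k X) := by
  -- A countable family yields one exceptional null set in (t, s); outside it the identity extends
  -- to all C¹ tests, as the chart argument needs.
  obtain ⟨D, hDc, hDs, hD⟩ := exists_countable_test d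
  have hs : ∀ {w : ℝ × Space d × A.Spectrum → ℂ}, MemLp w 2 (measTXS A d T) →
      ∀ᵐ r ∂((volume.restrict (Ioo 0 T)).prod A.beta),
        LocallyIntegrable fun X => w (r.1, X, r.2) := fun hw => by
    filter_upwards [MemLp.ae_slice (hw.comp_measurePreserving measurePreserving_swapSpectrum)]
      with r hr
    exact hr.locallyIntegrable (by norm_num)
  have hV := ae_all_iff.2 fun i => hs (memLp_cellCoeff (S.conv_grad i).2.1 0)
  have h0 := (ae_ball_iff hDc).2 fun φ hφ => ae_all_iff.2 fun i =>
    S.integral_firstOrder_eq_zero (hDs φ hφ).1 (hDs φ hφ).2 i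
  filter_upwards [hs (memLp_cellCoeff S.conv.2.1 0), hV, h0] with r hUr hVr hr
  refine S.flowJacobian.hasWeakGradient_of_chart r.2 hUr hVr fun φ hφ hφc i => ?_
  refine hD _ _ (hVr i) (fun j => ?_) (fun φ hφ => hr φ hφ i) φ hφ hφc
  exact locallyIntegrableOn_univ.1 ((hUr.locallyIntegrableOn univ).mul_continuousOn
    ((map_continuous (CharacterSpace.toCLM r.2)).comp (S.flowJacobian.cont j i)).continuousOn
    isClosed_univ.isLocallyClosed)

theorem exists_potential_coeff (k : Fin d → ℤ) : ∃ b : ℝ × Space d × A.Spectrum → ℂ,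
    MemLp b 2 (measTXS A d T) ∧
    eLpNorm b 2 (measTXS A d T) ^ 2 ≤ ∑ i, eLpNorm (cellCoeff (v₀ i) k) 2 (measTXS A d T) ^ 2 ∧
    (k ≠ 0 → ∀ l, ∀ᵐ p ∂(measTXS A d T),
      cellCoeff (v₀ l) k p = 2 * Real.pi * Complex.I * k l * b p) := by
  by_cases hk : k = 0
  · exact ⟨0, MemLp.zero, by rw [eLpNorm_zero, zero_pow two_ne_zero]; exact zero_le, fun h => absurd hk h⟩
  obtain ⟨i, hi⟩ := Function.ne_iff.1 hk
  have hi' : (k i : ℂ) ≠ 0 := Int.cast_ne_zero.2 hi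
  have hm := memLp_cellCoeff (S.conv_grad i).2.1 k
  -- Any coordinate with k_i ≠ 0 serves, by parallelism. The divisor has modulus at least 2π > 1, so
  -- no norm is lost.
  refine ⟨fun p => (2 * Real.pi * Complex.I * k i)⁻¹ * cellCoeff (v₀ i) k p, hm.const_mul _, ?_,
    fun _ l => ?_⟩
  · refine le_trans ?_ (Finset.single_le_sum
      (f := fun i => eLpNorm (cellCoeff (v₀ i) k) 2 (measTXS A d T) ^ 2)
      (fun _ _ => zero_le) (Finset.mem_univ i))
    gcongr
    refine eLpNorm_mono fun p => ?_
    rw [norm_mul]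
    refine mul_le_of_le_one_left (norm_nonneg _) ?_
    rw [norm_inv]
    refine inv_le_one_of_one_le₀ ?_
    have h1 : (1 : ℝ) ≤ |(k i : ℝ)| := by
      exact_mod_cast Int.one_le_abs hi
    simp only [norm_mul, Complex.norm_I, Complex.norm_real, Complex.norm_intCast,
      RCLike.norm_ofNat, Real.norm_eq_abs, abs_of_pos Real.pi_pos, mul_one]
    nlinarith [Real.pi_gt_three]
  · filter_upwards [S.cellCoeff_grad_parallel hk i l] with p hp
    have hπ : (Real.pi : ℂ) ≠ 0 := Complex.ofReal_ne_zero.2 Real.pi_ne_zero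
    field_simp
    rw [hp, mul_comm]

theorem exists_corrector : ∃ u₁ : ℝ × Space d × A.Spectrum × Space d → ℂ,
    MemLp u₁ 2 (measTXSY A d T) ∧
    ∀ᵐ p ∂(measTXS A d T), HasTorusWeakGradient (fun y => u₁ (p.1, p.2.1, p.2.2, y))
      fun i y => v₀ i (p.1, p.2.1, p.2.2, y) - cellCoeff (v₀ i) 0 p := by
  choose b hb hbn hbc using S.exists_potential_coeff
  have hv := fun i => MemLp.comp_joinCell (S.conv_grad i).2.1
  -- Each b_k is dominated by the modes of v₀, whose squares are summable by Bessel.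
  have hs : ∑' k, eLpNorm (b k) 2 (measTXS A d T) ^ 2 ≠ ⊤ := by
    refine ne_top_of_le_ne_top ?_ (ENNReal.tsum_le_tsum hbn)
    rw [Summable.tsum_finsetSum fun _ _ => ENNReal.summable]
    refine ENNReal.sum_ne_top.2 fun i _ => ne_top_of_le_ne_top ?_ (tsum_eLpNorm_coeff_sq_le (hv i))
    exact ENNReal.pow_ne_top (hv i).eLpNorm_ne_top
  obtain ⟨w, hw, hwb⟩ := exists_memLp_of_coeff hb hs
  refine ⟨w ∘ (joinCell A d).symm, hw.comp_measurePreserving measurePreserving_joinCell.symm, ?_⟩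
  filter_upwards [MemLp.ae_slice hw, ae_all_iff.2 fun i => MemLp.ae_slice (hv i),
    ae_all_iff.2 hwb, ae_all_iff.2 fun k => eventually_imp_distrib_left.2 fun hk => ae_all_iff.2 (hbc k hk)]
    with p h1 h2 h3 h4
  replace h2 : ∀ i, MemLp (fun y => v₀ i (p.1, p.2.1, p.2.2, y)) 2 (volume.restrict (cell d)) := h2
  refine hasTorusWeakGradient_of_fourier h1 (fun i => (h2 i).sub (memLp_const _)) fun i k => ?_
  have e1 : ∫ y in cell d, w (p, y) * expo (-k) y = b k p := h3 k
  have e2 : ∫ y in cell d, (v₀ i (p.1, p.2.1, p.2.2, y) - cellCoeff (v₀ i) 0 p) * expo (-k) y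
      = cellCoeff (v₀ i) k p - if k = 0 then cellCoeff (v₀ i) 0 p else 0 := by
    simp only [sub_mul]
    rw [integral_sub (integrable_mul_expo (h2 i) _) (integrable_mul_expo (memLp_const _) _),
      integral_const_mul, setIntegral_cell_expo]
    simp only [neg_eq_zero, mul_ite, mul_one, mul_zero]
    rfl
  refine e2.trans ?_
  change _ = _ * ∫ y in cell d, w (p, y) * expo (-k) y
  rw [e1]
  -- At frequency zero both sides vanish: the mean of v₀ was subtracted and k_i = 0. The mean of u₁
  -- in y plays no role.
  by_cases hk : k = 0
  · subst hk
    simp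
  · rw [if_neg hk, sub_zero, h4 k hk i]

theorem memLp_sub_cellCoeff (i : Fin d) :
    MemLp (fun q => v₀ i q - cellCoeff (v₀ i) 0 (q.1, q.2.1, q.2.2.1)) 2 (measTXSY A d T) :=
  (S.conv_grad i).2.1.sub ((memLp_cellCoeff (S.conv_grad i).2.1 0).comp_measurePreserving
    measurePreserving_forgetCell)

/-- The gradient of U was defined by applying ᵀ(J⁻¹) to the zero mode of v₀, so applying ᵀJ recovers
that mode at every point. -/
theorem sum_char_mul_gradient (p : ℝ × Space d × A.Spectrum) (i : Fin d) :
    ∑ j, p.2.2 (Jt j i p.2.1) * ∑ l, cellCoeff (v₀ l) 0 p * p.2.2 (invJac Jt l j p.2.1)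
      = cellCoeff (v₀ i) 0 p := by
  simp_rw [Finset.mul_sum]
  rw [Finset.sum_comm]
  have : ∀ l, ∑ j, p.2.2 (Jt j i p.2.1) * (cellCoeff (v₀ l) 0 p * p.2.2 (invJac Jt l j p.2.1))
      = cellCoeff (v₀ l) 0 p * if l = i then 1 else 0 := fun l => by
    rw [← S.flowJacobian.sum_char_invJac_mul p.2.2 p.2.1 l i, Finset.mul_sum]
    exact Finset.sum_congr rfl fun j _ => by ring
  simp [this]

end GradientSequence

end LimitStructure

end SigmaFlow
-- Assembly of the decomposition
theorem mainTheorem4 (d : ℕ) (T : ℝ) (hT : 0 < T)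
    (A : SigmaFlow.MeanValueAlgebra)
    (Φ : ℝ → SigmaFlow.Space d → SigmaFlow.Space d) (hΦ : SigmaFlow.IsAdmissibleFlow Φ)
    -- the flow representation of the Jacobian matrix is a continuous map from `ℝ^d` to `A`
    (Jt : Fin d → Fin d → SigmaFlow.Space d → A.Elem)
    (hJt_cont : ∀ i j, Continuous (Jt i j))
    (hJt : ∀ i j X τ, (Jt i j X).1 τ = ((SigmaFlow.jacobian Φ τ (Φ τ X) i j : ℝ) : ℂ))
    (ε : ℕ → ℝ) (hε_pos : ∀ n, 0 < ε n) (hε : Tendsto ε atTop (𝓝 0))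
    (u : ℕ → ℝ × SigmaFlow.Space d → ℂ)
    (gradu : ℕ → Fin d → ℝ × SigmaFlow.Space d → ℂ)
    (hgradu : ∀ n, ∀ᵐ t ∂(volume.restrict (Ioo 0 T)),
      SigmaFlow.HasWeakGradient (fun x => u n (t, x)) (fun i x => gradu n i (t, x)))
    (hbdd : ∃ C : NNReal, ∀ n, eLpNorm (u n) 2 (SigmaFlow.measTX d T) ≤ C)
    (u₀ : ℝ × SigmaFlow.Space d × A.Spectrum × SigmaFlow.Space d → ℂ)
    (v₀ : Fin d → ℝ × SigmaFlow.Space d × A.Spectrum × SigmaFlow.Space d → ℂ)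
    (hu : SigmaFlow.SigmaConverges A d T Φ ε u u₀)
    (hv : ∀ i, SigmaFlow.SigmaConverges A d T Φ ε (fun n => gradu n i) (v₀ i)) :
    ∃ (U₀ : ℝ × SigmaFlow.Space d × A.Spectrum → ℂ)
      (gradU₀ : Fin d → ℝ × SigmaFlow.Space d × A.Spectrum → ℂ)
      (u₁ : ℝ × SigmaFlow.Space d × A.Spectrum × SigmaFlow.Space d → ℂ)
      (gradu₁ : Fin d → ℝ × SigmaFlow.Space d × A.Spectrum × SigmaFlow.Space d → ℂ),
      -- `u₀` does not depend on `y`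
      MemLp U₀ 2 (SigmaFlow.measTXS A d T) ∧
      (∀ᵐ q ∂(SigmaFlow.measTXSY A d T), u₀ q = U₀ (q.1, q.2.1, q.2.2.1)) ∧
      -- `gradU₀` is the weak gradient `∇_X u₀`
      (∀ᵐ r ∂((volume.restrict (Ioo 0 T)).prod A.beta),
        SigmaFlow.HasWeakGradient (fun X => U₀ (r.1, X, r.2))
          (fun i X => gradU₀ i (r.1, X, r.2))) ∧
      -- `u₁ ∈ L²((0,T) × ℝ^d × Δ(A); H¹(𝕋^d))`, with `gradu₁ = ∇_y u₁`
      MemLp u₁ 2 (SigmaFlow.measTXSY A d T) ∧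
      (∀ i, MemLp (gradu₁ i) 2 (SigmaFlow.measTXSY A d T)) ∧
      (∀ᵐ p ∂(SigmaFlow.measTXS A d T),
        SigmaFlow.HasTorusWeakGradient (fun y => u₁ (p.1, p.2.1, p.2.2, y))
          (fun i y => gradu₁ i (p.1, p.2.1, p.2.2, y))) ∧
      -- `v₀ = ᵀĴ(s, X) ∇_X u₀ + ∇_y u₁`
      (∀ i, ∀ᵐ q ∂(SigmaFlow.measTXSY A d T),
        v₀ i q = ∑ j, q.2.2.1 (Jt j i q.2.1) * gradU₀ j (q.1, q.2.1, q.2.2.1)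
          + gradu₁ i q) := by
  have S : SigmaFlow.GradientSequence T Φ Jt ε u gradu u₀ v₀ :=
    ⟨⟨hΦ, hJt_cont, hJt⟩, hε_pos, hε, hgradu, hbdd, hu, hv⟩
  obtain ⟨u₁, hu₁, hgrad⟩ := S.exists_corrector
  refine ⟨SigmaFlow.cellCoeff u₀ 0,
    fun k p => ∑ i, SigmaFlow.cellCoeff (v₀ i) 0 p * p.2.2 (SigmaFlow.invJac Jt i k p.2.1), u₁,
    fun i q => v₀ i q - SigmaFlow.cellCoeff (v₀ i) 0 (q.1, q.2.1, q.2.2.1),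
    SigmaFlow.memLp_cellCoeff S.conv.2.1 0, S.ae_eq_cellCoeff_zero, S.hasWeakGradient_cellCoeff,
    hu₁, S.memLp_sub_cellCoeff, hgrad, fun i => ae_of_all _ fun q => ?_⟩
  have h := S.sum_char_mul_gradient (q.1, q.2.1, q.2.2.1) i
  rw [h]
  ring
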